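/- Let $D^2\subset\mathbb{R}^2$ be the open unit disk and $m\in\mathbb{N}$. For a function $f$ on $D^2$ write $\nabla f=(\partial_{1}f,\partial_{2}f)$ and $\nabla^\perp f=(-\partial_{2}f,\partial_{1}f)$ (weak derivatives). Let $\Omega=(\Omega_1,\Omega_2)\in L^2(D^2,\mathbb{R}^2\otimes so(m))$ be a vector field with values in the antisymmetric real $m\times m$ matrices, and let $A,B\in W^{1,2}(D^2,M_m(\mathbb{R}))$ satisfy $$\nabla A-A\,\Omega=-\nabla^\perp B\quad\text{a.e. in }D^2 .$$ Suppose that $A$ is invertible almost everywhere and that $\|A\|_{L^\infty(D^2)}+\|A^{-1}\|_{L^\infty(D^2)}<+\infty$. Let $u\in W^{1,2}(D^2,\mathbb{R}^m)$. Then $u$ satisfies $$-\Delta u=\Omega\cdot\nabla u\quad\text{in }\mathcal{D}'(D^2),\qquad\text{i.e. } -\Delta u^i=\sum_{j=1}^m\Omega^i_j\cdot\nabla u^j\quad(i=1,\dots,m),$$ if and only if it satisfies the conservation law $$\operatorname{div}\big(A\nabla u-B\nabla^\perp u\big)=0\quad\text{in }\mathcal{D}'(D^2).$$ If this holds, then: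 (i) $u\in W^{1,p}_{loc}(D^2,\mathbb{R}^m)$ for every $1\le p<+\infty$; (ii) $u$ coincides almost everywhere with a map that belongs to $C^{0,\alpha}_{loc}(D^2,\mathbb{R}^m)$ for every $0<\alpha<1$; (iii) $u$ satisfies a Morrey decay estimate: there is $\alpha>0$ such that $$\sup_{p\in B_{1/2}(0),\;0<\rho<1/4}\rho^{-2\alpha}\int_{B_\rho(p)}|\nabla u|^2<+\infty ,$$ and the distribution $\Delta u$ is a locally integrable function on $D^2$ with $$\sup_{p\in B_{1/2}(0),\;0<\rho<1/4}\rho^{-\alpha}\int_{B_\rho(p)}|\Delta u|<+\infty .$$ -/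

import Mathlib

open MeasureTheory
open scoped ENNReal NNReal ContDiff Matrix Laplacian

noncomputable section

namespace SchrodingerSystem

/-- The Euclidean plane. -/
abbrev Plane : Type := EuclideanSpace ℝ (Fin 2)

/-- The open unit disk. -/
def D2 : Set Plane := Metric.ball 0 1

/-- Smooth real functions with compact support in `U`. -/
def IsTestFunction (U : Set Plane) (φ : Plane → ℝ) : Prop :=
  ContDiff ℝ ∞ φ ∧ HasCompactSupport φ ∧ tsupport φ ⊆ U

/-- The classical partial derivative in the `k`-th coordinate direction. -/
def partialDeriv (k : Fin 2) (φ : Plane → ℝ) (x : Plane) : ℝ :=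
  fderiv ℝ φ x (EuclideanSpace.single k 1)

/-- `g` is the distributional derivative of `f` in the `k`-th direction on `U`. -/
def IsWeakPartial (U : Set Plane) (k : Fin 2) (f g : Plane → ℝ) : Prop :=
  LocallyIntegrableOn f U ∧ LocallyIntegrableOn g U ∧
    ∀ φ : Plane → ℝ, IsTestFunction U φ →
      ∫ x in U, f x * partialDeriv k φ x = -∫ x in U, g x * φ x

open Classical in
/-- A representative of the weak derivative of `f` in the `k`-th direction on `U`; it is determined
up to a null set of the open set `U` when the weak derivative exists, and is `0` otherwise. -/
def weakPartial (U : Set Plane) (k : Fin 2) (f : Plane → ℝ) : Plane → ℝ :=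
  if h : ∃ g, IsWeakPartial U k f g then h.choose else 0

theorem isWeakPartial_weakPartial {U : Set Plane} {k : Fin 2} {f g : Plane → ℝ}
    (h : IsWeakPartial U k f g) : IsWeakPartial U k f (weakPartial U k f) := by
  have h' : ∃ g, IsWeakPartial U k f g := ⟨g, h⟩
  rw [weakPartial, dif_pos h']
  exact h'.choose_spec

/-- The Sobolev space `W^{1,p}(U)` of real functions. -/
def MemW1p (p : ℝ≥0∞) (U : Set Plane) (f : Plane → ℝ) : Prop :=
  MemLp f p (volume.restrict U) ∧
    ∀ k : Fin 2, ∃ g : Plane → ℝ, IsWeakPartial U k f g ∧ MemLp g p (volume.restrict U)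

/-- The local Sobolev space `W^{1,p}_loc(U)`: `W^{1,p}(V)` for every open `V` whose closure is
compact and contained in `U`. -/
def MemW1pLoc (p : ℝ≥0∞) (U : Set Plane) (f : Plane → ℝ) : Prop :=
  ∀ V : Set Plane, IsOpen V → IsCompact (closure V) → closure V ⊆ U → MemW1p p V f

/-- `Δ f = g` in the sense of distributions on `U`. -/
def IsWeakLaplacian (U : Set Plane) (f g : Plane → ℝ) : Prop :=
  LocallyIntegrableOn f U ∧ LocallyIntegrableOn g U ∧
    ∀ φ : Plane → ℝ, IsTestFunction U φ →
      ∫ x in U, f x * (Δ φ) x = ∫ x in U, g x * φ x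

/-- `div X = 0` in the sense of distributions on `U`, for `X = (X 0, X 1)`. -/
def IsWeakDivFree (U : Set Plane) (X : Fin 2 → Plane → ℝ) : Prop :=
  (∀ k, LocallyIntegrableOn (X k) U) ∧
    ∀ φ : Plane → ℝ, IsTestFunction U φ →
      ∫ x in U, ∑ k, X k x * partialDeriv k φ x = 0

/-- The weak gradient `∇f = (∂₁f, ∂₂f)` on the disk. -/
def grad (f : Plane → ℝ) (k : Fin 2) (x : Plane) : ℝ := weakPartial D2 k f x

/-- The rotated weak gradient `∇^⊥ f = (-∂₂f, ∂₁f)` on the disk. -/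
def gradPerp (f : Plane → ℝ) (k : Fin 2) (x : Plane) : ℝ :=
  ![-grad f 1 x, grad f 0 x] k

variable {m : ℕ}

/-- `∇u` for a map into `ℝ^m`, by components; `vecGrad u k x` is `∂ₖu(x)`. -/
def vecGrad (u : Plane → EuclideanSpace ℝ (Fin m)) (k : Fin 2) (x : Plane) : Fin m → ℝ :=
  fun i => grad (fun y => u y i) k x

/-- `∇^⊥ u` for a map into `ℝ^m`. -/
def vecGradPerp (u : Plane → EuclideanSpace ℝ (Fin m)) (k : Fin 2) (x : Plane) : Fin m → ℝ :=
  fun i => gradPerp (fun y => u y i) k x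

/-- `∇A` for a matrix valued map, by entries. -/
def matGrad (A : Plane → Matrix (Fin m) (Fin m) ℝ) (k : Fin 2) (x : Plane) :
    Matrix (Fin m) (Fin m) ℝ :=
  Matrix.of fun i j => grad (fun y => A y i j) k x

/-- `∇^⊥ B` for a matrix valued map, by entries. -/
def matGradPerp (B : Plane → Matrix (Fin m) (Fin m) ℝ) (k : Fin 2) (x : Plane) :
    Matrix (Fin m) (Fin m) ℝ :=
  Matrix.of fun i j => gradPerp (fun y => B y i j) k x

/-- `u ∈ W^{1,2}(D², ℝ^m)`. -/
def VecW12 (u : Plane → EuclideanSpace ℝ (Fin m)) : Prop :=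
  ∀ i, MemW1p 2 D2 fun x => u x i

/-- `A ∈ W^{1,2}(D², M_m(ℝ))`. -/
def MatW12 (A : Plane → Matrix (Fin m) (Fin m) ℝ) : Prop :=
  ∀ i j, MemW1p 2 D2 fun x => A x i j

/-- `A ∈ L^p(D², M_m(ℝ))`. -/
def MatMemLp (p : ℝ≥0∞) (A : Plane → Matrix (Fin m) (Fin m) ℝ) : Prop :=
  ∀ i j, MemLp (fun x => A x i j) p (volume.restrict D2)

/-- `Ω · ∇u = ∑ₖ Ωₖ ∂ₖu`. -/
def potentialTerm (Ω : Fin 2 → Plane → Matrix (Fin m) (Fin m) ℝ)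
    (u : Plane → EuclideanSpace ℝ (Fin m)) (x : Plane) : Fin m → ℝ :=
  ∑ k, Ω k x *ᵥ vecGrad u k x

/-- `-Δu = Ω · ∇u` in the sense of distributions on the disk. -/
def SolvesSchrodinger (Ω : Fin 2 → Plane → Matrix (Fin m) (Fin m) ℝ)
    (u : Plane → EuclideanSpace ℝ (Fin m)) : Prop :=
  ∀ i, IsWeakLaplacian D2 (fun x => u x i) (fun x => -potentialTerm Ω u x i)

/-- `div (A ∇u - B ∇^⊥ u) = 0` in the sense of distributions on the disk. -/
def ConservationLaw (A B : Plane → Matrix (Fin m) (Fin m) ℝ)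
    (u : Plane → EuclideanSpace ℝ (Fin m)) : Prop :=
  ∀ i, IsWeakDivFree D2 fun k x => (A x *ᵥ vecGrad u k x - B x *ᵥ vecGradPerp u k x) i

/-- For some `α > 0`, uniformly in `p ∈ B_{1/2}(0)` and `0 < ρ < 1/4`, the integral of `|∇u|²` over
`B_ρ(p)` is `O(ρ^{2α})`, and the distribution `Δu` is a function with `∫_{B_ρ(p)} |Δu| = O(ρ^α)`. -/
def MorreyDecay (u : Plane → EuclideanSpace ℝ (Fin m)) : Prop :=
  ∃ α C : ℝ, 0 < α ∧
    (∀ p ∈ Metric.ball (0 : Plane) (1 / 2), ∀ ρ : ℝ, 0 < ρ → ρ < 1 / 4 →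
      ∫ x in Metric.ball p ρ, ∑ k, ∑ i, vecGrad u k x i ^ 2 ≤ C * ρ ^ (2 * α)) ∧
    ∃ g : Plane → EuclideanSpace ℝ (Fin m),
      (∀ i, IsWeakLaplacian D2 (fun x => u x i) (fun x => g x i)) ∧
      ∀ p ∈ Metric.ball (0 : Plane) (1 / 2), ∀ ρ : ℝ, 0 < ρ → ρ < 1 / 4 →
        ∫ x in Metric.ball p ρ, ‖g x‖ ≤ C * ρ ^ α

/-- `u` agrees almost everywhere in the disk with a map that is `α`-Hölder continuous on every
compact subset of the open disk, for every `0 < α < 1`. -/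
def LocallyHolderAllExponents (u : Plane → EuclideanSpace ℝ (Fin m)) : Prop :=
  ∃ v : Plane → EuclideanSpace ℝ (Fin m), v =ᵐ[volume.restrict D2] u ∧
    ∀ α : ℝ≥0, 0 < α → α < 1 → ∀ K : Set Plane, IsCompact K → K ⊆ D2 →
      ∃ C : ℝ≥0, HolderOnWith C α v K

end SchrodingerSystem

end

namespace SchrodingerSystem

open Filter Topology Metric

/-! ### Classical calculus of smooth functions: coordinate derivatives, Jacobians, integration by
parts. -/

section Calculus

variable {f g h : Plane → ℝ} {k l : Fin 2} {x : Plane}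

/-! The equivalence is the product rule in weak form. A weak equation for `∇u` may be tested with a
bounded Sobolev function times a test function, so the system `-Δu = Ω·∇u` may be multiplied by `A`.
The result is `-div(A∇u) = (AΩ - ∇A)·∇u = ∇^⊥B·∇u`, and since `∇^⊥u` is divergence free the right
side is `-div(B∇^⊥u)`. This is the conservation law. Multiplying by `A⁻¹` goes back, once `A⁻¹` is
known to be of class `W^{1,2} ∩ L^∞`; this follows from Cramer's rule and a Neumann series for
`1/det A`, and `A⁻¹∇A + ∇(A⁻¹)A = 0` removes the extra terms
(`solvesSchrodinger_iff_conservationLaw`).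

For the regularity, the conservation law makes the divergence of `A∇u` a Jacobian of `B` and `u`,
while its curl is always a Jacobian of `A` and `u`. Jacobians in the plane are better than products
of two `L²` functions: `|∫ φ {a,b}| ≤ C ‖∇φ‖ ‖∇a‖ ‖∇b‖` in `L²` norms (`exists_trilinear_bound`, a
form of Wente's inequality). It is proved by bounding the logarithmic potential of `{a,b}` in the
sup norm: after integration by parts only the angular derivative of `b` on circles is left, and this
has mean zero. A Caccioppoli inequality then bounds the energy of the potential.

So on a small ball, where `∇A` and `∇B` have `L²` norm at most `δ`, the field `A∇u` is divergence
free and curl free up to an error `Cδ‖∇u‖` in the dual of `W^{1,2}_0`. Fields free of both decay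
like gradients of harmonic functions (`exists_duality_bound`), whence `‖∇u‖_{L²(B_ρ)} ≤ C(ρ/s +
δ)‖∇u‖_{L²(B_s)}` (`exists_decay_step`). Iteration over geometric radii gives `‖∇u‖_{L²(B_ρ)} ≤
Cρ^α` for every `α < 1`, locally uniformly in the centre (`exists_energy_decay`).

By Cauchy–Schwarz, `Δu = -Ω·∇u` then has mass `O(ρ^α)` on balls of radius `ρ`, for every `α < 1`. A
cutoff of `u` is a constant times the logarithmic potential of its Laplacian, which satisfies the
same bounds. Such a potential is Hölder continuous for every exponent below one, and its gradient
lies in every `L^p` with `p` finite (`MorreyDensity.exists_holder`, `MorreyDensity.memLp_gradPot`).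
-/

theorem contDiff_partialDeriv (hf : ContDiff ℝ ∞ f) (k : Fin 2) :
    ContDiff ℝ ∞ (partialDeriv k f) :=
  (hf.fderiv_right (m := ∞) (by simp)).clm_apply contDiff_const

theorem differentiableAt_of_smooth (hf : ContDiff ℝ ∞ f) (x : Plane) : DifferentiableAt ℝ f x :=
  (hf.differentiable (by simp)) x

theorem partialDeriv_mul (hf : ContDiff ℝ ∞ f) (hg : ContDiff ℝ ∞ g) (k : Fin 2) (x : Plane) :
    partialDeriv k (fun y => f y * g y) x =
      f x * partialDeriv k g x + partialDeriv k f x * g x := by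
  simp only [partialDeriv]
  rw [fderiv_fun_mul (differentiableAt_of_smooth hf x) (differentiableAt_of_smooth hg x)]
  simp [mul_comm]

theorem partialDeriv_add (hf : ContDiff ℝ ∞ f) (hg : ContDiff ℝ ∞ g) (k : Fin 2) (x : Plane) :
    partialDeriv k (fun y => f y + g y) x = partialDeriv k f x + partialDeriv k g x := by
  simp only [partialDeriv]
  rw [fderiv_fun_add (differentiableAt_of_smooth hf x) (differentiableAt_of_smooth hg x)]
  simp

theorem partialDeriv_sub_const (c : ℝ) (k : Fin 2) (x : Plane) :
    partialDeriv k (fun y => f y - c) x = partialDeriv k f x := by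
  simp [partialDeriv, fderiv_sub_const]

theorem partialDeriv_const_mul (c : ℝ) (hf : ContDiff ℝ ∞ f) (k : Fin 2) (x : Plane) :
    partialDeriv k (fun y => c * f y) x = c * partialDeriv k f x := by
  simp only [partialDeriv]
  rw [fderiv_const_mul (differentiableAt_of_smooth hf x)]
  simp

theorem partialDeriv_comm (hf : ContDiff ℝ ∞ f) (k l : Fin 2) (x : Plane) :
    partialDeriv k (partialDeriv l f) x = partialDeriv l (partialDeriv k f) x := by
  have hd : DifferentiableAt ℝ (fderiv ℝ f) x :=
    ((hf.fderiv_right (m := ∞) (by simp)).differentiable (by simp)) x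
  have key : ∀ i j : Fin 2, partialDeriv i (partialDeriv j f) x =
      fderiv ℝ (fderiv ℝ f) x (EuclideanSpace.single i 1) (EuclideanSpace.single j 1) := by
    intro i j
    unfold partialDeriv
    rw [fderiv_clm_apply hd (differentiableAt_const _)]
    simp
  rw [key, key]
  have := (hf.contDiffAt (x := x)).isSymmSndFDerivAt
    (by simpa using (WithTop.coe_le_coe.2 (le_top : (2 : ℕ∞) ≤ ⊤)))
  exact this _ _

theorem support_partialDeriv_subset (k : Fin 2) (f : Plane → ℝ) :
    Function.support (partialDeriv k f) ⊆ tsupport f := by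
  intro x hx
  refine support_fderiv_subset ℝ (f := f) ?_
  intro h
  exact hx (by simp [partialDeriv, h])

theorem tsupport_partialDeriv_subset (k : Fin 2) (f : Plane → ℝ) :
    tsupport (partialDeriv k f) ⊆ tsupport f :=
  closure_minimal (support_partialDeriv_subset k f) (isClosed_tsupport f)

theorem hasCompactSupport_partialDeriv (hf : HasCompactSupport f) (k : Fin 2) :
    HasCompactSupport (partialDeriv k f) :=
  hf.mono' (support_partialDeriv_subset k f)

theorem IsTestFunction.partialDeriv {U : Set Plane} (hf : IsTestFunction U f) (k : Fin 2) :
    IsTestFunction U (partialDeriv k f) :=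
  ⟨contDiff_partialDeriv hf.1 k, hasCompactSupport_partialDeriv hf.2.1 k,
    (tsupport_partialDeriv_subset k f).trans hf.2.2⟩

theorem IsTestFunction.mul_left {U : Set Plane} (hf : IsTestFunction U f) (hg : ContDiff ℝ ∞ g) :
    IsTestFunction U (fun x => g x * f x) :=
  ⟨hg.mul hf.1, hf.2.1.mul_left, (tsupport_mul_subset_right (f := g)).trans hf.2.2⟩

theorem IsTestFunction.mono {U V : Set Plane} (hf : IsTestFunction U f) (hUV : U ⊆ V) :
    IsTestFunction V f :=
  ⟨hf.1, hf.2.1, hf.2.2.trans hUV⟩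

theorem IsTestFunction.eq_zero {U : Set Plane} (hf : IsTestFunction U f) (hx : x ∉ U) :
    f x = 0 :=
  image_eq_zero_of_notMem_tsupport fun h => hx (hf.2.2 h)

theorem integral_mul_partialDeriv (hf : ContDiff ℝ ∞ f) (hg : ContDiff ℝ ∞ g)
    (hs : HasCompactSupport g) (k : Fin 2) :
    ∫ x, f x * partialDeriv k g x = - ∫ x, partialDeriv k f x * g x := by
  refine integral_mul_fderiv_eq_neg_fderiv_mul_of_integrable ?_ ?_ ?_
    (fun x _ => differentiableAt_of_smooth hf x) (fun x _ => differentiableAt_of_smooth hg x)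
  · exact ((contDiff_partialDeriv hf k).continuous.mul hg.continuous).integrable_of_hasCompactSupport
      hs.mul_left
  · exact (hf.continuous.mul (contDiff_partialDeriv hg k).continuous).integrable_of_hasCompactSupport
      (hasCompactSupport_partialDeriv hs k).mul_left
  · exact (hf.continuous.mul hg.continuous).integrable_of_hasCompactSupport hs.mul_left

theorem laplacian_eq_sum_partialDeriv (hf : ContDiff ℝ ∞ f) :
    Δ f = fun x => ∑ k, partialDeriv k (partialDeriv k f) x := by
  rw [InnerProductSpace.laplacian_eq_iteratedFDeriv_orthonormalBasis f
    (EuclideanSpace.basisFun (Fin 2) ℝ)]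
  funext x
  refine Finset.sum_congr rfl fun k _ => ?_
  have hd : DifferentiableAt ℝ (fderiv ℝ f) x :=
    ((hf.fderiv_right (m := ∞) (by simp)).differentiable (by simp)) x
  rw [iteratedFDeriv_two_apply]
  unfold partialDeriv
  rw [fderiv_clm_apply hd (differentiableAt_const _)]
  simp

theorem abs_partialDeriv_le_norm_fderiv (k : Fin 2) (f : Plane → ℝ) (x : Plane) :
    |partialDeriv k f x| ≤ ‖fderiv ℝ f x‖ := by
  have := (fderiv ℝ f x).le_opNorm (EuclideanSpace.single k (1 : ℝ))
  simpa [partialDeriv] using this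

theorem fderiv_apply_eq_partialDeriv (f : Plane → ℝ) (x v : Plane) :
    fderiv ℝ f x v = v 0 * partialDeriv 0 f x + v 1 * partialDeriv 1 f x := by
  have hv : v = v 0 • EuclideanSpace.single (0 : Fin 2) (1 : ℝ) +
      v 1 • EuclideanSpace.single (1 : Fin 2) (1 : ℝ) := by
    ext i
    fin_cases i <;> simp
  conv_lhs => rw [hv]
  simp [partialDeriv]

/-- The pointwise Jacobian determinant of `(a, b)`. -/
noncomputable def jac (a b : Plane → ℝ) (x : Plane) : ℝ :=
  partialDeriv 0 a x * partialDeriv 1 b x - partialDeriv 1 a x * partialDeriv 0 b x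

/-- The squared length of the classical gradient. -/
noncomputable def gradSq (f : Plane → ℝ) (x : Plane) : ℝ :=
  partialDeriv 0 f x ^ 2 + partialDeriv 1 f x ^ 2

theorem gradSq_nonneg (f : Plane → ℝ) (x : Plane) : 0 ≤ gradSq f x := by
  unfold gradSq; positivity

theorem contDiff_jac (hf : ContDiff ℝ ∞ f) (hg : ContDiff ℝ ∞ g) : ContDiff ℝ ∞ (jac f g) :=
  ((contDiff_partialDeriv hf 0).mul (contDiff_partialDeriv hg 1)).sub
    ((contDiff_partialDeriv hf 1).mul (contDiff_partialDeriv hg 0))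

theorem continuous_gradSq (hf : ContDiff ℝ ∞ f) : Continuous (gradSq f) :=
  ((contDiff_partialDeriv hf 0).continuous.pow 2).add ((contDiff_partialDeriv hf 1).continuous.pow 2)

theorem hasCompactSupport_jac (hf : HasCompactSupport f) : HasCompactSupport (jac f g) := by
  refine hf.mono' fun x hx => ?_
  by_contra h
  refine hx ?_
  have h0 : ∀ k, partialDeriv k f x = 0 := fun k => by
    by_contra h'
    exact h (support_partialDeriv_subset k f h')
  simp [jac, h0]

theorem support_gradSq_subset (f : Plane → ℝ) : Function.support (gradSq f) ⊆ tsupport f := by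
  intro x hx
  by_contra h
  have h0 : ∀ k, partialDeriv k f x = 0 := fun k => by
    by_contra h'
    exact h (support_partialDeriv_subset k f h')
  exact hx (by simp [gradSq, h0])

theorem hasCompactSupport_gradSq (hf : HasCompactSupport f) : HasCompactSupport (gradSq f) :=
  hf.mono' (support_gradSq_subset f)

theorem integrable_gradSq (hf : ContDiff ℝ ∞ f) (hs : HasCompactSupport f) :
    Integrable (gradSq f) :=
  (continuous_gradSq hf).integrable_of_hasCompactSupport (hasCompactSupport_gradSq hs)

theorem abs_jac_le (f g : Plane → ℝ) (x : Plane) : |jac f g x| ≤ (gradSq f x + gradSq g x) / 2 := by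
  unfold jac gradSq
  rw [abs_le]
  constructor <;>
  nlinarith [sq_nonneg (partialDeriv 0 f x + partialDeriv 1 g x),
    sq_nonneg (partialDeriv 0 f x - partialDeriv 1 g x),
    sq_nonneg (partialDeriv 1 f x + partialDeriv 0 g x),
    sq_nonneg (partialDeriv 1 f x - partialDeriv 0 g x)]

end Calculus

/-! ### Cauchy–Schwarz inequalities and optimization of weights. -/

section CauchySchwarz

variable {α : Type*} [MeasurableSpace α] {μ : Measure α} {f g : α → ℝ}

theorem integral_abs_mul_le_sqrt (hf : MemLp f 2 μ) (hg : MemLp g 2 μ) :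
    ∫ x, |f x| * |g x| ∂μ ≤ √(∫ x, f x ^ 2 ∂μ) * √(∫ x, g x ^ 2 ∂μ) := by
  have h := integral_mul_norm_le_Lp_mul_Lq (μ := μ) (f := f) (g := g) (p := 2) (q := 2)
    (by constructor <;> norm_num) (by simpa using hf) (by simpa using hg)
  simpa [Real.sqrt_eq_rpow] using h

theorem abs_integral_mul_le_sqrt (hf : MemLp f 2 μ) (hg : MemLp g 2 μ) :
    |∫ x, f x * g x ∂μ| ≤ √(∫ x, f x ^ 2 ∂μ) * √(∫ x, g x ^ 2 ∂μ) := by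
  refine (abs_integral_le_integral_abs).trans ?_
  simpa [abs_mul] using integral_abs_mul_le_sqrt hf hg

/-- A family of weighted arithmetic mean bounds gives a geometric mean bound. -/
theorem le_two_mul_sqrt_of_forall_weighted {X C P Q : ℝ} (hP : 0 ≤ P) (hQ : 0 ≤ Q) (hC : 0 ≤ C)
    (h : ∀ t : ℝ, 0 < t → X ≤ C * (t ^ 2 * P + (t⁻¹) ^ 2 * Q)) :
    X ≤ 2 * C * (√P * √Q) := by
  -- The optimal weight `t² = √Q/√P` is meaningless when `P` or `Q` vanishes; both are shifted by
  -- `δ`, which is then sent to zero.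
  have key : ∀ δ : ℝ, 0 < δ → X ≤ 2 * C * (√(P + δ) * √(Q + δ)) := by
    intro δ hδ
    have hp : 0 < √(P + δ) := Real.sqrt_pos.2 (by linarith)
    have hq : 0 < √(Q + δ) := Real.sqrt_pos.2 (by linarith)
    have hp2 := Real.sq_sqrt (show 0 ≤ P + δ by linarith)
    have hq2 := Real.sq_sqrt (show 0 ≤ Q + δ by linarith)
    set p := √(P + δ)
    set q := √(Q + δ)
    have := h √(q / p) (Real.sqrt_pos.2 (by positivity))
    rw [inv_pow, Real.sq_sqrt (by positivity)] at this
    refine this.trans ?_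
    have e1 : q / p * P ≤ q * p := by
      rw [div_mul_eq_mul_div, div_le_iff₀ hp]; nlinarith
    have e2 : (q / p)⁻¹ * Q ≤ q * p := by
      rw [inv_div, div_mul_eq_mul_div, div_le_iff₀ hq]; nlinarith
    nlinarith
  have hlim : Tendsto (fun δ : ℝ => 2 * C * (√(P + δ) * √(Q + δ))) (𝓝[>] 0)
      (𝓝 (2 * C * (√(P + 0) * √(Q + 0)))) := by
    refine Tendsto.mono_left (Continuous.tendsto ?_ _) nhdsWithin_le_nhds
    fun_prop
  simp only [add_zero] at hlim
  exact ge_of_tendsto hlim (by filter_upwards [self_mem_nhdsWithin] with δ hδ using key δ hδ)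

end CauchySchwarz

/-- Cutoff functions between concentric balls with radii in ratio two, with scale invariant
gradient bounds. -/
theorem exists_cutoff : ∃ C : ℝ, 0 < C ∧ ∀ (p : Plane) (r : ℝ), 0 < r →
    ∃ χ : Plane → ℝ, ContDiff ℝ ∞ χ ∧ HasCompactSupport χ ∧ tsupport χ ⊆ ball p (2 * r) ∧
      (∀ x ∈ closedBall p r, χ x = 1) ∧ (∀ x, 0 ≤ χ x) ∧ (∀ x, χ x ≤ 1) ∧
      ∀ k x, |partialDeriv k χ x| ≤ C / r := by
  -- The outer radius `3/2` keeps the closed support, after rescaling, inside the open ball of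
  -- radius `2r`.
  let β : ContDiffBump (0 : Plane) := ⟨1, 3 / 2, by norm_num, by norm_num⟩
  have hβ : ContDiff ℝ ∞ (β : Plane → ℝ) := β.contDiff
  have hβd : Continuous (fderiv ℝ (β : Plane → ℝ)) := hβ.continuous_fderiv (by simp)
  obtain ⟨C, hC⟩ := hβd.bounded_above_of_compact_support (β.hasCompactSupport.fderiv ℝ)
  refine ⟨max C 1, by positivity, fun p r hr => ?_⟩
  have hs : ContDiff ℝ ∞ (fun x : Plane => r⁻¹ • (x - p)) := by fun_prop
  have hsupp : tsupport (fun x => β (r⁻¹ • (x - p))) ⊆ closedBall p (3 / 2 * r) := by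
    refine closure_minimal (fun x hx => ?_) isClosed_closedBall
    have : r⁻¹ • (x - p) ∈ Function.support β := hx
    rw [β.support_eq, mem_ball_zero_iff, norm_smul, Real.norm_eq_abs, abs_of_pos (inv_pos.2 hr),
      inv_mul_lt_iff₀ hr] at this
    rw [mem_closedBall, dist_eq_norm]
    change ‖x - p‖ < r * (3 / 2) at this
    linarith
  refine ⟨fun x => β (r⁻¹ • (x - p)), hβ.comp hs, ?_, ?_, ?_, fun x => β.nonneg, fun x => β.le_one,
    fun k x => ?_⟩
  · exact (isCompact_closedBall p (3 / 2 * r)).of_isClosed_subset (isClosed_tsupport _) hsupp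
  · exact hsupp.trans (closedBall_subset_ball (by linarith))
  · intro x hx
    refine β.one_of_mem_closedBall ?_
    rw [mem_closedBall, dist_eq_norm] at hx
    rw [mem_closedBall_zero_iff, norm_smul, Real.norm_eq_abs, abs_of_pos (inv_pos.2 hr)]
    change r⁻¹ * ‖x - p‖ ≤ 1
    rw [inv_mul_le_iff₀ hr]; linarith
  · refine (abs_partialDeriv_le_norm_fderiv _ _ _).trans ?_
    have hd : HasFDerivAt (fun x : Plane => r⁻¹ • (x - p))
        (r⁻¹ • ContinuousLinearMap.id ℝ Plane) x :=
      ((hasFDerivAt_id x).sub_const p).const_smul r⁻¹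
    have hcomp := ((differentiableAt_of_smooth hβ (r⁻¹ • (x - p))).hasFDerivAt).comp x hd
    have : fderiv ℝ (fun x => β (r⁻¹ • (x - p))) x = _ := hcomp.fderiv
    rw [this]
    refine (ContinuousLinearMap.opNorm_comp_le _ _).trans ?_
    rw [norm_smul, Real.norm_eq_abs, abs_of_pos (inv_pos.2 hr), div_eq_mul_inv]
    have h1 : ‖ContinuousLinearMap.id ℝ Plane‖ ≤ 1 := ContinuousLinearMap.norm_id_le
    have h2 := hC (r⁻¹ • (x - p))
    have h3 : r⁻¹ * ‖ContinuousLinearMap.id ℝ Plane‖ ≤ r⁻¹ := by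
      have := inv_pos.2 hr
      nlinarith
    exact mul_le_mul (h2.trans (le_max_left _ _)) h3 (by positivity) (by positivity)

/-! ### The regularized logarithmic kernel and its approximate identity. -/

section Kernel

/-- A smooth regularization of the logarithmic kernel of the plane. -/
noncomputable def logKer (ε : ℝ) (z : Plane) : ℝ := Real.log (‖z‖ ^ 2 + ε ^ 2) / 2

/-- The Laplacian of `logKer ε`. -/
noncomputable def diracKer (ε : ℝ) (z : Plane) : ℝ := 2 * ε ^ 2 / (‖z‖ ^ 2 + ε ^ 2) ^ 2

/-- The total mass of the kernels `diracKer ε`. -/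
noncomputable def diracMass : ℝ := ∫ z, diracKer 1 z

/-- The regularized logarithmic potential of `g`. -/
noncomputable def pot (ε : ℝ) (g : Plane → ℝ) : Plane → ℝ :=
  convolution (logKer ε) g (ContinuousLinearMap.mul ℝ ℝ) volume

variable {ε : ℝ} {g : Plane → ℝ}

theorem norm_sq_add_pos (hε : 0 < ε) (z : Plane) : 0 < ‖z‖ ^ 2 + ε ^ 2 := by positivity

theorem contDiff_logKer (hε : 0 < ε) : ContDiff ℝ ∞ (logKer ε) := by
  unfold logKer
  refine ContDiff.div_const (ContDiff.log ?_ fun z => (norm_sq_add_pos hε z).ne') _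
  exact (contDiff_norm_sq ℝ).add contDiff_const

theorem hasFDerivAt_norm_sq_add (ε : ℝ) (z : Plane) :
    HasFDerivAt (fun y : Plane => ‖y‖ ^ 2 + ε ^ 2) (2 • innerSL ℝ z) z :=
  (hasStrictFDerivAt_norm_sq z).hasFDerivAt.add_const _

theorem partialDeriv_logKer (hε : 0 < ε) (k : Fin 2) (z : Plane) :
    partialDeriv k (logKer ε) z = z k / (‖z‖ ^ 2 + ε ^ 2) := by
  have h := ((hasFDerivAt_norm_sq_add ε z).log (norm_sq_add_pos hε z).ne').mul_const 2⁻¹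
  have h' : fderiv ℝ (logKer ε) z = _ := h.fderiv
  rw [partialDeriv, h']
  have hk : inner ℝ z (EuclideanSpace.single k (1 : ℝ)) = z k := by
    simp [EuclideanSpace.inner_single_right]
  have := (norm_sq_add_pos hε z).ne'
  simp [hk]
  field_simp

theorem partialDeriv_partialDeriv_logKer (hε : 0 < ε) (k : Fin 2) (z : Plane) :
    partialDeriv k (partialDeriv k (logKer ε)) z =
      1 / (‖z‖ ^ 2 + ε ^ 2) - 2 * z k ^ 2 / (‖z‖ ^ 2 + ε ^ 2) ^ 2 := by
  have e : partialDeriv k (logKer ε) = fun z : Plane => z k * (‖z‖ ^ 2 + ε ^ 2)⁻¹ := by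
    funext z; rw [partialDeriv_logKer hε, div_eq_mul_inv]
  have hp := (norm_sq_add_pos hε z).ne'
  have h1 : HasFDerivAt (fun z : Plane => z k) (EuclideanSpace.proj k : Plane →L[ℝ] ℝ) z :=
    (EuclideanSpace.proj k : Plane →L[ℝ] ℝ).hasFDerivAt
  have h2 := (hasDerivAt_inv hp).comp_hasFDerivAt z (hasFDerivAt_norm_sq_add ε z)
  have h := h1.mul h2
  rw [e, partialDeriv]
  have h' : fderiv ℝ (fun z : Plane => z k * (‖z‖ ^ 2 + ε ^ 2)⁻¹) z = _ := h.fderiv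
  rw [h']
  have hk : inner ℝ z (EuclideanSpace.single k (1 : ℝ)) = z k := by
    simp [EuclideanSpace.inner_single_right]
  simp [hk]
  field_simp
  ring

theorem norm_sq_eq_sum (z : Plane) : ‖z‖ ^ 2 = z 0 ^ 2 + z 1 ^ 2 := by
  rw [EuclideanSpace.norm_sq_eq]; simp [Fin.sum_univ_two]

theorem abs_apply_le_norm (z : Plane) (k : Fin 2) : |z k| ≤ ‖z‖ := by
  simpa using PiLp.norm_apply_le z k

theorem sum_partialDeriv_logKer (hε : 0 < ε) (z : Plane) :
    ∑ k, partialDeriv k (partialDeriv k (logKer ε)) z = diracKer ε z := by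
  simp only [partialDeriv_partialDeriv_logKer hε, Fin.sum_univ_two, diracKer]
  have hp := (norm_sq_add_pos hε z).ne'
  have := norm_sq_eq_sum z
  field_simp
  linarith

theorem abs_partialDeriv_logKer_le (hε : 0 < ε) (k : Fin 2) (z : Plane) :
    |partialDeriv k (logKer ε) z| ≤ ‖z‖⁻¹ := by
  rw [partialDeriv_logKer hε, abs_div, abs_of_pos (norm_sq_add_pos hε z)]
  rcases eq_or_ne z 0 with rfl | hz
  · simp
  have hz' : 0 < ‖z‖ := norm_pos_iff.2 hz
  rw [div_le_iff₀ (norm_sq_add_pos hε z)]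
  have := abs_apply_le_norm z k
  calc |z k| ≤ ‖z‖ := this
    _ = ‖z‖⁻¹ * ‖z‖ ^ 2 := by field_simp
    _ ≤ _ := by gcongr; nlinarith [sq_nonneg ε]

theorem diracKer_nonneg (ε : ℝ) (z : Plane) : 0 ≤ diracKer ε z := by unfold diracKer; positivity

theorem continuous_diracKer (hε : 0 < ε) : Continuous (diracKer ε) := by
  unfold diracKer
  exact continuous_const.div (by fun_prop) fun z => (pow_pos (norm_sq_add_pos hε z) 2).ne'

theorem integrable_diracKer_one : Integrable (diracKer 1) := by
  have h := integrable_rpow_neg_one_add_norm_sq (E := Plane) (μ := volume) (r := 4)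
    (by simp; norm_num)
  refine (h.const_mul 2).congr (ae_of_all _ fun z => ?_)
  have h0 : 0 < 1 + ‖z‖ ^ 2 := by positivity
  simp only [diracKer]
  rw [show (-4 / 2 : ℝ) = -(2 : ℕ) by norm_num, Real.rpow_neg h0.le, Real.rpow_natCast,
    add_comm (‖z‖ ^ 2)]
  simp [div_eq_mul_inv]

/-- The mass equals `2π`, but only its sign matters: it serves as a positive divisor throughout. -/
theorem diracMass_pos : 0 < diracMass := by
  refine (integral_pos_iff_support_of_nonneg (diracKer_nonneg 1) integrable_diracKer_one).2 ?_
  have : Function.support (diracKer 1) = Set.univ := by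
    ext z
    have := norm_sq_add_pos one_pos z
    simp only [Function.mem_support, Set.mem_univ, iff_true, diracKer]
    positivity
  rw [this]
  simp

theorem locallyIntegrable_logKer (hε : 0 < ε) : LocallyIntegrable (logKer ε) :=
  (contDiff_logKer hε).continuous.locallyIntegrable

theorem contDiff_pot (hε : 0 < ε) (hg : ContDiff ℝ ∞ g) (hs : HasCompactSupport g) :
    ContDiff ℝ ∞ (pot ε g) :=
  hs.contDiff_convolution_right _ (n := ⊤) (locallyIntegrable_logKer hε) hg

theorem pot_apply (x : Plane) : pot ε g x = ∫ t, logKer ε t * g (x - t) := by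
  simp [pot, convolution_def]

theorem partialDeriv_pot (hε : 0 < ε) (hg : ContDiff ℝ ∞ g) (hs : HasCompactSupport g)
    (k : Fin 2) : partialDeriv k (pot ε g) = pot ε (partialDeriv k g) := by
  funext x
  have h := hs.hasFDerivAt_convolution_right (ContinuousLinearMap.mul ℝ ℝ)
    (locallyIntegrable_logKer hε) (hg.of_le (by simp)) x
  rw [partialDeriv]
  have h' : fderiv ℝ (pot ε g) x = _ := h.fderiv
  rw [h', convolution_precompR_apply _ (locallyIntegrable_logKer hε) (hs.fderiv ℝ)
    (hg.continuous_fderiv (by simp))]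
  rfl

theorem contDiff_comp_const_sub (hg : ContDiff ℝ ∞ g) (x : Plane) :
    ContDiff ℝ ∞ (fun t => g (x - t)) := hg.comp (by fun_prop)

theorem hasCompactSupport_comp_const_sub (hs : HasCompactSupport g) (x : Plane) :
    HasCompactSupport (fun t => g (x - t)) :=
  hs.comp_homeomorph (Homeomorph.subLeft x)

theorem partialDeriv_comp_const_sub (hg : ContDiff ℝ ∞ g) (k : Fin 2) (x t : Plane) :
    partialDeriv k (fun t => g (x - t)) t = - partialDeriv k g (x - t) := by
  have h1 : HasFDerivAt (fun t : Plane => x - t) (-ContinuousLinearMap.id ℝ Plane) t :=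
    (hasFDerivAt_id t).const_sub x
  have h := ((differentiableAt_of_smooth hg (x - t)).hasFDerivAt).comp t h1
  have h' : fderiv ℝ (fun t => g (x - t)) t = _ := h.fderiv
  rw [partialDeriv, h']
  simp [partialDeriv]

theorem integral_mul_partialDeriv_comp_const_sub {N : Plane → ℝ} (hN : ContDiff ℝ ∞ N)
    (hg : ContDiff ℝ ∞ g) (hs : HasCompactSupport g) (k : Fin 2) (x : Plane) :
    ∫ t, N t * partialDeriv k g (x - t) = ∫ t, partialDeriv k N t * g (x - t) := by
  have h := integral_mul_partialDeriv hN (contDiff_comp_const_sub hg x)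
    (hasCompactSupport_comp_const_sub hs x) k
  simp only [partialDeriv_comp_const_sub hg, mul_neg, integral_neg, neg_inj] at h
  exact h

theorem partialDeriv_pot_apply (hε : 0 < ε) (hg : ContDiff ℝ ∞ g) (hs : HasCompactSupport g)
    (k : Fin 2) (x : Plane) :
    partialDeriv k (pot ε g) x = ∫ t, partialDeriv k (logKer ε) t * g (x - t) := by
  rw [partialDeriv_pot hε hg hs, pot_apply,
    integral_mul_partialDeriv_comp_const_sub (contDiff_logKer hε) hg hs]

theorem diracKer_smul (hε : 0 < ε) (s : Plane) :
    ε ^ 2 * diracKer ε (ε • s) = diracKer 1 s := by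
  have h1 := (norm_sq_add_pos one_pos s).ne'
  have h2 := (norm_sq_add_pos hε (ε • s)).ne'
  simp only [diracKer]
  rw [norm_smul, Real.norm_eq_abs, mul_pow, sq_abs] at h2 ⊢
  have : ε ^ 2 * ‖s‖ ^ 2 + ε ^ 2 = ε ^ 2 * (‖s‖ ^ 2 + 1 ^ 2) := by ring
  rw [this]
  field_simp

/-- The kernels are the mass preserving dilations of `diracKer 1`. Moving the scale into the
argument of `F` leaves a fixed integrable weight, so that bounds uniform in `ε` and dominated
convergence are immediate. -/
theorem integral_diracKer_mul (hε : 0 < ε) (F : Plane → ℝ) :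
    ∫ t, diracKer ε t * F t = ∫ s, diracKer 1 s * F (ε • s) := by
  have h := Measure.integral_comp_smul (volume : Measure Plane) (fun t => diracKer ε t * F t) ε
  have e : ∀ s, diracKer 1 s * F (ε • s) = ε ^ 2 * (diracKer ε (ε • s) * F (ε • s)) := fun s => by
    rw [← mul_assoc, diracKer_smul hε]
  simp_rw [e]
  rw [integral_const_mul, h]
  simp
  field_simp

theorem sum_partialDeriv_pot (hε : 0 < ε) (hg : ContDiff ℝ ∞ g) (hs : HasCompactSupport g)
    (x : Plane) : ∑ k, partialDeriv k (partialDeriv k (pot ε g)) x =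
      ∫ s, diracKer 1 s * g (x - ε • s) := by
  have h : ∀ k, partialDeriv k (partialDeriv k (pot ε g)) x =
      ∫ t, partialDeriv k (partialDeriv k (logKer ε)) t * g (x - t) := fun k => by
    rw [partialDeriv_pot hε hg hs,
      partialDeriv_pot_apply hε (contDiff_partialDeriv hg k) (hasCompactSupport_partialDeriv hs k),
      integral_mul_partialDeriv_comp_const_sub (contDiff_partialDeriv (contDiff_logKer hε) k) hg hs]
  simp_rw [h]
  rw [← integral_finsetSum, ← integral_diracKer_mul hε (fun t => g (x - t))]
  · refine integral_congr_ae (ae_of_all _ fun t => ?_)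
    simp only [← Finset.sum_mul, sum_partialDeriv_logKer hε]
  · intro k _
    exact ((contDiff_partialDeriv (contDiff_partialDeriv (contDiff_logKer hε) k) k).continuous.mul
      (contDiff_comp_const_sub hg x).continuous).integrable_of_hasCompactSupport
      (hasCompactSupport_comp_const_sub hs x).mul_left

theorem abs_integral_diracKer_one_mul_le {F : Plane → ℝ} {M : ℝ} (hF : ∀ s, |F s| ≤ M) :
    |∫ s, diracKer 1 s * F s| ≤ diracMass * M := by
  refine (norm_integral_le_of_norm_le (f := fun s => diracKer 1 s * F s)
    (integrable_diracKer_one.mul_const M) (ae_of_all _ fun s => ?_)).trans_eq ?_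
  · rw [Real.norm_eq_abs, abs_mul, abs_of_nonneg (diracKer_nonneg 1 s)]
    exact mul_le_mul_of_nonneg_left (hF s) (diracKer_nonneg 1 s)
  · rw [integral_mul_const, diracMass]

theorem exists_abs_le_of_hasCompactSupport (hg : Continuous g) (hs : HasCompactSupport g) :
    ∃ M, 0 ≤ M ∧ ∀ x, |g x| ≤ M := by
  obtain ⟨M, hM⟩ := hg.bounded_above_of_compact_support hs
  exact ⟨M, (norm_nonneg _).trans (hM 0), fun x => hM x⟩

/-- This is `Δ log|z| = 2πδ` in regularized form: the Laplacian of the potential averages `g` over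
the points `x - εs` with weight `diracKer 1`. -/
theorem tendsto_sum_partialDeriv_pot (hg : ContDiff ℝ ∞ g) (hs : HasCompactSupport g) (x : Plane) :
    Tendsto (fun ε => ∑ k, partialDeriv k (partialDeriv k (pot ε g)) x) (𝓝[>] 0)
      (𝓝 (diracMass * g x)) := by
  obtain ⟨M, hM0, hM⟩ := exists_abs_le_of_hasCompactSupport hg.continuous hs
  have : Tendsto (fun ε : ℝ => ∫ s, diracKer 1 s * g (x - ε • s)) (𝓝[>] 0)
      (𝓝 (∫ s, diracKer 1 s * g x)) := by
    refine tendsto_integral_filter_of_dominated_convergence (fun s => diracKer 1 s * M) ?_ ?_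
      (integrable_diracKer_one.mul_const M) ?_
    · refine Eventually.of_forall fun ε => Continuous.aestronglyMeasurable ?_
      exact (continuous_diracKer one_pos).mul (hg.continuous.comp (by fun_prop))
    · refine Eventually.of_forall fun ε => ae_of_all _ fun s => ?_
      rw [Real.norm_eq_abs, abs_mul, abs_of_nonneg (diracKer_nonneg 1 s)]
      exact mul_le_mul_of_nonneg_left (hM _) (diracKer_nonneg 1 s)
    · refine ae_of_all _ fun s => Tendsto.const_mul _ ?_
      have hc : Continuous fun ε : ℝ => g (x - ε • s) := hg.continuous.comp (by fun_prop)
      simpa using (hc.tendsto 0).mono_left nhdsWithin_le_nhds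
  rw [integral_mul_const] at this
  refine this.congr' ?_
  filter_upwards [self_mem_nhdsWithin] with ε hε
  exact (sum_partialDeriv_pot hε hg hs x).symm

theorem abs_sum_partialDeriv_pot_le (hε : 0 < ε) (hg : ContDiff ℝ ∞ g) (hs : HasCompactSupport g)
    {M : ℝ} (hM : ∀ x, |g x| ≤ M) (x : Plane) :
    |∑ k, partialDeriv k (partialDeriv k (pot ε g)) x| ≤ diracMass * M := by
  rw [sum_partialDeriv_pot hε hg hs]
  exact abs_integral_diracKer_one_mul_le fun s => hM _

end Kernel

/-! ### Wente's sup bound for the logarithmic potential of a Jacobian. -/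

section Polar

open Real

/-- The Jacobian is the divergence of `(a ∂₁b, -a ∂₀b)`. Integrating by parts moves the derivatives
from `a` to `N`, and the mixed second derivatives of `b` cancel. -/
theorem integral_mul_jac {N a b : Plane → ℝ} (hN : ContDiff ℝ ∞ N) (ha : ContDiff ℝ ∞ a)
    (hb : ContDiff ℝ ∞ b) (hs : HasCompactSupport a) :
    ∫ x, N x * jac a b x = - ∫ x, a x * jac N b x := by
  have key : ∀ i j : Fin 2, ∫ x, (N x * partialDeriv i b x) * partialDeriv j a x =
      - ∫ x, (N x * partialDeriv j (partialDeriv i b) x +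
        partialDeriv j N x * partialDeriv i b x) * a x := by
    intro i j
    rw [integral_mul_partialDeriv (hN.mul (contDiff_partialDeriv hb i)) ha hs]
    simp_rw [partialDeriv_mul hN (contDiff_partialDeriv hb i)]
  have hint : ∀ i j : Fin 2, Integrable fun x =>
      (N x * partialDeriv i b x) * partialDeriv j a x := fun i j =>
    ((hN.continuous.mul (contDiff_partialDeriv hb i).continuous).mul
      (contDiff_partialDeriv ha j).continuous).integrable_of_hasCompactSupport
      (hasCompactSupport_partialDeriv hs j).mul_left
  have hint' : ∀ i j : Fin 2, Integrable fun x =>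
      (N x * partialDeriv j (partialDeriv i b) x +
        partialDeriv j N x * partialDeriv i b x) * a x := fun i j =>
    (((hN.continuous.mul (contDiff_partialDeriv (contDiff_partialDeriv hb i) j).continuous).add
      ((contDiff_partialDeriv hN j).continuous.mul (contDiff_partialDeriv hb i).continuous)).mul
      ha.continuous).integrable_of_hasCompactSupport hs.mul_left
  have e : ∫ x, N x * jac a b x = (∫ x, (N x * partialDeriv 1 b x) * partialDeriv 0 a x) -
      ∫ x, (N x * partialDeriv 0 b x) * partialDeriv 1 a x := by
    rw [← integral_sub (hint 1 0) (hint 0 1)]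
    exact integral_congr_ae (ae_of_all _ fun x => by simp only [jac]; ring)
  rw [e, key, key, neg_sub_neg, ← neg_sub, neg_inj, ← integral_sub (hint' 1 0) (hint' 0 1)]
  refine integral_congr_ae (ae_of_all _ fun x => ?_)
  simp only [jac]
  rw [partialDeriv_comm hb 0 1 x]
  ring

/-- The point of the plane with polar coordinates `(r, θ)`. -/
noncomputable def polarPt (r θ : ℝ) : Plane := !₂[r * cos θ, r * sin θ]

theorem norm_sq_polarPt (r θ : ℝ) : ‖polarPt r θ‖ ^ 2 = r ^ 2 := by
  rw [norm_sq_eq_sum]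
  simp only [polarPt, PiLp.toLp_apply, Matrix.cons_val_zero, Matrix.cons_val_one]
  nlinarith [sin_sq_add_cos_sq θ]

theorem continuous_polarPt : Continuous fun p : ℝ × ℝ => polarPt p.1 p.2 := by
  unfold polarPt
  refine (PiLp.continuous_toLp 2 _).comp (continuous_pi fun i => ?_)
  fin_cases i <;> simp <;> fun_prop

theorem integral_plane_eq (F : Plane → ℝ) : ∫ x, F x = ∫ p : ℝ × ℝ, F !₂[p.1, p.2] := by
  have h1 := (volume_preserving_finTwoArrow ℝ).symm
  have h2 := EuclideanSpace.volume_preserving_symm_measurableEquiv_toLp (Fin 2)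
  rw [← h2.symm.integral_comp' (g := F), ← h1.integral_comp']
  rfl

theorem integral_eq_polar (F : Plane → ℝ) :
    ∫ x, F x = ∫ p in Set.Ioi (0 : ℝ) ×ˢ Set.Ioo (-π) π, p.1 * F (polarPt p.1 p.2) := by
  rw [integral_plane_eq, ← integral_comp_polarCoord_symm]
  rfl

/-- The integrand vanishes for large radii, so only a compact rectangle of radii and angles matters.
-/
theorem integrableOn_polar {H : ℝ × ℝ → ℝ} (hH : Continuous H) {R : ℝ}
    (hR : ∀ r θ, R < r → H (r, θ) = 0) :
    IntegrableOn H (Set.Ioi (0 : ℝ) ×ˢ Set.Ioo (-π) π) := by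
  have h1 : IntegrableOn H (Set.Icc 0 R ×ˢ Set.Icc (-π) π) :=
    hH.continuousOn.integrableOn_compact (isCompact_Icc.prod isCompact_Icc)
  refine IntegrableOn.of_forall_sdiff_eq_zero h1 (measurableSet_Ioi.prod measurableSet_Ioo) ?_
  rintro ⟨r, θ⟩ ⟨⟨hr, hθ⟩, hn⟩
  refine hR r θ ?_
  by_contra hle
  exact hn ⟨⟨le_of_lt hr, not_lt.1 hle⟩, ⟨hθ.1.le, hθ.2.le⟩⟩

theorem hasDerivAt_comp_polarPt {a : Plane → ℝ} (ha : ContDiff ℝ ∞ a) (r θ : ℝ) :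
    HasDerivAt (fun θ => a (polarPt r θ)) (polarPt r θ 0 * partialDeriv 1 a (polarPt r θ) -
      polarPt r θ 1 * partialDeriv 0 a (polarPt r θ)) θ := by
  have h1 : HasDerivAt (fun θ => polarPt r θ) !₂[r * (-sin θ), r * cos θ] θ := by
    unfold polarPt
    have h : HasDerivAt (fun θ : ℝ => ![r * cos θ, r * sin θ]) ![r * (-sin θ), r * cos θ] θ := by
      rw [hasDerivAt_pi]
      intro i
      fin_cases i
      · simpa using (hasDerivAt_cos θ).const_mul r
      · simpa using (hasDerivAt_sin θ).const_mul r
    exact ((PiLp.continuousLinearEquiv 2 ℝ (fun _ : Fin 2 => ℝ)).symm.hasFDerivAt).comp_hasDerivAt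
      θ h
  have h := (differentiableAt_of_smooth ha (polarPt r θ)).hasFDerivAt.comp_hasDerivAt θ h1
  refine h.congr_deriv ?_
  rw [fderiv_apply_eq_partialDeriv]
  simp [polarPt]
  ring

theorem angular_deriv_sq_le (a : Plane → ℝ) (z : Plane) :
    (z 0 * partialDeriv 1 a z - z 1 * partialDeriv 0 a z) ^ 2 ≤ ‖z‖ ^ 2 * gradSq a z := by
  rw [norm_sq_eq_sum, gradSq]
  nlinarith [sq_nonneg (z 0 * partialDeriv 0 a z + z 1 * partialDeriv 1 a z)]

theorem sq_integral_abs_le {f : ℝ → ℝ} (hf : Continuous f) :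
    (∫ θ in (-π)..π, |f θ|) ^ 2 ≤ 2 * π * ∫ θ in (-π)..π, f θ ^ 2 := by
  have hpi : -π ≤ π := by linarith [pi_pos]
  rw [intervalIntegral.integral_of_le hpi, intervalIntegral.integral_of_le hpi]
  have hm : MemLp f 2 (volume.restrict (Set.Ioc (-π) π)) := by
    rw [memLp_two_iff_integrable_sq hf.aestronglyMeasurable]
    exact (hf.pow 2).integrableOn_Ioc
  have h := integral_abs_mul_le_sqrt hm (memLp_const (1 : ℝ))
  simp only [abs_one, mul_one, one_pow, integral_const, smul_eq_mul] at h
  have hv : (volume.restrict (Set.Ioc (-π) π)).real Set.univ = 2 * π := by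
    rw [measureReal_restrict_apply_univ, Real.volume_real_Ioc_of_le hpi]; ring
  rw [hv] at h
  have h0 : 0 ≤ ∫ θ in Set.Ioc (-π) π, |f θ| := integral_nonneg fun _ => abs_nonneg _
  have h1 : 0 ≤ ∫ θ in Set.Ioc (-π) π, f θ ^ 2 := integral_nonneg fun _ => sq_nonneg _
  calc _ ≤ (√(∫ θ in Set.Ioc (-π) π, f θ ^ 2) * √(2 * π)) ^ 2 := by gcongr
    _ = _ := by rw [mul_pow, sq_sqrt h1, sq_sqrt (by positivity)]; ring

/-- Periodicity gives `g'` mean zero, so a constant may be subtracted from `f`; then `|f - f(-π)| ≤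
∫|f'|`. The product `∫|f'| ∫|g'|` is at most half the sum of the squares, and each square costs a
factor `2π`. -/
theorem abs_integral_periodic_le {f g f' g' : ℝ → ℝ} (hf : ∀ θ, HasDerivAt f (f' θ) θ)
    (hg : ∀ θ, HasDerivAt g (g' θ) θ) (hf' : Continuous f') (hg' : Continuous g')
    (hper : g π = g (-π)) :
    |∫ θ in (-π)..π, f θ * g' θ| ≤
      π * ((∫ θ in (-π)..π, f' θ ^ 2) + ∫ θ in (-π)..π, g' θ ^ 2) := by
  have hpi : -π ≤ π := by linarith [pi_pos]
  have hfc : Continuous f := continuous_iff_continuousAt.2 fun θ => (hf θ).continuousAt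
  have hg0 : ∫ θ in (-π)..π, g' θ = 0 := by
    rw [intervalIntegral.integral_eq_sub_of_hasDerivAt (fun θ _ => hg θ)
      (hg'.intervalIntegrable _ _), hper, sub_self]
  have e : ∫ θ in (-π)..π, f θ * g' θ = ∫ θ in (-π)..π, (f θ - f (-π)) * g' θ := by
    have i1 : IntervalIntegrable (fun θ => f θ * g' θ) volume (-π) π :=
      (hfc.mul hg').intervalIntegrable _ _
    have i2 : IntervalIntegrable (fun θ => f (-π) * g' θ) volume (-π) π :=
      (hg'.const_mul _).intervalIntegrable _ _
    simp_rw [sub_mul]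
    rw [intervalIntegral.integral_sub i1 i2, intervalIntegral.integral_const_mul, hg0]
    simp
  set S := ∫ θ in (-π)..π, |f' θ|
  set T := ∫ θ in (-π)..π, |g' θ|
  have hsup : ∀ θ ∈ Set.Icc (-π) π, |f θ - f (-π)| ≤ S := by
    intro θ hθ
    rw [← intervalIntegral.integral_eq_sub_of_hasDerivAt (fun θ _ => hf θ)
      (hf'.intervalIntegrable _ _)]
    refine (intervalIntegral.abs_integral_le_integral_abs hθ.1).trans ?_
    exact intervalIntegral.integral_mono_interval le_rfl hθ.1 hθ.2
      (ae_of_all _ fun _ => abs_nonneg _) (hf'.abs.intervalIntegrable _ _)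
  have h1 : |∫ θ in (-π)..π, (f θ - f (-π)) * g' θ| ≤ S * T := by
    refine (intervalIntegral.abs_integral_le_integral_abs hpi).trans ?_
    rw [← intervalIntegral.integral_const_mul]
    refine intervalIntegral.integral_mono_on hpi
      ((((hfc.sub continuous_const).mul hg').abs).intervalIntegrable _ _)
      ((hg'.abs.const_mul _).intervalIntegrable _ _) fun θ hθ => ?_
    rw [abs_mul]
    exact mul_le_mul_of_nonneg_right (hsup θ hθ) (abs_nonneg _)
  have h2 := sq_integral_abs_le hf'
  have h3 := sq_integral_abs_le hg'
  rw [e]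
  nlinarith [sq_nonneg (S - T)]

/-- The gradient of `logKer` is radial, so its Jacobian with `b` is the angular derivative of `b`
divided by `r² + ε²`. On each circle the periodic estimate gives angular derivatives squared, at
most `r²|∇·|²`. The weight `r/(r² + ε²)` times `r²` is at most `r`, the polar area element. The
bound is therefore independent of `ε`. -/
theorem abs_integral_mul_jac_logKer_le {ε : ℝ} (hε : 0 < ε) {a b : Plane → ℝ}
    (ha : ContDiff ℝ ∞ a) (hb : ContDiff ℝ ∞ b) (hsa : HasCompactSupport a)
    (hsb : HasCompactSupport b) :
    |∫ x, a x * jac (logKer ε) b x| ≤ π * ((∫ x, gradSq a x) + ∫ x, gradSq b x) := by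
  let ang : (Plane → ℝ) → Plane → ℝ := fun c z => z 0 * partialDeriv 1 c z - z 1 * partialDeriv 0 c z
  have hang : ∀ {c : Plane → ℝ}, ContDiff ℝ ∞ c → Continuous (ang c) := fun hc => by
    have := (contDiff_partialDeriv hc 0).continuous
    have := (contDiff_partialDeriv hc 1).continuous
    simp only [ang]; fun_prop
  obtain ⟨R₁, hR₁⟩ := hsa.isBounded.subset_closedBall 0
  obtain ⟨R₂, hR₂⟩ := hsb.isBounded.subset_closedBall 0
  let R := max (max R₁ R₂) 0
  have hout : ∀ {c : Plane → ℝ} {R' r θ : ℝ}, tsupport c ⊆ closedBall 0 R' → R' ≤ R → R < r →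
      polarPt r θ ∉ tsupport c := by
    intro c R' r θ hc hR' hr hmem
    have h := hc hmem
    rw [mem_closedBall_zero_iff] at h
    have h2 := norm_sq_polarPt r θ
    have h3 : 0 ≤ R := le_max_right _ _
    nlinarith [norm_nonneg (polarPt r θ)]
  have hRa : R₁ ≤ R := (le_max_left _ _).trans (le_max_left _ _)
  have hRb : R₂ ≤ R := (le_max_right _ _).trans (le_max_left _ _)
  have ejac : ∀ z, a z * jac (logKer ε) b z = a z * ang b z / (‖z‖ ^ 2 + ε ^ 2) := by
    intro z
    have := (norm_sq_add_pos hε z).ne'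
    simp only [jac, partialDeriv_logKer hε, ang]
    field_simp
  have hpos : ∀ r : ℝ, 0 < r ^ 2 + ε ^ 2 := fun r => by positivity
  let G : ℝ × ℝ → ℝ := fun p =>
    p.1 / (p.1 ^ 2 + ε ^ 2) * (a (polarPt p.1 p.2) * ang b (polarPt p.1 p.2))
  have hGc : Continuous G := by
    refine Continuous.mul (continuous_fst.div (by fun_prop) fun p => (hpos _).ne') ?_
    exact (ha.continuous.comp continuous_polarPt).mul ((hang hb).comp continuous_polarPt)
  have hGi : IntegrableOn G (Set.Ioi (0 : ℝ) ×ˢ Set.Ioo (-π) π) :=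
    integrableOn_polar hGc (R := R) fun r θ hr => by
      simp [G, image_eq_zero_of_notMem_tsupport (hout hR₁ hRa hr)]
  let H : ℝ × ℝ → ℝ := fun p => p.1 * (gradSq a (polarPt p.1 p.2) + gradSq b (polarPt p.1 p.2))
  have hHc : Continuous H :=
    continuous_fst.mul (((continuous_gradSq ha).comp continuous_polarPt).add
      ((continuous_gradSq hb).comp continuous_polarPt))
  have hz : ∀ {c : Plane → ℝ} {z}, z ∉ tsupport c → gradSq c z = 0 := fun {c z} h => by
    by_contra h'
    exact h (support_gradSq_subset c h')
  have hHi : IntegrableOn H (Set.Ioi (0 : ℝ) ×ˢ Set.Ioo (-π) π) :=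
    integrableOn_polar hHc (R := R) fun r θ hr => by
      simp [H, hz (hout hR₁ hRa hr), hz (hout hR₂ hRb hr)]
  have eI : ∫ x, a x * jac (logKer ε) b x =
      ∫ r in Set.Ioi (0 : ℝ), ∫ θ in Set.Ioo (-π) π, G (r, θ) := by
    rw [integral_eq_polar, ← setIntegral_prod G hGi]
    refine integral_congr_ae (ae_of_all _ fun p => ?_)
    simp only [G, ejac, norm_sq_polarPt]
    ring
  have eE : (∫ x, gradSq a x) + ∫ x, gradSq b x =
      ∫ r in Set.Ioi (0 : ℝ), ∫ θ in Set.Ioo (-π) π, H (r, θ) := by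
    rw [← integral_add (integrable_gradSq ha hsa) (integrable_gradSq hb hsb), integral_eq_polar,
      ← setIntegral_prod H hHi]
    rfl
  rw [eI, eE, ← integral_const_mul, ← Real.norm_eq_abs]
  have hHi' : Integrable (fun r => ∫ θ in Set.Ioo (-π) π, H (r, θ))
      (volume.restrict (Set.Ioi (0 : ℝ))) := by
    have h := hHi
    rw [IntegrableOn, Measure.volume_eq_prod, ← Measure.prod_restrict] at h
    exact h.integral_prod_left
  refine norm_integral_le_of_norm_le (hHi'.const_mul π) ?_
  refine (ae_restrict_iff' measurableSet_Ioi).2 (ae_of_all _ fun r hr => ?_)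
  have hr0 : 0 < r := hr
  have hpi : -π ≤ π := by linarith [pi_pos]
  have cpt : Continuous fun θ => polarPt r θ :=
    continuous_polarPt.comp (continuous_const.prodMk continuous_id)
  have h1 := abs_integral_periodic_le (hasDerivAt_comp_polarPt ha r) (hasDerivAt_comp_polarPt hb r)
    ((hang ha).comp cpt) ((hang hb).comp cpt) (by simp [polarPt])
  simp only [G, H]
  rw [← integral_Ioc_eq_integral_Ioo, ← integral_Ioc_eq_integral_Ioo,
    ← intervalIntegral.integral_of_le hpi, ← intervalIntegral.integral_of_le hpi,
    intervalIntegral.integral_const_mul, intervalIntegral.integral_const_mul, Real.norm_eq_abs,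
    abs_mul, abs_of_pos (div_pos hr0 (hpos r))]
  have hw : r / (r ^ 2 + ε ^ 2) * r ^ 2 ≤ r := by
    rw [div_mul_eq_mul_div, div_le_iff₀ (hpos r)]
    nlinarith [sq_nonneg ε, mul_nonneg hr0.le (sq_nonneg ε)]
  have hmono : ∀ {c : Plane → ℝ}, ContDiff ℝ ∞ c →
      ∫ θ in (-π)..π, ang c (polarPt r θ) ^ 2 ≤
        r ^ 2 * ∫ θ in (-π)..π, gradSq c (polarPt r θ) := by
    intro c hc
    rw [← intervalIntegral.integral_const_mul]
    refine intervalIntegral.integral_mono hpi ((((hang hc).comp cpt).pow 2).intervalIntegrable _ _)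
      ((((continuous_gradSq hc).comp cpt).const_mul _).intervalIntegrable _ _) fun θ => ?_
    have := angular_deriv_sq_le c (polarPt r θ)
    rwa [norm_sq_polarPt] at this
  have hnn : ∀ c : Plane → ℝ, 0 ≤ ∫ θ in (-π)..π, gradSq c (polarPt r θ) := fun c =>
    intervalIntegral.integral_nonneg hpi fun θ _ => gradSq_nonneg _ _
  have hii : ∀ {c : Plane → ℝ}, ContDiff ℝ ∞ c →
      IntervalIntegrable (fun θ => gradSq c (polarPt r θ)) volume (-π) π := fun hc =>
    ((continuous_gradSq hc).comp cpt).intervalIntegrable _ _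
  rw [intervalIntegral.integral_add (hii ha) (hii hb)]
  have ma := hmono ha
  have mb := hmono hb
  set Ea := ∫ θ in (-π)..π, gradSq a (polarPt r θ)
  set Eb := ∫ θ in (-π)..π, gradSq b (polarPt r θ)
  have na : 0 ≤ Ea := hnn a
  have nb : 0 ≤ Eb := hnn b
  have hdiv : 0 ≤ r / (r ^ 2 + ε ^ 2) := (div_pos hr0 (hpos r)).le
  calc _ ≤ r / (r ^ 2 + ε ^ 2) * (π * (r ^ 2 * Ea + r ^ 2 * Eb)) := by
        refine mul_le_mul_of_nonneg_left (h1.trans ?_) hdiv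
        exact mul_le_mul_of_nonneg_left (add_le_add ma mb) pi_pos.le
    _ = π * ((r / (r ^ 2 + ε ^ 2) * r ^ 2) * (Ea + Eb)) := by ring
    _ ≤ π * (r * (Ea + Eb)) := by gcongr

/-- Wente's estimate. By translation it suffices to work at the origin, and integration by parts
puts the derivative on the kernel. -/
theorem abs_pot_jac_le {ε : ℝ} (hε : 0 < ε) {a b : Plane → ℝ}
    (ha : ContDiff ℝ ∞ a) (hb : ContDiff ℝ ∞ b) (hsa : HasCompactSupport a)
    (hsb : HasCompactSupport b) (x : Plane) :
    |pot ε (jac a b) x| ≤ π * ((∫ x, gradSq a x) + ∫ x, gradSq b x) := by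
  have hj : ∀ t, jac a b (x - t) = jac (fun t => a (x - t)) (fun t => b (x - t)) t := fun t => by
    simp [jac, partialDeriv_comp_const_sub ha, partialDeriv_comp_const_sub hb]
  have hg : ∀ {c : Plane → ℝ}, ContDiff ℝ ∞ c →
      ∫ t, gradSq (fun t => c (x - t)) t = ∫ t, gradSq c t := fun {c} hc => by
    rw [← integral_sub_left_eq_self (gradSq c) volume x]
    simp [gradSq, partialDeriv_comp_const_sub hc]
  simp_rw [pot_apply, hj]
  rw [integral_mul_jac (contDiff_logKer hε) (contDiff_comp_const_sub ha x)
    (contDiff_comp_const_sub hb x) (hasCompactSupport_comp_const_sub hsa x), abs_neg]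
  refine (abs_integral_mul_jac_logKer_le hε (contDiff_comp_const_sub ha x)
    (contDiff_comp_const_sub hb x) (hasCompactSupport_comp_const_sub hsa x)
    (hasCompactSupport_comp_const_sub hsb x)).trans_eq ?_
  rw [hg ha, hg hb]

end Polar

/-! ### The trilinear estimate for Jacobians in energy norms. -/

section Wente

theorem volume_real_ball_plane (p : Plane) {r : ℝ} (hr : 0 ≤ r) :
    volume.real (ball p r) = Real.pi * r ^ 2 := by
  rw [Measure.real, EuclideanSpace.volume_ball_fin_two, ENNReal.toReal_mul, ENNReal.toReal_pow,
    ENNReal.toReal_ofReal hr]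
  simp [mul_comm, Real.pi_pos.le]

theorem abs_integral_pair_le {α : Type*} [MeasurableSpace α] {μ : Measure α} {f₀ f₁ g₀ g₁ : α → ℝ}
    (hf₀ : MemLp f₀ 2 μ) (hf₁ : MemLp f₁ 2 μ) (hg₀ : MemLp g₀ 2 μ) (hg₁ : MemLp g₁ 2 μ) :
    |∫ x, (f₀ x * g₀ x + f₁ x * g₁ x) ∂μ| ≤
      √(∫ x, (f₀ x ^ 2 + f₁ x ^ 2) ∂μ) * √(∫ x, (g₀ x ^ 2 + g₁ x ^ 2) ∂μ) := by
  have hP : 0 ≤ ∫ x, (f₀ x ^ 2 + f₁ x ^ 2) ∂μ := integral_nonneg fun x => by positivity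
  have hQ : 0 ≤ ∫ x, (g₀ x ^ 2 + g₁ x ^ 2) ∂μ := integral_nonneg fun x => by positivity
  have h := le_two_mul_sqrt_of_forall_weighted (X := |∫ x, (f₀ x * g₀ x + f₁ x * g₁ x) ∂μ|)
    (C := 1 / 2) hP hQ (by norm_num) ?_
  · linarith
  intro t ht
  have hfi : Integrable (fun x => f₀ x ^ 2 + f₁ x ^ 2) μ := hf₀.integrable_sq.add hf₁.integrable_sq
  have hgi : Integrable (fun x => g₀ x ^ 2 + g₁ x ^ 2) μ := hg₀.integrable_sq.add hg₁.integrable_sq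
  rw [← integral_const_mul, ← integral_const_mul,
    ← integral_add (hfi.const_mul _) (hgi.const_mul _), ← integral_const_mul, ← Real.norm_eq_abs]
  refine norm_integral_le_of_norm_le (((hfi.const_mul _).add (hgi.const_mul _)).const_mul _)
    (ae_of_all _ fun x => ?_)
  have key : ∀ a b : ℝ, |a * b| ≤ 1 / 2 * (t ^ 2 * a ^ 2 + (t⁻¹) ^ 2 * b ^ 2) := by
    intro a b
    have : a * b = (t * a) * (t⁻¹ * b) := by field_simp
    rw [this, abs_mul]
    nlinarith [sq_nonneg (|t * a| - |t⁻¹ * b|), sq_abs (t * a), sq_abs (t⁻¹ * b)]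
  rw [Real.norm_eq_abs]
  refine (abs_add_le _ _).trans ?_
  have h1 := key (f₀ x) (g₀ x)
  have h2 := key (f₁ x) (g₁ x)
  linarith

theorem memLp_of_smooth {f : Plane → ℝ} (hf : Continuous f) (hs : HasCompactSupport f)
    (p : ℝ≥0∞) : MemLp f p :=
  hf.memLp_of_hasCompactSupport hs

/-- Caccioppoli's inequality: integrate `χ²ψ Δψ` by parts and absorb the cross term, the slack being
the square of `χ∇ψ + 2ψ∇χ`. -/
theorem integral_cutoff_sq_mul_gradSq_le {χ ψ : Plane → ℝ} (hχ : ContDiff ℝ ∞ χ)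
    (hs : HasCompactSupport χ) (hψ : ContDiff ℝ ∞ ψ) :
    ∫ x, χ x ^ 2 * gradSq ψ x ≤
      -2 * (∫ x, χ x ^ 2 * ψ x * ∑ k, partialDeriv k (partialDeriv k ψ) x) +
        4 * ∫ x, ψ x ^ 2 * gradSq χ x := by
  have cχ := hχ.continuous
  have cψ := hψ.continuous
  have cdχ := fun k => (contDiff_partialDeriv hχ k).continuous
  have cdψ := fun k => (contDiff_partialDeriv hψ k).continuous
  have hq : ContDiff ℝ ∞ (fun x => χ x * (χ x * ψ x)) := hχ.mul (hχ.mul hψ)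
  have hqs : HasCompactSupport (fun x => χ x * (χ x * ψ x)) := hs.mul_right
  have ibp : ∀ k, ∫ x, χ x * (χ x * ψ x) * partialDeriv k (partialDeriv k ψ) x =
      - ∫ x, (χ x ^ 2 * partialDeriv k ψ x ^ 2 +
        2 * (χ x * partialDeriv k ψ x) * (ψ x * partialDeriv k χ x)) := by
    intro k
    have h := integral_mul_partialDeriv (contDiff_partialDeriv hψ k) hq hqs k
    rw [show (∫ x, χ x * (χ x * ψ x) * partialDeriv k (partialDeriv k ψ) x) =
      ∫ x, partialDeriv k (partialDeriv k ψ) x * (χ x * (χ x * ψ x)) by simp_rw [mul_comm],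
      ← neg_eq_iff_eq_neg, ← h]
    refine integral_congr_ae (ae_of_all _ fun x => ?_)
    simp only [partialDeriv_mul hχ (hχ.mul hψ), partialDeriv_mul hχ hψ]
    ring
  have sup : ∀ {F : Plane → ℝ}, Continuous F → (∀ x, χ x = 0 → (∀ k, partialDeriv k χ x = 0) →
      F x = 0) → Integrable F := by
    intro F hF h0
    refine hF.integrable_of_hasCompactSupport (hs.mono' fun x hx => ?_)
    by_contra hn
    refine hx (h0 x (image_eq_zero_of_notMem_tsupport hn) fun k => ?_)
    by_contra h'
    exact hn (support_partialDeriv_subset k χ h')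
  have i1 : ∀ k, Integrable fun x => χ x * (χ x * ψ x) * partialDeriv k (partialDeriv k ψ) x :=
    fun k => sup ((cχ.mul (cχ.mul cψ)).mul
      (contDiff_partialDeriv (contDiff_partialDeriv hψ k) k).continuous)
      fun x h _ => by simp [h]
  have i2 : ∀ k, Integrable fun x => χ x ^ 2 * partialDeriv k ψ x ^ 2 +
      2 * (χ x * partialDeriv k ψ x) * (ψ x * partialDeriv k χ x) :=
    fun k => by
      have := cdχ k
      have := cdψ k
      exact sup (by fun_prop) fun x h _ => by simp [h]
  have i3 : Integrable fun x => χ x ^ 2 * gradSq ψ x :=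
    sup ((cχ.pow 2).mul (continuous_gradSq hψ)) fun x h _ => by simp [h]
  have i4 : Integrable fun x => ψ x ^ 2 * gradSq χ x :=
    sup ((cψ.pow 2).mul (continuous_gradSq hχ)) fun x _ h => by simp [gradSq, h]
  have e : ∫ x, χ x ^ 2 * ψ x * ∑ k, partialDeriv k (partialDeriv k ψ) x =
      - ∫ x, ∑ k, (χ x ^ 2 * partialDeriv k ψ x ^ 2 +
        2 * (χ x * partialDeriv k ψ x) * (ψ x * partialDeriv k χ x)) := by
    rw [integral_finsetSum _ fun k _ => i2 k, ← Finset.sum_neg_distrib]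
    simp_rw [← ibp]
    rw [← integral_finsetSum _ fun k _ => i1 k]
    refine integral_congr_ae (ae_of_all _ fun x => ?_)
    simp only [Finset.mul_sum]
    exact Finset.sum_congr rfl fun k _ => by ring
  rw [e, neg_mul_neg, ← integral_const_mul, ← integral_const_mul,
    ← integral_add ((integrable_finsetSum _ fun k _ => i2 k).const_mul 2) (i4.const_mul 4)]
  refine integral_mono i3
    (((integrable_finsetSum _ fun k _ => i2 k).const_mul 2).add (i4.const_mul 4)) fun x => ?_
  simp only [Fin.sum_univ_two, gradSq]
  nlinarith [sq_nonneg (χ x * partialDeriv 0 ψ x + 2 * (ψ x * partialDeriv 0 χ x)),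
    sq_nonneg (χ x * partialDeriv 1 ψ x + 2 * (ψ x * partialDeriv 1 χ x))]

theorem integral_gradSq_cutoff_le {χ : Plane → ℝ} {C r : ℝ} {p : Plane} (hr : 0 < r)
    (hχ : ContDiff ℝ ∞ χ) (hs : HasCompactSupport χ) (hsupp : tsupport χ ⊆ ball p (2 * r))
    (hC : ∀ k x, |partialDeriv k χ x| ≤ C / r) :
    ∫ x, gradSq χ x ≤ 8 * Real.pi * C ^ 2 := by
  have e : ∫ x, gradSq χ x = ∫ x in ball p (2 * r), gradSq χ x := by
    rw [setIntegral_eq_integral_of_forall_compl_eq_zero]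
    intro x hx
    by_contra h
    exact hx (hsupp (support_gradSq_subset χ h))
  rw [e]
  have hle : ∀ x, gradSq χ x ≤ 2 * (C / r) ^ 2 := fun x => by
    have h0 := sq_le_sq' (neg_le_of_abs_le (hC 0 x)) (le_of_abs_le (hC 0 x))
    have h1 := sq_le_sq' (neg_le_of_abs_le (hC 1 x)) (le_of_abs_le (hC 1 x))
    unfold gradSq; linarith
  calc _ ≤ ∫ x in ball p (2 * r), 2 * (C / r) ^ 2 :=
        integral_mono (integrable_gradSq hχ hs).integrableOn
          (integrableOn_const (by finiteness)) hle
    _ = 8 * Real.pi * C ^ 2 := by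
        rw [setIntegral_const, volume_real_ball_plane p (by positivity)]
        simp only [smul_eq_mul]
        field_simp
        ring

/-- With `ψ` the regularized potential of `jac a b`, the pairing `∫ φ Δψ = -∫ ∇φ·χ∇ψ` tends to
`diracMass ∫ φ jac a b`. Caccioppoli's inequality bounds `∫ χ²|∇ψ|²` by the sup of `ψ` times the
mass of `Δψ`, plus a cutoff term. Wente's sup bound and the pointwise bound on the Jacobian make
both quadratic in the sum of the energies of `a` and `b`; scaling then turns the sum into the
geometric mean. -/
theorem exists_trilinear_bound : ∃ C : ℝ, 0 < C ∧ ∀ φ a b : Plane → ℝ,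
    ContDiff ℝ ∞ φ → ContDiff ℝ ∞ a → ContDiff ℝ ∞ b →
    HasCompactSupport φ → HasCompactSupport a → HasCompactSupport b →
    |∫ x, φ x * jac a b x| ≤
      C * √(∫ x, gradSq φ x) * (√(∫ x, gradSq a x) * √(∫ x, gradSq b x)) := by
  obtain ⟨C₀, hC₀, hcut⟩ := exists_cutoff
  set K := 8 * Real.pi * C₀ ^ 2 with hK
  have hKpos : 0 < K := by positivity
  have hm := diracMass_pos
  -- With `S` the sum of the energies of `a` and `b`, the limiting energy of `ψ` is at most
  -- `2(πS)(diracMass·S/2) + 4(πS)²K`.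
  set C₁ := √(Real.pi * diracMass + 4 * Real.pi ^ 2 * K) / diracMass with hC₁
  have hC₁pos : 0 < C₁ := by positivity
  have key : ∀ φ a b : Plane → ℝ, ContDiff ℝ ∞ φ → ContDiff ℝ ∞ a → ContDiff ℝ ∞ b →
      HasCompactSupport φ → HasCompactSupport a → HasCompactSupport b →
      |∫ x, φ x * jac a b x| ≤
        C₁ * √(∫ x, gradSq φ x) * ((∫ x, gradSq a x) + ∫ x, gradSq b x) := by
    intro φ a b hφ ha hb sφ sa sb
    have hJ := contDiff_jac ha hb
    have sJ : HasCompactSupport (jac a b) := hasCompactSupport_jac sa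
    obtain ⟨M, hM0, hM⟩ := exists_abs_le_of_hasCompactSupport hJ.continuous sJ
    set S := (∫ x, gradSq a x) + ∫ x, gradSq b x with hS
    have hS0 : 0 ≤ S := add_nonneg (integral_nonneg fun x => gradSq_nonneg a x)
      (integral_nonneg fun x => gradSq_nonneg b x)
    obtain ⟨R, hR⟩ := sφ.isBounded.subset_closedBall 0
    -- The size of this radius is irrelevant: in the plane the energy of the cutoff is bounded by
    -- `K` at every scale.
    obtain ⟨χ, hχ, sχ, tχ, χ1, χ0, χle, dχ⟩ := hcut 0 (max R 1) (by positivity)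
    have χone : ∀ x ∈ tsupport φ, χ x = 1 := fun x hx =>
      χ1 x (closedBall_subset_closedBall (le_max_left _ _) (hR hx))
    have hEχ := integral_gradSq_cutoff_le (by positivity) hχ sχ tχ dχ
    rw [← hK] at hEχ
    let D : ℝ → Plane → ℝ := fun ε x =>
      ∑ k, partialDeriv k (partialDeriv k (pot ε (jac a b))) x
    have hDc : ∀ ε > 0, Continuous (D ε) := fun ε hε =>
      continuous_finsetSum _ fun k _ => (contDiff_partialDeriv (contDiff_partialDeriv
        (contDiff_pot hε hJ sJ) k) k).continuous
    have step : ∀ ε > 0, |∫ x, φ x * D ε x| ≤ √(∫ x, gradSq φ x) *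
        √(2 * (Real.pi * S) * (∫ x, χ x ^ 2 * |D ε x|) + 4 * (Real.pi * S) ^ 2 * K) := by
      intro ε hε
      set ψ := pot ε (jac a b) with hψdef
      have hψ : ContDiff ℝ ∞ ψ := contDiff_pot hε hJ sJ
      have hψb : ∀ x, |ψ x| ≤ Real.pi * S := abs_pot_jac_le hε ha hb sa sb
      have e1 : ∫ x, φ x * D ε x = - ∫ x, (partialDeriv 0 φ x * (χ x * partialDeriv 0 ψ x) +
          partialDeriv 1 φ x * (χ x * partialDeriv 1 ψ x)) := by
        have ibp : ∀ k, ∫ x, partialDeriv k φ x * (χ x * partialDeriv k ψ x) =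
            - ∫ x, partialDeriv k (partialDeriv k ψ) x * φ x := fun k => by
          rw [← integral_mul_partialDeriv (contDiff_partialDeriv hψ k) hφ sφ]
          refine integral_congr_ae (ae_of_all _ fun x => ?_)
          by_cases hx : x ∈ tsupport φ
          · simp [χone x hx, mul_comm]
          · have : partialDeriv k φ x = 0 := by
              by_contra h'
              exact hx (support_partialDeriv_subset k φ h')
            simp [this]
        have i1 : ∀ k, Integrable fun x => partialDeriv k φ x * (χ x * partialDeriv k ψ x) :=
          fun k => ((contDiff_partialDeriv hφ k).continuous.mul (hχ.continuous.mul
            (contDiff_partialDeriv hψ k).continuous)).integrable_of_hasCompactSupport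
            (hasCompactSupport_partialDeriv sφ k).mul_right
        have i2 : ∀ k, Integrable fun x => partialDeriv k (partialDeriv k ψ) x * φ x :=
          fun k => ((contDiff_partialDeriv (contDiff_partialDeriv hψ k) k).continuous.mul
            hφ.continuous).integrable_of_hasCompactSupport sφ.mul_left
        rw [integral_add (i1 0) (i1 1), ibp, ibp, ← neg_add, neg_neg, ← integral_add (i2 0) (i2 1)]
        refine integral_congr_ae (ae_of_all _ fun x => ?_)
        simp only [D, Fin.sum_univ_two]
        ring
      rw [e1, abs_neg]
      have mφ : ∀ k, MemLp (partialDeriv k φ) 2 := fun k => memLp_of_smooth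
        (contDiff_partialDeriv hφ k).continuous (hasCompactSupport_partialDeriv sφ k) 2
      have mψ : ∀ k, MemLp (fun x => χ x * partialDeriv k ψ x) 2 := fun k => memLp_of_smooth
        (hχ.continuous.mul (contDiff_partialDeriv hψ k).continuous) sχ.mul_right 2
      refine (abs_integral_pair_le (mφ 0) (mφ 1) (mψ 0) (mψ 1)).trans ?_
      refine mul_le_mul_of_nonneg_left (Real.sqrt_le_sqrt ?_) (Real.sqrt_nonneg _)
      have e2 : ∫ x, ((χ x * partialDeriv 0 ψ x) ^ 2 + (χ x * partialDeriv 1 ψ x) ^ 2) =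
          ∫ x, χ x ^ 2 * gradSq ψ x :=
        integral_congr_ae (ae_of_all _ fun x => by simp only [gradSq]; ring)
      rw [e2]
      refine (integral_cutoff_sq_mul_gradSq_le hχ sχ hψ).trans ?_
      have h1 : -2 * (∫ x, χ x ^ 2 * ψ x * D ε x) ≤
          2 * (Real.pi * S) * (∫ x, χ x ^ 2 * |D ε x|) := by
        rw [mul_assoc 2, ← integral_const_mul, ← integral_const_mul, ← integral_const_mul]
        refine integral_mono ?_ ?_ fun x => ?_
        · exact Integrable.const_mul ((((hχ.continuous.pow 2).mul hψ.continuous).mul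
            (hDc ε hε)).integrable_of_hasCompactSupport (by
              simp_rw [sq, mul_assoc]; exact sχ.mul_right)) _
        · exact Integrable.const_mul (Integrable.const_mul (((hχ.continuous.pow 2).mul
            (hDc ε hε).abs).integrable_of_hasCompactSupport (by
              simp_rw [sq, mul_assoc]; exact sχ.mul_right)) _) _
        · have h2 : -(ψ x * D ε x) ≤ Real.pi * S * |D ε x| := by
            refine (neg_le_abs _).trans ?_
            rw [abs_mul]
            exact mul_le_mul_of_nonneg_right (hψb x) (abs_nonneg _)
          have h3 := mul_le_mul_of_nonneg_left h2 (sq_nonneg (χ x))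
          simp only
          nlinarith
      have h2 : ∫ x, ψ x ^ 2 * gradSq χ x ≤ (Real.pi * S) ^ 2 * K := by
        refine le_trans ?_ (mul_le_mul_of_nonneg_left hEχ (sq_nonneg _))
        rw [← integral_const_mul]
        refine integral_mono ?_ ((integrable_gradSq hχ sχ).const_mul _) fun x => ?_
        · exact ((hψ.continuous.pow 2).mul (continuous_gradSq hχ)).integrable_of_hasCompactSupport
            (hasCompactSupport_gradSq sχ).mul_left
        · exact mul_le_mul_of_nonneg_right
            (sq_le_sq' (neg_le_of_abs_le (hψb x)) (le_of_abs_le (hψb x))) (gradSq_nonneg _ _)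
      simp only [D] at h1
      linarith
    have lim1 : Tendsto (fun ε => |∫ x, φ x * D ε x|) (𝓝[>] 0)
        (𝓝 |∫ x, φ x * (diracMass * jac a b x)|) := by
      refine Tendsto.abs ?_
      refine tendsto_integral_filter_of_dominated_convergence
        (fun x => |φ x| * (diracMass * M)) ?_ ?_ ?_ ?_
      · filter_upwards [self_mem_nhdsWithin] with ε hε
        exact (hφ.continuous.mul (hDc ε hε)).aestronglyMeasurable
      · filter_upwards [self_mem_nhdsWithin] with ε hε
        refine ae_of_all _ fun x => ?_
        rw [Real.norm_eq_abs, abs_mul]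
        exact mul_le_mul_of_nonneg_left (abs_sum_partialDeriv_pot_le hε hJ sJ hM x) (abs_nonneg _)
      · exact (hφ.continuous.abs.integrable_of_hasCompactSupport sφ.norm).mul_const _
      · exact ae_of_all _ fun x => (tendsto_sum_partialDeriv_pot hJ sJ x).const_mul _
    have sχ2 : HasCompactSupport (fun x => χ x ^ 2) := by
      simp_rw [sq]; exact sχ.mul_right
    have lim2 : Tendsto (fun ε => ∫ x, χ x ^ 2 * |D ε x|) (𝓝[>] 0)
        (𝓝 (∫ x, χ x ^ 2 * |diracMass * jac a b x|)) := by
      refine tendsto_integral_filter_of_dominated_convergence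
        (fun x => χ x ^ 2 * (diracMass * M)) ?_ ?_ ?_ ?_
      · filter_upwards [self_mem_nhdsWithin] with ε hε
        exact ((hχ.continuous.pow 2).mul (hDc ε hε).abs).aestronglyMeasurable
      · filter_upwards [self_mem_nhdsWithin] with ε hε
        refine ae_of_all _ fun x => ?_
        rw [Real.norm_eq_abs, abs_mul, abs_abs, abs_of_nonneg (sq_nonneg _)]
        exact mul_le_mul_of_nonneg_left (abs_sum_partialDeriv_pot_le hε hJ sJ hM x) (sq_nonneg _)
      · exact ((hχ.continuous.pow 2).integrable_of_hasCompactSupport sχ2).mul_const _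
      · exact ae_of_all _ fun x => ((tendsto_sum_partialDeriv_pot hJ sJ x).abs).const_mul _
    have hlim := le_of_tendsto_of_tendsto lim1
      (((lim2.const_mul (2 * (Real.pi * S))).add_const (4 * (Real.pi * S) ^ 2 * K)).sqrt.const_mul
        √(∫ x, gradSq φ x)) (by
        filter_upwards [self_mem_nhdsWithin] with ε hε using step ε hε)
    have hJ1 : ∫ x, χ x ^ 2 * |diracMass * jac a b x| ≤ diracMass * (S / 2) := by
      have : ∫ x, χ x ^ 2 * |diracMass * jac a b x| ≤
          ∫ x, diracMass * ((gradSq a x + gradSq b x) / 2) := by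
        refine integral_mono ?_ ?_ fun x => ?_
        · exact ((hχ.continuous.pow 2).mul
            (hJ.continuous.const_mul _).abs).integrable_of_hasCompactSupport sχ2.mul_right
        · exact (((integrable_gradSq ha sa).add (integrable_gradSq hb sb)).div_const 2).const_mul _
        · simp only [abs_mul, abs_of_pos hm]
          have h1 : χ x ^ 2 ≤ 1 := pow_le_one₀ (χ0 x) (χle x)
          have h2 := abs_jac_le a b x
          have h3 : diracMass * |jac a b x| ≤ diracMass * ((gradSq a x + gradSq b x) / 2) :=
            mul_le_mul_of_nonneg_left h2 hm.le
          have h4 : 0 ≤ diracMass * |jac a b x| := by positivity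
          nlinarith
      rwa [integral_const_mul, integral_div, integral_add (integrable_gradSq ha sa)
        (integrable_gradSq hb sb)] at this
    have e3 : ∫ x, φ x * (diracMass * jac a b x) = diracMass * ∫ x, φ x * jac a b x := by
      rw [← integral_const_mul]
      exact integral_congr_ae (ae_of_all _ fun x => by ring)
    rw [e3, abs_mul, abs_of_pos hm] at hlim
    have h5 : √(2 * (Real.pi * S) * (∫ x, χ x ^ 2 * |diracMass * jac a b x|) +
        4 * (Real.pi * S) ^ 2 * K) ≤ √(Real.pi * diracMass + 4 * Real.pi ^ 2 * K) * S := by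
      rw [← Real.sqrt_sq hS0, ← Real.sqrt_mul (by positivity), Real.sqrt_sq hS0]
      refine Real.sqrt_le_sqrt ?_
      have := mul_le_mul_of_nonneg_left hJ1 (show 0 ≤ 2 * (Real.pi * S) by positivity)
      nlinarith
    have h6 := hlim.trans (mul_le_mul_of_nonneg_left h5 (Real.sqrt_nonneg _))
    rw [hC₁, div_mul_eq_mul_div, div_mul_eq_mul_div, le_div_iff₀ hm]
    linarith
  refine ⟨2 * C₁, by positivity, fun φ a b hφ ha hb sφ sa sb => ?_⟩
  have h := le_two_mul_sqrt_of_forall_weighted (X := |∫ x, φ x * jac a b x|)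
    (P := ∫ x, gradSq a x) (Q := ∫ x, gradSq b x) (C := C₁ * √(∫ x, gradSq φ x))
    (integral_nonneg fun x => gradSq_nonneg a x) (integral_nonneg fun x => gradSq_nonneg b x)
    (by positivity) ?_
  · linarith
  intro t ht
  -- Replacing `(a, b)` by `(ta, t⁻¹b)` does not change the Jacobian but reweights the two energies.
  have h := key φ (fun x => t * a x) (fun x => t⁻¹ * b x) hφ (contDiff_const.mul ha)
    (contDiff_const.mul hb) sφ sa.mul_left sb.mul_left
  have eg : ∀ {c : Plane → ℝ} (s : ℝ), ContDiff ℝ ∞ c →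
      ∫ x, gradSq (fun x => s * c x) x = s ^ 2 * ∫ x, gradSq c x := fun {c} s hc => by
    rw [← integral_const_mul]
    refine integral_congr_ae (ae_of_all _ fun x => ?_)
    simp only [gradSq, partialDeriv_const_mul s hc]
    ring
  have ej : ∀ x, jac (fun x => t * a x) (fun x => t⁻¹ * b x) x = jac a b x := fun x => by
    simp only [jac, partialDeriv_const_mul _ ha, partialDeriv_const_mul _ hb]
    field_simp
  simp_rw [ej, eg t ha, eg t⁻¹ hb] at h
  exact h

end Wente

/-! ### Poincaré's inequality on balls and the localized trilinear estimate. -/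

section Poincare

/-- The homothety with centre `y` and ratio `t ≤ 1` maps the convex ball into itself, and the
inverse of its Jacobian is `t⁻² ≤ 4` because `t > 1/2`. -/
theorem lintegral_ball_comp_homothety_le {h : Plane → ℝ≥0∞} (p : Plane) {r t : ℝ}
    (ht : t ∈ Set.Ioc (1 / 2 : ℝ) 1) {y : Plane} (hy : y ∈ ball p r) :
    ∫⁻ x in ball p r, h (y + t • (x - y)) ≤ 4 * ∫⁻ z in ball p r, h z := by
  have ht0 : 0 < t := lt_trans (by norm_num) ht.1
  let F : Plane → ℝ≥0∞ := (ball p r).indicator h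
  have h1 : ∫⁻ x in ball p r, h (y + t • (x - y)) ≤ ∫⁻ x, F (y + t • (x - y)) := by
    rw [← lintegral_indicator measurableSet_ball]
    refine lintegral_mono fun x => ?_
    by_cases hx : x ∈ ball p r
    · have hz : y + t • (x - y) ∈ ball p r := by
        have := (convex_ball p r) hy hx (show 0 ≤ 1 - t by linarith [ht.2]) ht0.le (by ring)
        convert! this using 1
        rw [smul_sub, sub_smul, one_smul]; abel
      simp [F, hx, hz]
    · simp [hx]
  refine h1.trans ?_
  have h2 : ∫⁻ x, F (y + t • (x - y)) = ∫⁻ x, F (y + t • x) :=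
    lintegral_sub_right_eq_self (fun x => F (y + t • x)) y
  have h3 : ∫⁻ x, F (y + t • x) = ENNReal.ofReal |(t ^ 2)⁻¹| * ∫⁻ x, F (y + x) := by
    have hm := Measure.map_addHaar_smul (volume : Measure Plane) ht0.ne'
    have e := lintegral_map_equiv (μ := (volume : Measure Plane)) (fun x => F (y + x))
      (Homeomorph.smulOfNeZero t ht0.ne').toMeasurableEquiv
    have hco : (⇑(Homeomorph.smulOfNeZero t ht0.ne').toMeasurableEquiv : Plane → Plane) =
      fun x => t • x := rfl
    rw [hco] at e
    rw [← e, hm, lintegral_smul_measure]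
    simp
  rw [h2, h3, lintegral_add_left_eq_self F y, lintegral_indicator measurableSet_ball]
  gcongr
  rw [show (4 : ℝ≥0∞) = ENNReal.ofReal 4 by norm_num]
  refine ENNReal.ofReal_le_ofReal ?_
  rw [abs_of_pos (by positivity), inv_le_comm₀ (by positivity) (by norm_num)]
  nlinarith [ht.1]

/-- The segment is followed only from its midpoint to `x`: this keeps the ratio of the homotheties
centred at `y` at least `1/2`, hence their Jacobians under control. -/
theorem sq_sub_midpoint_le {f : Plane → ℝ} (hf : ContDiff ℝ ∞ f) {p x y : Plane} {r : ℝ}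
    (hx : x ∈ ball p r) (hy : y ∈ ball p r) :
    (f x - f (y + (1 / 2 : ℝ) • (x - y))) ^ 2 ≤
      2 * r ^ 2 * ∫ t in (1 / 2 : ℝ)..1, gradSq f (y + t • (x - y)) := by
  have hhalf : (1 / 2 : ℝ) ≤ 1 := by norm_num
  let D : ℝ → ℝ := fun t => fderiv ℝ f (y + t • (x - y)) (x - y)
  have hD : ∀ t, HasDerivAt (fun t : ℝ => f (y + t • (x - y))) (D t) t := fun t => by
    have h1 : HasDerivAt (fun t : ℝ => y + t • (x - y)) (x - y) t := by
      simpa using ((hasDerivAt_id t).smul_const (x - y)).const_add y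
    exact (differentiableAt_of_smooth hf _).hasFDerivAt.comp_hasDerivAt t h1
  have hline : Continuous fun t : ℝ => y + t • (x - y) := by fun_prop
  have hDc : Continuous D :=
    ((hf.continuous_fderiv (by simp)).comp hline).clm_apply continuous_const
  have hgc : Continuous fun t : ℝ => gradSq f (y + t • (x - y)) := (continuous_gradSq hf).comp hline
  have e : f x - f (y + (1 / 2 : ℝ) • (x - y)) = ∫ t in (1 / 2 : ℝ)..1, D t := by
    rw [intervalIntegral.integral_eq_sub_of_hasDerivAt (fun t _ => hD t)
      (hDc.intervalIntegrable _ _)]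
    simp
  have hcs : (∫ t in (1 / 2 : ℝ)..1, D t) ^ 2 ≤ 1 / 2 * ∫ t in (1 / 2 : ℝ)..1, D t ^ 2 := by
    rw [intervalIntegral.integral_of_le hhalf, intervalIntegral.integral_of_le hhalf]
    have hm : MemLp D 2 (volume.restrict (Set.Ioc (1 / 2 : ℝ) 1)) := by
      rw [memLp_two_iff_integrable_sq hDc.aestronglyMeasurable]
      exact (hDc.pow 2).integrableOn_Ioc
    have h := abs_integral_mul_le_sqrt hm (memLp_const (1 : ℝ))
    simp only [mul_one, one_pow, integral_const, smul_eq_mul] at h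
    have hv : (volume.restrict (Set.Ioc (1 / 2 : ℝ) 1)).real Set.univ = 1 / 2 := by
      rw [measureReal_restrict_apply_univ, Real.volume_real_Ioc_of_le hhalf]; norm_num
    rw [hv] at h
    have h1 : 0 ≤ ∫ t in Set.Ioc (1 / 2 : ℝ) 1, D t ^ 2 := integral_nonneg fun _ => sq_nonneg _
    rw [← sq_abs]
    calc _ ≤ (√(∫ t in Set.Ioc (1 / 2 : ℝ) 1, D t ^ 2) * √(1 / 2)) ^ 2 := by gcongr
      _ = _ := by rw [mul_pow, Real.sq_sqrt h1, Real.sq_sqrt (by norm_num)]; ring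
  rw [e]
  refine hcs.trans ?_
  have hxy : ‖x - y‖ ^ 2 ≤ 4 * r ^ 2 := by
    have h1 := dist_triangle_right x y p
    rw [mem_ball] at hx hy
    rw [dist_eq_norm] at h1
    have : ‖x - y‖ ≤ 2 * r := by linarith
    nlinarith [norm_nonneg (x - y)]
  have hle : ∀ t, D t ^ 2 ≤ 4 * r ^ 2 * gradSq f (y + t • (x - y)) := fun t => by
    simp only [D]
    rw [fderiv_apply_eq_partialDeriv]
    have h1 := norm_sq_eq_sum (x - y)
    refine le_trans ?_ (mul_le_mul_of_nonneg_right hxy (gradSq_nonneg _ _))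
    rw [h1, gradSq]
    nlinarith [sq_nonneg ((x - y) 0 * partialDeriv 1 f (y + t • (x - y)) -
      (x - y) 1 * partialDeriv 0 f (y + t • (x - y)))]
  have := intervalIntegral.integral_mono (μ := volume) hhalf
    ((hDc.pow 2).intervalIntegrable _ _)
    ((hgc.const_mul (4 * r ^ 2)).intervalIntegrable (1 / 2 : ℝ) 1) hle
  rw [intervalIntegral.integral_const_mul] at this
  simp only [Pi.pow_apply] at this
  linarith

theorem setLIntegral_setLIntegral_le_of_symm {B : Set Plane} (hB : MeasurableSet B)
    {Q A : Plane → Plane → ℝ≥0∞} {K M : ℝ≥0∞} (hK : K ≠ ⊤)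
    (hA : Measurable fun q : Plane × Plane => A q.1 q.2)
    (hQ : ∀ x ∈ B, ∀ y ∈ B, Q x y ≤ K * (A x y + A y x))
    (hM : ∫⁻ y in B, ∫⁻ x in B, A x y ≤ M) :
    ∫⁻ y in B, ∫⁻ x in B, Q x y ≤ K * (2 * M) := by
  have hsw : Measurable fun q : Plane × Plane => A q.2 q.1 := hA.comp measurable_swap
  have hAx : ∀ y, Measurable fun x => A x y := fun y =>
    hA.comp (measurable_id.prodMk measurable_const)
  have hAxi : Measurable fun y => ∫⁻ x in B, A x y := hsw.lintegral_prod_right'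
  have hM' : ∫⁻ y in B, ∫⁻ x in B, A y x ≤ M := by
    rw [lintegral_lintegral_swap hA.aemeasurable]
    exact hM
  calc _ ≤ ∫⁻ y in B, ∫⁻ x in B, K * (A x y + A y x) :=
        setLIntegral_mono' hB fun y hy => setLIntegral_mono' hB fun x hx => hQ x hx y hy
    _ = K * ((∫⁻ y in B, ∫⁻ x in B, A x y) + ∫⁻ y in B, ∫⁻ x in B, A y x) := by
        rw [← lintegral_add_left hAxi, ← lintegral_const_mul' _ _ hK]
        refine lintegral_congr fun y => ?_
        rw [lintegral_const_mul' _ _ hK, lintegral_add_left (hAx y)]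
    _ ≤ K * (2 * M) := by rw [two_mul]; gcongr

/-- Split `f x - f y` at the midpoint of the segment, and treat each half by homotheties centred at
the opposite endpoint. This bounds the double integral of `(f x - f y)²` over the ball. -/
theorem poincare_ball {f : Plane → ℝ} (hf : ContDiff ℝ ∞ f) (p : Plane) {r : ℝ} (hr : 0 < r) :
    ∃ c : ℝ, ∫ x in ball p r, (f x - c) ^ 2 ≤ 16 * r ^ 2 * ∫ x in ball p r, gradSq f x := by
  let h : Plane → ℝ≥0∞ := fun z => ENNReal.ofReal (gradSq f z)
  have hmeas : Measurable h := (continuous_gradSq hf).measurable.ennreal_ofReal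
  set G : ℝ≥0∞ := ∫⁻ z in ball p r, h z with hG
  let V : ℝ≥0∞ := volume (ball p r)
  have hV0 : V ≠ 0 := (measure_ball_pos volume p hr).ne'
  have hVt : V ≠ ⊤ := measure_ball_lt_top.ne
  let A : Plane → Plane → ℝ≥0∞ := fun x y =>
    ∫⁻ t in Set.Ioc (1 / 2 : ℝ) 1, h (y + t • (x - y))
  have hAmeas : Measurable fun q : Plane × Plane => A q.1 q.2 := by
    have hc : Continuous fun w : (Plane × Plane) × ℝ => w.1.2 + w.2 • (w.1.1 - w.1.2) := by fun_prop
    exact (hmeas.comp hc.measurable).lintegral_prod_right'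
  have hpt : ∀ x ∈ ball p r, ∀ y ∈ ball p r,
      ENNReal.ofReal ((f x - f (y + (1 / 2 : ℝ) • (x - y))) ^ 2) ≤
        ENNReal.ofReal (2 * r ^ 2) * A x y := by
    intro x hx y hy
    have hgc : Continuous fun t : ℝ => gradSq f (y + t • (x - y)) :=
      (continuous_gradSq hf).comp (by fun_prop)
    have e : A x y = ENNReal.ofReal (∫ t in (1 / 2 : ℝ)..1, gradSq f (y + t • (x - y))) := by
      rw [intervalIntegral.integral_of_le (by norm_num),
        ofReal_integral_eq_lintegral_ofReal hgc.integrableOn_Ioc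
          (ae_of_all _ fun t => gradSq_nonneg _ _)]
    rw [e, ← ENNReal.ofReal_mul (by positivity)]
    exact ENNReal.ofReal_le_ofReal (sq_sub_midpoint_le hf hx hy)
  have hpt2 : ∀ x ∈ ball p r, ∀ y ∈ ball p r,
      ENNReal.ofReal ((f x - f y) ^ 2) ≤ ENNReal.ofReal (4 * r ^ 2) * (A x y + A y x) := by
    intro x hx y hy
    have hmid : y + (1 / 2 : ℝ) • (x - y) = x + (1 / 2 : ℝ) • (y - x) := by module
    have h1 := hpt x hx y hy
    have h2 := hpt y hy x hx
    rw [← hmid] at h2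
    set m := f (y + (1 / 2 : ℝ) • (x - y))
    calc ENNReal.ofReal ((f x - f y) ^ 2)
        ≤ ENNReal.ofReal (2 * ((f x - m) ^ 2 + (f y - m) ^ 2)) := by
          refine ENNReal.ofReal_le_ofReal ?_
          nlinarith [sq_nonneg ((f x - m) + (f y - m))]
      _ = 2 * (ENNReal.ofReal ((f x - m) ^ 2) + ENNReal.ofReal ((f y - m) ^ 2)) := by
          rw [ENNReal.ofReal_mul (by norm_num), ENNReal.ofReal_add (by positivity) (by positivity)]
          norm_num
      _ ≤ 2 * (ENNReal.ofReal (2 * r ^ 2) * A x y + ENNReal.ofReal (2 * r ^ 2) * A y x) := by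
          gcongr
      _ = _ := by
          rw [← mul_add, ← mul_assoc, show (4 * r ^ 2 : ℝ) = 2 * (2 * r ^ 2) by ring,
            ENNReal.ofReal_mul (show (0 : ℝ) ≤ 2 by norm_num)]
          norm_num
  have hA : ∫⁻ y in ball p r, ∫⁻ x in ball p r, A x y ≤ 2 * G * V := by
    have h1 : ∀ y ∈ ball p r, ∫⁻ x in ball p r, A x y ≤ 2 * G := by
      intro y hy
      have hc : Continuous fun w : Plane × ℝ => y + w.2 • (w.1 - y) := by fun_prop
      have hm : Measurable (Function.uncurry fun (x : Plane) (t : ℝ) => h (y + t • (x - y))) :=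
        hmeas.comp hc.measurable
      simp only [A]
      rw [lintegral_lintegral_swap hm.aemeasurable]
      calc _ ≤ ∫⁻ t in Set.Ioc (1 / 2 : ℝ) 1, 4 * G := by
            refine setLIntegral_mono measurable_const fun t ht => ?_
            exact lintegral_ball_comp_homothety_le p ht hy
        _ = 2 * G := by
            rw [setLIntegral_const, Real.volume_Ioc, mul_right_comm]
            congr 1
            rw [show (4 : ℝ≥0∞) = ENNReal.ofReal 4 by norm_num, ← ENNReal.ofReal_mul (by norm_num)]
            norm_num
    calc _ ≤ ∫⁻ y in ball p r, 2 * G := setLIntegral_mono measurable_const h1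
      _ = _ := by rw [setLIntegral_const]
  have hsq : Measurable fun q : Plane × Plane => ENNReal.ofReal ((f q.2 - f q.1) ^ 2) := by
    have := hf.continuous
    exact (by fun_prop : Continuous fun q : Plane × Plane => (f q.2 - f q.1) ^ 2).measurable.ennreal_ofReal
  have htot : ∫⁻ y in ball p r, ∫⁻ x in ball p r, ENNReal.ofReal ((f x - f y) ^ 2) ≤
      ENNReal.ofReal (16 * r ^ 2) * G * V := by
    refine (setLIntegral_setLIntegral_le_of_symm measurableSet_ball ENNReal.ofReal_ne_top hAmeas hpt2
      hA).trans_eq ?_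
    have e : ENNReal.ofReal (16 * r ^ 2) = ENNReal.ofReal (4 * r ^ 2) * 4 := by
      rw [show (4 : ℝ≥0∞) = ENNReal.ofReal 4 by norm_num, ← ENNReal.ofReal_mul (by positivity)]
      ring_nf
    rw [e]
    ring
  have : IsFiniteMeasure (volume.restrict (ball p r)) :=
    ⟨by rw [Measure.restrict_apply_univ]; exact measure_ball_lt_top⟩
  -- Some `y` does no worse than the average, so the value `f y` can stand in for the mean of `f`.
  obtain ⟨y, hy⟩ := exists_le_laverage (μ := volume.restrict (ball p r))
    (f := fun y => ∫⁻ x in ball p r, ENNReal.ofReal ((f x - f y) ^ 2))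
    (by rw [Ne, Measure.restrict_eq_zero]; exact hV0) hsq.lintegral_prod_right'.aemeasurable
  refine ⟨f y, ?_⟩
  rw [laverage_eq, Measure.restrict_apply_univ] at hy
  have hfin := hy.trans (ENNReal.div_le_of_le_mul htot)
  have i1 : IntegrableOn (gradSq f) (ball p r) :=
    ((continuous_gradSq hf).continuousOn.integrableOn_compact
      (isCompact_closedBall p r)).mono_set ball_subset_closedBall
  have i2 : IntegrableOn (fun x => (f x - f y) ^ 2) (ball p r) :=
    (((hf.continuous.sub continuous_const).pow 2).continuousOn.integrableOn_compact
      (isCompact_closedBall p r)).mono_set ball_subset_closedBall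
  rw [hG, ← ofReal_integral_eq_lintegral_ofReal i2 (ae_of_all _ fun _ => sq_nonneg _),
    ← ofReal_integral_eq_lintegral_ofReal i1 (ae_of_all _ fun _ => gradSq_nonneg _ _),
    ← ENNReal.ofReal_mul (by positivity)] at hfin
  exact (ENNReal.ofReal_le_ofReal_iff (mul_nonneg (by positivity)
    (integral_nonneg fun _ => gradSq_nonneg _ _))).1 hfin

/-- On the support of `φ` only the gradients of `f` and `u` matter. They are those of `ζ(f - c)` and
`ζ(u - c')`, whose energies over the plane are controlled by Poincaré's inequality on the doubled
ball. -/
theorem exists_local_trilinear_bound : ∃ C : ℝ, 0 < C ∧ ∀ (p : Plane) (r : ℝ), 0 < r →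
    ∀ φ f u : Plane → ℝ, IsTestFunction (ball p r) φ → ContDiff ℝ ∞ f → ContDiff ℝ ∞ u →
    |∫ x, φ x * jac f u x| ≤ C * √(∫ x, gradSq φ x) *
      (√(∫ x in ball p (2 * r), gradSq f x) * √(∫ x in ball p (2 * r), gradSq u x)) := by
  obtain ⟨C₀, hC₀, htri⟩ := exists_trilinear_bound
  obtain ⟨C₁, hC₁, hcut⟩ := exists_cutoff
  -- The second term is `4 (C₁/r)²` times the Poincaré constant `16 (2r)²` of the doubled ball; the
  -- radius cancels.
  set L := 2 + 256 * C₁ ^ 2 with hL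
  refine ⟨C₀ * (√L * √L), by positivity, fun p r hr φ f u hφ hf hu => ?_⟩
  obtain ⟨ζ, hζ, sζ, tζ, ζ1, ζ0, ζle, dζ⟩ := hcut p r hr
  have key : ∀ f : Plane → ℝ, ContDiff ℝ ∞ f → ∃ a : Plane → ℝ, ContDiff ℝ ∞ a ∧
      HasCompactSupport a ∧ (∀ k, ∀ x ∈ ball p r, partialDeriv k a x = partialDeriv k f x) ∧
      ∫ x, gradSq a x ≤ L * ∫ x in ball p (2 * r), gradSq f x := by
    intro f hf
    obtain ⟨c, hc⟩ := poincare_ball hf p (show 0 < 2 * r by positivity)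
    have hfc : ContDiff ℝ ∞ fun x => f x - c := hf.sub contDiff_const
    have hpd : ∀ k x, partialDeriv k (fun x => ζ x * (f x - c)) x =
        ζ x * partialDeriv k f x + partialDeriv k ζ x * (f x - c) := fun k x => by
      rw [partialDeriv_mul hζ hfc, partialDeriv_sub_const]
    refine ⟨fun x => ζ x * (f x - c), hζ.mul hfc, sζ.mul_right, fun k x hx => ?_, ?_⟩
    · have h1 : ζ =ᶠ[𝓝 x] fun _ => 1 := by
        filter_upwards [isOpen_ball.mem_nhds hx] with z hz using ζ1 z (ball_subset_closedBall hz)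
      have h2 : partialDeriv k ζ x = 0 := by simp [partialDeriv, h1.fderiv_eq]
      rw [hpd, h2, h1.eq_of_nhds]; ring
    · have e : ∫ x, gradSq (fun x => ζ x * (f x - c)) x =
          ∫ x in ball p (2 * r), gradSq (fun x => ζ x * (f x - c)) x := by
        rw [setIntegral_eq_integral_of_forall_compl_eq_zero]
        intro x hx
        by_contra h
        exact hx (tζ (tsupport_mul_subset_left (support_gradSq_subset _ h)))
      have i1 : IntegrableOn (gradSq f) (ball p (2 * r)) :=
        ((continuous_gradSq hf).continuousOn.integrableOn_compact
          (isCompact_closedBall p _)).mono_set ball_subset_closedBall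
      have i2 : IntegrableOn (fun x => (f x - c) ^ 2) (ball p (2 * r)) :=
        ((hfc.continuous.pow 2).continuousOn.integrableOn_compact
          (isCompact_closedBall p _)).mono_set ball_subset_closedBall
      have h1 : ∫ x in ball p (2 * r), gradSq (fun x => ζ x * (f x - c)) x ≤
          ∫ x in ball p (2 * r), (2 * gradSq f x + 4 * (C₁ / r) ^ 2 * (f x - c) ^ 2) := by
        refine integral_mono (integrable_gradSq (hζ.mul hfc) sζ.mul_right).integrableOn
          ((i1.const_mul 2).add (i2.const_mul _)) fun x => ?_
        have hz : ζ x ^ 2 ≤ 1 := pow_le_one₀ (ζ0 x) (ζle x)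
        have hb : ∀ k, partialDeriv k (fun x => ζ x * (f x - c)) x ^ 2 ≤
            2 * partialDeriv k f x ^ 2 + 2 * ((C₁ / r) ^ 2 * (f x - c) ^ 2) := fun k => by
          rw [hpd]
          have hd : partialDeriv k ζ x ^ 2 ≤ (C₁ / r) ^ 2 :=
            sq_le_sq' (neg_le_of_abs_le (dζ k x)) (le_of_abs_le (dζ k x))
          have h3 := mul_le_mul_of_nonneg_right hz (sq_nonneg (partialDeriv k f x))
          have h4 := mul_le_mul_of_nonneg_right hd (sq_nonneg (f x - c))
          nlinarith [sq_nonneg (ζ x * partialDeriv k f x - partialDeriv k ζ x * (f x - c))]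
        have h0 := hb 0
        have h1 := hb 1
        simp only [gradSq]
        linarith
      rw [integral_add (i1.const_mul 2) (i2.const_mul _), integral_const_mul,
        integral_const_mul] at h1
      rw [e]
      refine h1.trans ?_
      have h2 := mul_le_mul_of_nonneg_left hc (show 0 ≤ 4 * (C₁ / r) ^ 2 by positivity)
      have e2 : 4 * (C₁ / r) ^ 2 * (16 * (2 * r) ^ 2 * ∫ x in ball p (2 * r), gradSq f x) =
          256 * C₁ ^ 2 * ∫ x in ball p (2 * r), gradSq f x := by field_simp; ring
      rw [e2] at h2
      rw [hL]; linarith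
  obtain ⟨a, ha, sa, da, Ea⟩ := key f hf
  obtain ⟨b, hb, sb, db, Eb⟩ := key u hu
  have e : ∫ x, φ x * jac f u x = ∫ x, φ x * jac a b x := by
    refine integral_congr_ae (ae_of_all _ fun x => ?_)
    by_cases hx : x ∈ ball p r
    · simp only [jac, da _ x hx, db _ x hx]
    · simp [hφ.eq_zero hx]
  rw [e]
  refine (htri φ a b hφ.1 ha hb hφ.2.1 sa sb).trans ?_
  have h1 := Real.sqrt_le_sqrt Ea
  have h2 := Real.sqrt_le_sqrt Eb
  rw [Real.sqrt_mul (by positivity)] at h1 h2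
  have := mul_le_mul h1 h2 (Real.sqrt_nonneg _) (by positivity)
  have h3 := mul_le_mul_of_nonneg_left this
    (show 0 ≤ C₀ * √(∫ x, gradSq φ x) by positivity)
  refine h3.trans_eq ?_
  ring

end Poincare

/-! ### Mollification and its convergence almost everywhere and in `L²`. -/

section Mollifier

/-- A sequence of bump functions shrinking to the origin. -/
noncomputable def molBump (n : ℕ) : ContDiffBump (0 : Plane) where
  rIn := 1 / (2 * (n + 1))
  rOut := 1 / (n + 1)
  rIn_pos := by positivity
  rIn_lt_rOut := by
    rw [div_lt_div_iff₀ (by positivity) (by positivity)]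
    have : (0 : ℝ) < n + 1 := by positivity
    linarith

/-- The mollifying kernels. -/
noncomputable def molKer (n : ℕ) : Plane → ℝ := (molBump n).normed volume

/-- Mollification. -/
noncomputable def mol (n : ℕ) (f : Plane → ℝ) : Plane → ℝ :=
  convolution (molKer n) f (ContinuousLinearMap.lsmul ℝ ℝ) volume

variable {f : Plane → ℝ}

theorem mol_apply (n : ℕ) (f : Plane → ℝ) (x : Plane) :
    mol n f x = ∫ t, molKer n t * f (x - t) := by
  simp [mol, convolution_def]

theorem contDiff_molKer (n : ℕ) : ContDiff ℝ ∞ (molKer n) := (molBump n).contDiff_normed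

theorem hasCompactSupport_molKer (n : ℕ) : HasCompactSupport (molKer n) :=
  (molBump n).hasCompactSupport_normed

theorem molKer_nonneg (n : ℕ) (t : Plane) : 0 ≤ molKer n t := (molBump n).nonneg_normed t

theorem integral_molKer (n : ℕ) : ∫ t, molKer n t = 1 := (molBump n).integral_normed

theorem integrable_molKer (n : ℕ) : Integrable (molKer n) := (molBump n).integrable_normed

theorem molKer_eq_zero {n : ℕ} {t : Plane} (ht : 1 / ((n : ℝ) + 1) ≤ ‖t‖) : molKer n t = 0 := by
  by_contra h
  have h1 : t ∈ Function.support (molKer n) := h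
  rw [molKer, (molBump n).support_normed_eq, mem_ball_zero_iff] at h1
  exact absurd h1 (not_lt.2 ht)

theorem tendsto_one_div_succ : Tendsto (fun n : ℕ => 1 / ((n : ℝ) + 1)) atTop (𝓝 0) :=
  tendsto_one_div_add_atTop_nhds_zero_nat

theorem contDiff_mol (n : ℕ) (hf : LocallyIntegrable f) : ContDiff ℝ ∞ (mol n f) :=
  (hasCompactSupport_molKer n).contDiff_convolution_left _ (n := ⊤) (contDiff_molKer n) hf

theorem ae_tendsto_mol (hf : LocallyIntegrable f) :
    ∀ᵐ x, Tendsto (fun n => mol n f x) atTop (𝓝 (f x)) := by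
  refine ContDiffBump.ae_convolution_tendsto_right_of_locallyIntegrable (φ := molBump) (K := 2)
    ?_ (Eventually.of_forall fun n => ?_) hf
  · exact tendsto_one_div_succ
  · simp only [molBump]
    field_simp
    exact le_rfl

theorem integrable_molKer_mul (n : ℕ) {g : Plane → ℝ} (hg : LocallyIntegrable g) (x : Plane) :
    Integrable fun t => molKer n t * g (x - t) := by
  have h : ConvolutionExistsAt (molKer n) g x (ContinuousLinearMap.lsmul ℝ ℝ) volume :=
    (hasCompactSupport_molKer n).convolutionExists_left _ (contDiff_molKer n).continuous hg x
  exact h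

theorem abs_mol_le (n : ℕ) {M : ℝ} (hM : ∀ᵐ x, |f x| ≤ M) (x : Plane) : |mol n f x| ≤ M := by
  rw [mol_apply, ← Real.norm_eq_abs]
  have hM' : ∀ᵐ t, |f (x - t)| ≤ M :=
    (quasiMeasurePreserving_sub_left volume x).ae hM
  refine (norm_integral_le_of_norm_le ((integrable_molKer n).mul_const M) ?_).trans_eq ?_
  · filter_upwards [hM'] with t ht
    rw [Real.norm_eq_abs, abs_mul, abs_of_nonneg (molKer_nonneg n t)]
    exact mul_le_mul_of_nonneg_left ht (molKer_nonneg n t)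
  · rw [integral_mul_const, integral_molKer, one_mul]

theorem mol_eq_zero {n : ℕ} {p x : Plane} {ρ : ℝ} (hf : ∀ y ∉ ball p ρ, f y = 0)
    (hx : x ∉ ball p (ρ + 1 / ((n : ℝ) + 1))) : mol n f x = 0 := by
  rw [mol_apply]
  refine integral_eq_zero_of_ae (ae_of_all _ fun t => ?_)
  by_cases ht : 1 / ((n : ℝ) + 1) ≤ ‖t‖
  · simp [molKer_eq_zero ht]
  · have : x - t ∉ ball p ρ := fun h => hx <| by
      rw [mem_ball, dist_eq_norm] at h ⊢
      calc ‖x - p‖ = ‖(x - t - p) + t‖ := by congr 1; abel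
        _ ≤ ‖x - t - p‖ + ‖t‖ := norm_add_le _ _
        _ < _ := add_lt_add h (not_le.1 ht)
    simp [hf _ this]

theorem locallyIntegrable_of_memLp (hf : MemLp f 2) : LocallyIntegrable f :=
  hf.locallyIntegrable (by norm_num)

/-- Jensen's inequality for the probability density `molKer n`, by Cauchy–Schwarz with the kernel
split into two square roots. -/
theorem mol_sq_le (n : ℕ) (hf : MemLp f 2) (x : Plane) :
    mol n f x ^ 2 ≤ mol n (fun y => f y ^ 2) x := by
  have hloc := locallyIntegrable_of_memLp hf
  have hsq : LocallyIntegrable fun y => f y ^ 2 := hf.integrable_sq.locallyIntegrable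
  have i2 := integrable_molKer_mul n hsq x
  have hms : AEStronglyMeasurable (fun t => f (x - t)) :=
    hf.1.comp_quasiMeasurePreserving (quasiMeasurePreserving_sub_left volume x)
  have hsqrt : Continuous fun t => √(molKer n t) := (contDiff_molKer n).continuous.sqrt
  have m1 : MemLp (fun t => √(molKer n t)) 2 := by
    rw [memLp_two_iff_integrable_sq hsqrt.aestronglyMeasurable]
    simp_rw [Real.sq_sqrt (molKer_nonneg n _)]
    exact integrable_molKer n
  have m2 : MemLp (fun t => √(molKer n t) * f (x - t)) 2 := by
    refine (memLp_two_iff_integrable_sq (hsqrt.aestronglyMeasurable.mul hms)).2 ?_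
    simp only [Pi.mul_apply]
    simp_rw [mul_pow, Real.sq_sqrt (molKer_nonneg n _)]
    exact i2
  have h := abs_integral_mul_le_sqrt m1 m2
  simp_rw [← mul_assoc, mul_pow, Real.mul_self_sqrt (molKer_nonneg n _),
    Real.sq_sqrt (molKer_nonneg n _), integral_molKer, Real.sqrt_one, one_mul, ← mol_apply] at h
  have h0 : 0 ≤ mol n (fun y => f y ^ 2) x := by
    rw [mol_apply]
    exact integral_nonneg fun t => mul_nonneg (molKer_nonneg n t) (sq_nonneg _)
  have h1 : ∫ t, molKer n t * f (x - t) ^ 2 = mol n (fun y => f y ^ 2) x := by rw [mol_apply]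
  rw [h1] at h
  calc mol n f x ^ 2 = |mol n f x| ^ 2 := (sq_abs _).symm
    _ ≤ √(mol n (fun y => f y ^ 2) x) ^ 2 := by gcongr
    _ = _ := Real.sq_sqrt h0

theorem integrable_mol (n : ℕ) {g : Plane → ℝ} (hg : Integrable g) : Integrable (mol n g) :=
  (integrable_molKer n).integrable_convolution _ hg

theorem integral_mol (n : ℕ) {g : Plane → ℝ} (hg : Integrable g) : ∫ x, mol n g x = ∫ x, g x := by
  have := integral_convolution (ContinuousLinearMap.lsmul ℝ ℝ) (integrable_molKer n) hg
    (μ := volume) (ν := volume)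
  rw [integral_molKer] at this
  simpa [mol] using this

theorem memLp_mol (n : ℕ) (hf : MemLp f 2) : MemLp (mol n f) 2 := by
  have hc := (contDiff_mol n (locallyIntegrable_of_memLp hf)).continuous
  rw [memLp_two_iff_integrable_sq hc.aestronglyMeasurable]
  refine (integrable_mol n hf.integrable_sq).mono' (hc.pow 2).aestronglyMeasurable
    (ae_of_all _ fun x => ?_)
  rw [Real.norm_eq_abs, abs_of_nonneg (sq_nonneg _)]
  exact mol_sq_le n hf x

theorem integral_mol_sq_le (n : ℕ) (hf : MemLp f 2) :
    ∫ x, mol n f x ^ 2 ≤ ∫ x, f x ^ 2 := by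
  rw [← integral_mol n hf.integrable_sq]
  exact integral_mono (memLp_mol n hf).integrable_sq (integrable_mol n hf.integrable_sq)
    (mol_sq_le n hf)

/-- By the parallelogram law and the contraction property, `‖f_n - f‖² ≤ 4‖f‖² - ‖f_n + f‖²`. Since
`f_n → f` almost everywhere, Fatou's lemma gives `liminf ‖f_n + f‖² ≥ 4‖f‖²`. -/
theorem tendsto_integral_sq_mol_sub (hf : MemLp f 2) :
    Tendsto (fun n => ∫ x, (mol n f x - f x) ^ 2) atTop (𝓝 0) := by
  set F := ∫ x, f x ^ 2
  have hadd : ∀ n, MemLp (fun x => mol n f x + f x) 2 := fun n => (memLp_mol n hf).add hf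
  have hsub : ∀ n, MemLp (fun x => mol n f x - f x) 2 := fun n => (memLp_mol n hf).sub hf
  have hpar : ∀ n, ∫ x, (mol n f x - f x) ^ 2 ≤ 4 * F - ∫ x, (mol n f x + f x) ^ 2 := by
    intro n
    have e : (∫ x, (mol n f x - f x) ^ 2) + ∫ x, (mol n f x + f x) ^ 2 =
        2 * (∫ x, mol n f x ^ 2) + 2 * F := by
      rw [← integral_add (hsub n).integrable_sq (hadd n).integrable_sq, ← integral_const_mul,
        ← integral_const_mul, ← integral_add ((memLp_mol n hf).integrable_sq.const_mul 2)
        (hf.integrable_sq.const_mul 2)]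
      exact integral_congr_ae (ae_of_all _ fun x => by ring)
    linarith [integral_mol_sq_le n hf]
  have hfatou : ENNReal.ofReal (4 * F) ≤
      liminf (fun n => ENNReal.ofReal (∫ x, (mol n f x + f x) ^ 2)) atTop := by
    have e1 : ENNReal.ofReal (4 * F) = ∫⁻ x, ENNReal.ofReal (4 * f x ^ 2) := by
      rw [← integral_const_mul, ofReal_integral_eq_lintegral_ofReal (hf.integrable_sq.const_mul 4)
        (ae_of_all _ fun x => by positivity)]
    have e2 : ∀ n, ENNReal.ofReal (∫ x, (mol n f x + f x) ^ 2) =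
        ∫⁻ x, ENNReal.ofReal ((mol n f x + f x) ^ 2) := fun n =>
      ofReal_integral_eq_lintegral_ofReal (hadd n).integrable_sq (ae_of_all _ fun x => sq_nonneg _)
    rw [e1]
    simp_rw [e2]
    refine le_trans (le_of_eq ?_) (lintegral_liminf_le' fun n => ?_)
    · refine lintegral_congr_ae ?_
      filter_upwards [ae_tendsto_mol (locallyIntegrable_of_memLp hf)] with x hx
      refine (Tendsto.liminf_eq ?_).symm
      refine ENNReal.tendsto_ofReal ?_
      have := (hx.add_const (f x)).pow 2
      convert! this using 2
      ring
    · exact ((hadd n).1.aemeasurable.pow_const 2).ennreal_ofReal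
  rw [Metric.tendsto_atTop']
  intro δ hδ
  have hF : 0 ≤ F := integral_nonneg fun _ => sq_nonneg _
  have hev : ∀ᶠ n in atTop, 4 * F - δ < ∫ x, (mol n f x + f x) ^ 2 := by
    by_cases hlt : 4 * F - δ < 0
    · exact Eventually.of_forall fun n => hlt.trans_le (integral_nonneg fun _ => sq_nonneg _)
    · have h1 : ENNReal.ofReal (4 * F - δ) < ENNReal.ofReal (4 * F) := by
        rw [ENNReal.ofReal_lt_ofReal_iff_of_nonneg (not_lt.1 hlt)]; linarith
      have h2 := eventually_lt_of_lt_liminf (h1.trans_le hfatou)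
      filter_upwards [h2] with n hn
      exact (ENNReal.ofReal_lt_ofReal_iff_of_nonneg (not_lt.1 hlt)).1 hn
  obtain ⟨N, hN⟩ := eventually_atTop.1 hev
  refine ⟨N, fun n hn => ?_⟩
  rw [Real.dist_eq, sub_zero, abs_of_nonneg (integral_nonneg fun _ => sq_nonneg _)]
  linarith [hpar n, hN n hn.le]

end Mollifier

/-! ### Interior estimates for the potentials used in the duality argument. -/

section Duality

theorem isFiniteMeasure_restrict_ball (p : Plane) (r : ℝ) :
    IsFiniteMeasure (volume.restrict (ball p r)) :=
  ⟨by rw [Measure.restrict_apply_univ]; exact measure_ball_lt_top⟩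

theorem integrable_of_cutoff {χ F : Plane → ℝ} (hs : HasCompactSupport χ) (hF : Continuous F)
    (h0 : ∀ x ∉ tsupport χ, F x = 0) : Integrable F :=
  hF.integrable_of_hasCompactSupport (hs.mono' fun x hx => by
    by_contra hn
    exact hx (h0 x hn))

theorem partialDeriv_eq_zero_of_notMem {χ : Plane → ℝ} {x : Plane} (hx : x ∉ tsupport χ)
    (k : Fin 2) : partialDeriv k χ x = 0 := by
  by_contra hne
  exact hx (support_partialDeriv_subset k χ hne)

/-- An interior energy estimate for solutions of `Δ α = ∂_j Z`. -/
theorem integral_gradSq_cutoff_mul_le {χ α Z : Plane → ℝ} (hχ : ContDiff ℝ ∞ χ)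
    (hs : HasCompactSupport χ) (hα : ContDiff ℝ ∞ α) (hZ : ContDiff ℝ ∞ Z) (j : Fin 2)
    (hlap : ∀ x, ∑ k, partialDeriv k (partialDeriv k α) x = partialDeriv j Z x) :
    ∫ x, gradSq (fun x => χ x * α x) x ≤
      16 * (∫ x, χ x ^ 2 * Z x ^ 2) + 26 * ∫ x, α x ^ 2 * gradSq χ x := by
  have cχ := hχ.continuous
  have cα := hα.continuous
  have cZ := hZ.continuous
  have cdχ := fun k => (contDiff_partialDeriv hχ k).continuous
  have cdα := fun k => (contDiff_partialDeriv hα k).continuous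
  have hq : ContDiff ℝ ∞ (fun x => χ x * (χ x * α x)) := hχ.mul (hχ.mul hα)
  have hqs : HasCompactSupport (fun x => χ x * (χ x * α x)) := hs.mul_right
  have z0 : ∀ x ∉ tsupport χ, χ x = 0 := fun x hx => image_eq_zero_of_notMem_tsupport hx
  have z1 : ∀ x ∉ tsupport χ, gradSq χ x = 0 := fun x hx => by
    simp [gradSq, partialDeriv_eq_zero_of_notMem hx]
  have i1 : Integrable fun x => χ x ^ 2 * gradSq α x :=
    integrable_of_cutoff hs ((cχ.pow 2).mul (continuous_gradSq hα)) fun x hx => by simp [z0 x hx]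
  have i2 : Integrable fun x => χ x ^ 2 * Z x ^ 2 :=
    integrable_of_cutoff hs ((cχ.pow 2).mul (cZ.pow 2)) fun x hx => by simp [z0 x hx]
  have i3 : Integrable fun x => α x ^ 2 * gradSq χ x :=
    integrable_of_cutoff hs ((cα.pow 2).mul (continuous_gradSq hχ)) fun x hx => by simp [z1 x hx]
  have h1 := integral_cutoff_sq_mul_gradSq_le hχ hs hα
  have e1 : ∫ x, χ x ^ 2 * α x * ∑ k, partialDeriv k (partialDeriv k α) x =
      - ∫ x, (χ x ^ 2 * partialDeriv j α x + 2 * χ x * α x * partialDeriv j χ x) * Z x := by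
    simp_rw [hlap]
    have h := integral_mul_partialDeriv hZ hq hqs j
    rw [show (∫ x, χ x ^ 2 * α x * partialDeriv j Z x) =
      ∫ x, partialDeriv j Z x * (χ x * (χ x * α x)) from
        integral_congr_ae (ae_of_all _ fun x => by ring), ← neg_eq_iff_eq_neg, ← h]
    refine integral_congr_ae (ae_of_all _ fun x => ?_)
    simp only [partialDeriv_mul hχ (hχ.mul hα), partialDeriv_mul hχ hα]
    ring
  -- Caccioppoli's factor two doubles the weight `1/4`, so half of the energy is absorbed. What
  -- remains is `E ≤ 8∫χ²Z² + 12∫α²|∇χ|²`, and the product rule in `h3` turns this into `16` and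
  -- `26`.
  have h2 : ∫ x, (χ x ^ 2 * partialDeriv j α x + 2 * χ x * α x * partialDeriv j χ x) * Z x ≤
      1 / 4 * (∫ x, χ x ^ 2 * gradSq α x) + 2 * (∫ x, χ x ^ 2 * Z x ^ 2) +
        ∫ x, α x ^ 2 * gradSq χ x := by
    have i4 : Integrable fun x => 1 / 4 * (χ x ^ 2 * gradSq α x) + 2 * (χ x ^ 2 * Z x ^ 2) :=
      (i1.const_mul _).add (i2.const_mul _)
    rw [← integral_const_mul, ← integral_const_mul,
      ← integral_add (i1.const_mul _) (i2.const_mul _), ← integral_add i4 i3]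
    refine integral_mono ?_ (i4.add i3) fun x => ?_
    · have := cdχ j
      have := cdα j
      exact integrable_of_cutoff hs (by fun_prop) fun x hx => by simp [z0 x hx]
    · have g1 : partialDeriv j α x ^ 2 ≤ gradSq α x := by
        unfold gradSq
        fin_cases j <;> simp <;> positivity
      have g2 : partialDeriv j χ x ^ 2 ≤ gradSq χ x := by
        unfold gradSq
        fin_cases j <;> simp <;> positivity
      have g3 := mul_le_mul_of_nonneg_left g1 (sq_nonneg (χ x))
      have g4 := mul_le_mul_of_nonneg_left g2 (sq_nonneg (α x))
      nlinarith [sq_nonneg (χ x * partialDeriv j α x - 2 * (χ x * Z x)),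
        sq_nonneg (α x * partialDeriv j χ x - χ x * Z x)]
  have h3 : ∫ x, gradSq (fun x => χ x * α x) x ≤
      2 * (∫ x, χ x ^ 2 * gradSq α x) + 2 * ∫ x, α x ^ 2 * gradSq χ x := by
    rw [← integral_const_mul, ← integral_const_mul,
      ← integral_add (i1.const_mul _) (i3.const_mul _)]
    refine integral_mono (integrable_gradSq (hχ.mul hα) hs.mul_right)
      ((i1.const_mul _).add (i3.const_mul _)) fun x => ?_
    simp only [gradSq, partialDeriv_mul hχ hα]
    nlinarith [sq_nonneg (χ x * partialDeriv 0 α x - partialDeriv 0 χ x * α x),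
      sq_nonneg (χ x * partialDeriv 1 α x - partialDeriv 1 χ x * α x)]
  rw [e1] at h1
  linarith

/-- Smoothness and decay of the gradient of the potential of a function supported in a small
ball, away from that ball. -/
theorem abs_partialDeriv_pot_le {ε : ℝ} (hε : 0 < ε) {y : Plane → ℝ} {p : Plane} {ρ r : ℝ}
    (hr : 0 < r) (hρ : 0 < ρ) (hρr : 4 * ρ ≤ r) (hy : IsTestFunction (ball p ρ) y) (j : Fin 2)
    {x : Plane} (hx : r / 2 ≤ dist x p) :
    |partialDeriv j (pot ε y) x| ≤ 4 * √Real.pi * (ρ / r) * √(∫ x, y x ^ 2) := by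
  rw [partialDeriv_pot_apply hε hy.1 hy.2.1]
  have hyi : Integrable fun t => |y t| :=
    (hy.1.continuous.integrable_of_hasCompactSupport hy.2.1).abs
  have h1 : |∫ t, partialDeriv j (logKer ε) t * y (x - t)| ≤ 4 / r * ∫ t, |y t| := by
    rw [← integral_sub_left_eq_self (fun t => |y t|) volume x, ← integral_const_mul,
      ← Real.norm_eq_abs]
    refine norm_integral_le_of_norm_le ((hyi.comp_sub_left x).const_mul _)
      (ae_of_all _ fun t => ?_)
    rw [Real.norm_eq_abs, abs_mul]
    by_cases ht : x - t ∈ ball p ρ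
    · refine mul_le_mul_of_nonneg_right ?_ (abs_nonneg _)
      refine (abs_partialDeriv_logKer_le hε j t).trans ?_
      -- The kernel is evaluated at distance at least `r/2 - ρ ≥ r/4` from its singularity.
      have h2 : r / 4 ≤ ‖t‖ := by
        rw [mem_ball, dist_eq_norm] at ht
        rw [dist_eq_norm] at hx
        have : ‖x - p‖ ≤ ‖x - t - p‖ + ‖t‖ := by
          calc ‖x - p‖ = ‖(x - t - p) + t‖ := by congr 1; abel
            _ ≤ _ := norm_add_le _ _
        linarith
      rw [inv_le_comm₀ (by linarith) (by positivity), inv_div]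
      exact h2
    · simp [hy.eq_zero ht]
  refine h1.trans ?_
  have hm : MemLp y 2 (volume.restrict (ball p ρ)) :=
    (memLp_of_smooth hy.1.continuous hy.2.1 2).restrict _
  have := isFiniteMeasure_restrict_ball p ρ
  have h3 := integral_abs_mul_le_sqrt hm (memLp_const (1 : ℝ))
  have e0 : ∀ {F : Plane → ℝ}, (∀ t ∉ ball p ρ, F t = 0) → ∫ t in ball p ρ, F t = ∫ t, F t :=
    fun h => setIntegral_eq_integral_of_forall_compl_eq_zero fun t ht => h t ht
  simp only [abs_one, mul_one, one_pow, integral_const, smul_eq_mul,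
    measureReal_restrict_apply_univ] at h3
  rw [e0 fun t ht => by simp [hy.eq_zero ht], e0 fun t ht => by simp [hy.eq_zero ht],
    volume_real_ball_plane p hρ.le, Real.sqrt_mul Real.pi_pos.le, Real.sqrt_sq hρ.le] at h3
  calc 4 / r * ∫ t, |y t| ≤ 4 / r * (√(∫ x, y x ^ 2) * (√Real.pi * ρ)) := by gcongr
    _ = _ := by field_simp

end Duality

/-! ### Decay of planar fields with small divergence and curl. -/

section Duality

/-- The two hypotheses say that divergence and curl of `X` have size `M` in the dual of `W^{1,2}_0`.
If `Δq = y`, then `X₀ y` is the pairing of `X` with `∇(∂₀q)` plus the pairing of its rotation with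
`∇(∂₁q)`. Cutting `∂_j q` off makes them admissible, with energy controlled by the `L²` norm of `y`.
The cutoff errors live at distance at least `r/2` from `p`, where `|∇q|` carries the small factor
`ρ/r`. -/
theorem exists_duality_test_bound : ∃ C : ℝ, 0 < C ∧ ∀ (p : Plane) (r ρ M : ℝ), 0 < r → 0 < ρ →
    4 * ρ ≤ r → 0 ≤ M → ∀ X₀ X₁ : Plane → ℝ, MemLp X₀ 2 → MemLp X₁ 2 →
    (∀ φ, IsTestFunction (ball p r) φ →
      |∫ x, (X₀ x * partialDeriv 0 φ x + X₁ x * partialDeriv 1 φ x)| ≤ M * √(∫ x, gradSq φ x)) →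
    (∀ φ, IsTestFunction (ball p r) φ →
      |∫ x, (X₀ x * partialDeriv 1 φ x - X₁ x * partialDeriv 0 φ x)| ≤ M * √(∫ x, gradSq φ x)) →
    ∀ y, IsTestFunction (ball p ρ) y →
      |∫ x, X₀ x * y x| ≤
        (C * (ρ / r) * √(∫ x in ball p r, (X₀ x ^ 2 + X₁ x ^ 2)) + C * M) * √(∫ x, y x ^ 2) := by
  obtain ⟨C₀, hC₀, hcut⟩ := exists_cutoff
  have hm := diracMass_pos
  -- The constant of `abs_partialDeriv_pot_le` times the square root of the energy bound for the
  -- cutoff.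
  set Ca := 4 * √Real.pi * √(8 * Real.pi) * C₀ with hCa
  have hCa0 : 0 < Ca := by positivity
  set C₁ := √2 * Ca / diracMass with hC₁
  set C₂ := 2 * √(16 * diracMass ^ 2 + 26 * Ca ^ 2) / diracMass with hC₂
  have hC₁0 : 0 < C₁ := by positivity
  have hC₂0 : 0 < C₂ := by positivity
  refine ⟨max C₁ C₂, by positivity, fun p r ρ M hr hρ hρr hM X₀ X₁ hX₀ hX₁ hdiv hcurl y hy => ?_⟩
  obtain ⟨χ, hχ, sχ, tχ, χ1, χ0, χle, dχ⟩ := hcut p (r / 2) (by positivity)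
  rw [mul_div_cancel₀ r two_ne_zero] at tχ
  have hEχ : ∫ x, gradSq χ x ≤ 8 * Real.pi * C₀ ^ 2 :=
    integral_gradSq_cutoff_le (r := r / 2) (p := p) (by positivity) hχ sχ
      (by rwa [mul_div_cancel₀ r two_ne_zero]) dχ
  have hχtest : IsTestFunction (ball p r) χ := ⟨hχ, sχ, tχ⟩
  have dχ0 : ∀ x, dist x p < r / 2 → ∀ k, partialDeriv k χ x = 0 := by
    intro x hx k
    have h1 : χ =ᶠ[𝓝 x] fun _ => 1 := by
      filter_upwards [isOpen_ball.mem_nhds (mem_ball.2 hx)] with z hz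
        using χ1 z (ball_subset_closedBall hz)
    simp [partialDeriv, h1.fderiv_eq]
  set Y := √(∫ x, y x ^ 2) with hY
  have hY0 : 0 ≤ Y := Real.sqrt_nonneg _
  set XX := √(∫ x in ball p r, (X₀ x ^ 2 + X₁ x ^ 2)) with hXX
  obtain ⟨S, hS0, hS⟩ := exists_abs_le_of_hasCompactSupport hy.1.continuous hy.2.1
  let Z : ℝ → Plane → ℝ := fun ε x => ∑ k, partialDeriv k (partialDeriv k (pot ε y)) x
  have hZs : ∀ ε > 0, ContDiff ℝ ∞ (Z ε) := fun ε hε => ContDiff.sum fun k _ =>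
    contDiff_partialDeriv (contDiff_partialDeriv (contDiff_pot hε hy.1 hy.2.1) k) k
  have ρr : ρ / r ≤ 1 := by rw [div_le_one hr]; linarith
  have step : ∀ ε > 0, |∫ x, X₀ x * (χ x * Z ε x)| ≤
      M * (2 * √(16 * (∫ x, χ x ^ 2 * Z ε x ^ 2) + 26 * (Ca * Y) ^ 2)) +
        XX * (√2 * (Ca * (ρ / r) * Y)) := by
    intro ε hε
    have hq : ContDiff ℝ ∞ (pot ε y) := contDiff_pot hε hy.1 hy.2.1
    let α : Fin 2 → Plane → ℝ := fun j => partialDeriv j (pot ε y)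
    have hα : ∀ j, ContDiff ℝ ∞ (α j) := fun j => contDiff_partialDeriv hq j
    have hαlap : ∀ j x, ∑ k, partialDeriv k (partialDeriv k (α j)) x = partialDeriv j (Z ε) x := by
      intro j x
      have e : ∀ k, partialDeriv k (partialDeriv k (α j)) x =
          partialDeriv j (partialDeriv k (partialDeriv k (pot ε y))) x := fun k => by
        have : partialDeriv k (α j) = partialDeriv j (partialDeriv k (pot ε y)) :=
          funext fun z => partialDeriv_comm hq k j z
        rw [this, partialDeriv_comm (contDiff_partialDeriv hq k)]
      simp_rw [e]
      have := fun k : Fin 2 => contDiff_partialDeriv (contDiff_partialDeriv hq k) k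
      rw [Fin.sum_univ_two, ← partialDeriv_add (this 0) (this 1)]
      simp only [Z, Fin.sum_univ_two]
    have hαb : ∀ j x, α j x ^ 2 * gradSq χ x ≤
        (4 * √Real.pi * (ρ / r) * Y) ^ 2 * gradSq χ x := by
      intro j x
      by_cases hx : dist x p < r / 2
      · simp [gradSq, dχ0 x hx]
      · refine mul_le_mul_of_nonneg_right ?_ (gradSq_nonneg _ _)
        have := abs_partialDeriv_pot_le hε hr hρ hρr hy j (not_lt.1 hx)
        exact sq_le_sq' (neg_le_of_abs_le this) (le_of_abs_le this)
    have iα : ∀ j, Integrable fun x => α j x ^ 2 * gradSq χ x := fun j =>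
      (((hα j).continuous.pow 2).mul (continuous_gradSq hχ)).integrable_of_hasCompactSupport
        (hasCompactSupport_gradSq sχ).mul_left
    have hαi : ∀ j, ∫ x, α j x ^ 2 * gradSq χ x ≤ (Ca * (ρ / r) * Y) ^ 2 := by
      intro j
      calc _ ≤ ∫ x, (4 * √Real.pi * (ρ / r) * Y) ^ 2 * gradSq χ x :=
            integral_mono (iα j) ((integrable_gradSq hχ sχ).const_mul _) (hαb j)
        _ ≤ (4 * √Real.pi * (ρ / r) * Y) ^ 2 * (8 * Real.pi * C₀ ^ 2) := by
            rw [integral_const_mul]; gcongr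
        _ = _ := by
            have e8 : (8 * Real.pi) = √(8 * Real.pi) ^ 2 := (Real.sq_sqrt (by positivity)).symm
            rw [hCa]
            conv_lhs => rw [e8]
            ring
    have hαi' : ∀ j, ∫ x, α j x ^ 2 * gradSq χ x ≤ (Ca * Y) ^ 2 := fun j => by
      refine (hαi j).trans (pow_le_pow_left₀ (by positivity) ?_ 2)
      have : Ca * (ρ / r) ≤ Ca := mul_le_of_le_one_right hCa0.le ρr
      gcongr
    have hEn : ∀ j, √(∫ x, gradSq (fun x => χ x * α j x) x) ≤
        √(16 * (∫ x, χ x ^ 2 * Z ε x ^ 2) + 26 * (Ca * Y) ^ 2) := fun j => by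
      refine Real.sqrt_le_sqrt ?_
      have := integral_gradSq_cutoff_mul_le hχ sχ (hα j) (hZs ε hε) j (hαlap j)
      linarith [hαi' j]
    have htest : ∀ j, IsTestFunction (ball p r) (fun x => χ x * α j x) := fun j => by
      have := hχtest.mul_left (hα j)
      simp_rw [mul_comm] at this ⊢
      exact this
    have hpd : ∀ j k x, partialDeriv k (fun x => χ x * α j x) x =
        χ x * partialDeriv k (α j) x + partialDeriv k χ x * α j x := fun j k x =>
      partialDeriv_mul hχ (hα j) k x
    let E₀ : Plane → ℝ := fun x => α 0 x * partialDeriv 0 χ x + α 1 x * partialDeriv 1 χ x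
    let E₁ : Plane → ℝ := fun x => α 0 x * partialDeriv 1 χ x - α 1 x * partialDeriv 0 χ x
    have cα := fun j => (hα j).continuous
    have cdχ := fun k => (contDiff_partialDeriv hχ k).continuous
    have sE₀ : HasCompactSupport E₀ := sχ.mono' fun x hx => by
      by_contra hn
      exact hx (by simp [E₀, partialDeriv_eq_zero_of_notMem hn])
    have sE₁ : HasCompactSupport E₁ := sχ.mono' fun x hx => by
      by_contra hn
      exact hx (by simp [E₁, partialDeriv_eq_zero_of_notMem hn])
    have mE₀ : MemLp E₀ 2 := memLp_of_smooth (((cα 0).mul (cdχ 0)).add ((cα 1).mul (cdχ 1))) sE₀ 2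
    have mE₁ : MemLp E₁ 2 := memLp_of_smooth (((cα 0).mul (cdχ 1)).sub ((cα 1).mul (cdχ 0))) sE₁ 2
    have mT : ∀ j k, MemLp (partialDeriv k (fun x => χ x * α j x)) 2 := fun j k =>
      memLp_of_smooth (contDiff_partialDeriv (hχ.mul (hα j)) k).continuous
        (hasCompactSupport_partialDeriv (htest j).2.1 k) 2
    -- The Helmholtz-type splitting: the terms in `X₁` cancel since `∂₁∂₀q = ∂₀∂₁q`, and `E₀`, `E₁`
    -- collect the terms containing derivatives of the cutoff.
    have ident : ∫ x, X₀ x * (χ x * Z ε x) =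
        (∫ x, (X₀ x * partialDeriv 0 (fun x => χ x * α 0 x) x +
          X₁ x * partialDeriv 1 (fun x => χ x * α 0 x) x)) +
        (∫ x, (X₀ x * partialDeriv 1 (fun x => χ x * α 1 x) x -
          X₁ x * partialDeriv 0 (fun x => χ x * α 1 x) x)) -
        ∫ x, (X₀ x * E₀ x + X₁ x * E₁ x) := by
      have j1 : Integrable fun x => X₀ x * partialDeriv 0 (fun x => χ x * α 0 x) x +
          X₁ x * partialDeriv 1 (fun x => χ x * α 0 x) x :=
        (hX₀.integrable_mul (mT 0 0)).add (hX₁.integrable_mul (mT 0 1))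
      have j2 : Integrable fun x => X₀ x * partialDeriv 1 (fun x => χ x * α 1 x) x -
          X₁ x * partialDeriv 0 (fun x => χ x * α 1 x) x :=
        (hX₀.integrable_mul (mT 1 1)).sub (hX₁.integrable_mul (mT 1 0))
      have j3 : Integrable fun x => X₀ x * E₀ x + X₁ x * E₁ x :=
        (hX₀.integrable_mul mE₀).add (hX₁.integrable_mul mE₁)
      have j12 := integral_add j1 j2
      have j123 := integral_sub (j1.add j2) j3
      simp only [Pi.add_apply] at j123
      rw [← j12, ← j123]
      refine integral_congr_ae (ae_of_all _ fun x => ?_)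
      simp only [hpd, E₀, E₁, Z, Fin.sum_univ_two]
      have hc : partialDeriv 1 (α 0) x = partialDeriv 0 (α 1) x := partialDeriv_comm hq 1 0 x
      simp only [hc, α]
      ring
    have herr : |∫ x, (X₀ x * E₀ x + X₁ x * E₁ x)| ≤ XX * (√2 * (Ca * (ρ / r) * Y)) := by
      have e1 : ∫ x, (X₀ x * E₀ x + X₁ x * E₁ x) =
          ∫ x in ball p r, (X₀ x * E₀ x + X₁ x * E₁ x) := by
        rw [setIntegral_eq_integral_of_forall_compl_eq_zero]
        intro x hx
        have hn : x ∉ tsupport χ := fun h => hx (tχ h)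
        simp [E₀, E₁, partialDeriv_eq_zero_of_notMem hn]
      rw [e1]
      refine (abs_integral_pair_le (hX₀.restrict _) (hX₁.restrict _) (mE₀.restrict _)
        (mE₁.restrict _)).trans ?_
      refine mul_le_mul_of_nonneg_left ?_ (Real.sqrt_nonneg _)
      have e2 : ∀ x, E₀ x ^ 2 + E₁ x ^ 2 = α 0 x ^ 2 * gradSq χ x + α 1 x ^ 2 * gradSq χ x :=
        fun x => by simp only [E₀, E₁, gradSq]; ring
      simp_rw [e2]
      rw [← Real.sqrt_sq (show 0 ≤ Ca * (ρ / r) * Y by positivity),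
        ← Real.sqrt_mul (by norm_num : (0 : ℝ) ≤ 2)]
      refine Real.sqrt_le_sqrt ?_
      refine (setIntegral_le_integral ((iα 0).add (iα 1)) (ae_of_all _ fun x =>
        add_nonneg (mul_nonneg (sq_nonneg _) (gradSq_nonneg _ _))
          (mul_nonneg (sq_nonneg _) (gradSq_nonneg _ _)))).trans ?_
      simp only [Pi.add_apply]
      rw [integral_add (iα 0) (iα 1)]
      linarith [hαi 0, hαi 1]
    rw [ident]
    have d0 := (hdiv _ (htest 0)).trans (mul_le_mul_of_nonneg_left (hEn 0) hM)
    have d1 := (hcurl _ (htest 1)).trans (mul_le_mul_of_nonneg_left (hEn 1) hM)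
    refine (abs_sub _ _).trans ?_
    refine (add_le_add (abs_add_le _ _) herr).trans ?_
    linarith
  have cχ := hχ.continuous
  have sχ2 : HasCompactSupport (fun x => χ x ^ 2) := by
    simp_rw [sq]; exact sχ.mul_right
  have hXχ : Integrable fun x => |X₀ x| * |χ x| :=
    hX₀.abs.integrable_mul (memLp_of_smooth cχ sχ 2).abs
  have lim1 : Tendsto (fun ε => |∫ x, X₀ x * (χ x * Z ε x)|) (𝓝[>] 0)
      (𝓝 |∫ x, X₀ x * (χ x * (diracMass * y x))|) := by
    refine Tendsto.abs ?_
    refine tendsto_integral_filter_of_dominated_convergence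
      (fun x => |X₀ x| * |χ x| * (diracMass * S)) ?_ ?_ (hXχ.mul_const _) ?_
    · filter_upwards [self_mem_nhdsWithin] with ε hε
      exact hX₀.1.mul (cχ.mul (hZs ε hε).continuous).aestronglyMeasurable
    · filter_upwards [self_mem_nhdsWithin] with ε hε
      refine ae_of_all _ fun x => ?_
      rw [Real.norm_eq_abs, abs_mul, abs_mul, ← mul_assoc]
      exact mul_le_mul_of_nonneg_left (abs_sum_partialDeriv_pot_le hε hy.1 hy.2.1 hS x)
        (by positivity)
    · exact ae_of_all _ fun x =>
        ((tendsto_sum_partialDeriv_pot hy.1 hy.2.1 x).const_mul _).const_mul _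
  have lim2 : Tendsto (fun ε => ∫ x, χ x ^ 2 * Z ε x ^ 2) (𝓝[>] 0)
      (𝓝 (∫ x, χ x ^ 2 * (diracMass * y x) ^ 2)) := by
    refine tendsto_integral_filter_of_dominated_convergence
      (fun x => χ x ^ 2 * (diracMass * S) ^ 2) ?_ ?_
      (((cχ.pow 2).integrable_of_hasCompactSupport sχ2).mul_const _) ?_
    · filter_upwards [self_mem_nhdsWithin] with ε hε
      exact ((cχ.pow 2).mul ((hZs ε hε).continuous.pow 2)).aestronglyMeasurable
    · filter_upwards [self_mem_nhdsWithin] with ε hε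
      refine ae_of_all _ fun x => ?_
      rw [Real.norm_eq_abs, abs_of_nonneg (by positivity)]
      have h := abs_sum_partialDeriv_pot_le hε hy.1 hy.2.1 hS x
      exact mul_le_mul_of_nonneg_left
        (sq_le_sq' (neg_le_of_abs_le h) (le_of_abs_le h)) (sq_nonneg _)
    · exact ae_of_all _ fun x => ((tendsto_sum_partialDeriv_pot hy.1 hy.2.1 x).pow 2).const_mul _
  have hlim := le_of_tendsto_of_tendsto lim1
    ((((((lim2.const_mul 16).add_const (26 * (Ca * Y) ^ 2)).sqrt.const_mul 2).const_mul
      M).add_const (XX * (√2 * (Ca * (ρ / r) * Y))))) (by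
      filter_upwards [self_mem_nhdsWithin] with ε hε using step ε hε)
  have e1 : ∫ x, X₀ x * (χ x * (diracMass * y x)) = diracMass * ∫ x, X₀ x * y x := by
    rw [← integral_const_mul]
    refine integral_congr_ae (ae_of_all _ fun x => ?_)
    by_cases hx : x ∈ ball p ρ
    · have : χ x = 1 := χ1 x (mem_closedBall.2 (by rw [mem_ball] at hx; linarith))
      simp only [this]; ring
    · simp [hy.eq_zero hx]
  have h2 : ∫ x, χ x ^ 2 * (diracMass * y x) ^ 2 ≤ diracMass ^ 2 * Y ^ 2 := by
    have my := memLp_of_smooth hy.1.continuous hy.2.1 2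
    rw [hY, Real.sq_sqrt (integral_nonneg fun _ => sq_nonneg _), ← integral_const_mul]
    refine integral_mono ?_ (my.integrable_sq.const_mul _) fun x => ?_
    · exact ((cχ.pow 2).mul ((hy.1.continuous.const_mul _).pow
        2)).integrable_of_hasCompactSupport sχ2.mul_right
    · have h1 : χ x ^ 2 ≤ 1 := pow_le_one₀ (χ0 x) (χle x)
      simp only
      nlinarith [sq_nonneg (diracMass * y x)]
  have h3 : √(16 * (∫ x, χ x ^ 2 * (diracMass * y x) ^ 2) + 26 * (Ca * Y) ^ 2) ≤
      √(16 * diracMass ^ 2 + 26 * Ca ^ 2) * Y := by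
    rw [← Real.sqrt_sq hY0, ← Real.sqrt_mul (by positivity), Real.sqrt_sq hY0]
    refine Real.sqrt_le_sqrt ?_
    nlinarith
  rw [e1, abs_mul, abs_of_pos hm] at hlim
  have h4 : diracMass * |∫ x, X₀ x * y x| ≤
      M * (2 * (√(16 * diracMass ^ 2 + 26 * Ca ^ 2) * Y)) + XX * (√2 * (Ca * (ρ / r) * Y)) := by
    refine hlim.trans ?_
    gcongr
  have h5 : |∫ x, X₀ x * y x| ≤ (C₁ * (ρ / r) * XX + C₂ * M) * Y := by
    rw [hC₁, hC₂, ← mul_le_mul_iff_right₀ hm]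
    refine h4.trans_eq ?_
    field_simp
    ring
  refine h5.trans ?_
  gcongr
  · exact le_max_left _ _
  · exact le_max_right _ _

/-- Take `y` to be a mollification of `X₀` restricted to the small ball; in the limit `s² ≤ L s` for
its `L²` norm `s`. Mollified supports spill into the ball of radius `2ρ`, hence `8ρ ≤ r` in place of
`4ρ ≤ r`. -/
theorem exists_duality_bound : ∃ C : ℝ, 0 < C ∧ ∀ (p : Plane) (r ρ M : ℝ), 0 < r → 0 < ρ →
    8 * ρ ≤ r → 0 ≤ M → ∀ X₀ X₁ : Plane → ℝ, MemLp X₀ 2 → MemLp X₁ 2 →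
    (∀ φ, IsTestFunction (ball p r) φ →
      |∫ x, (X₀ x * partialDeriv 0 φ x + X₁ x * partialDeriv 1 φ x)| ≤ M * √(∫ x, gradSq φ x)) →
    (∀ φ, IsTestFunction (ball p r) φ →
      |∫ x, (X₀ x * partialDeriv 1 φ x - X₁ x * partialDeriv 0 φ x)| ≤ M * √(∫ x, gradSq φ x)) →
      √(∫ x in ball p ρ, X₀ x ^ 2) ≤
        C * (ρ / r) * √(∫ x in ball p r, (X₀ x ^ 2 + X₁ x ^ 2)) + C * M := by
  obtain ⟨C, hC, hbound⟩ := exists_duality_test_bound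
  refine ⟨2 * C, by positivity, fun p r ρ M hr hρ hρr hM X₀ X₁ hX₀ hX₁ hdiv hcurl => ?_⟩
  have hb := hbound p r (2 * ρ) M hr (by positivity) (by linarith) hM X₀ X₁ hX₀ hX₁ hdiv hcurl
  set XX := √(∫ x in ball p r, (X₀ x ^ 2 + X₁ x ^ 2)) with hXX
  have hXX0 : 0 ≤ XX := Real.sqrt_nonneg _
  set L := C * (2 * ρ / r) * XX + C * M with hL
  have hL0 : 0 ≤ L := by positivity
  let f : Plane → ℝ := (ball p ρ).indicator X₀
  have hf : MemLp f 2 := hX₀.indicator measurableSet_ball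
  have hfsq : ∫ x, f x ^ 2 = ∫ x in ball p ρ, X₀ x ^ 2 := by
    rw [← integral_indicator measurableSet_ball]
    refine integral_congr_ae (ae_of_all _ fun x => ?_)
    by_cases hx : x ∈ ball p ρ <;> simp [f, hx]
  have hfX : ∫ x, X₀ x * f x = ∫ x in ball p ρ, X₀ x ^ 2 := by
    rw [← hfsq]
    refine integral_congr_ae (ae_of_all _ fun x => ?_)
    by_cases hx : x ∈ ball p ρ <;> simp [f, hx, sq]
  have hfloc := locallyIntegrable_of_memLp hf
  have hev : ∀ᶠ n : ℕ in atTop, IsTestFunction (ball p (2 * ρ)) (mol n f) := by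
    have := tendsto_one_div_succ.eventually (gt_mem_nhds (show 0 < ρ / 2 by positivity))
    filter_upwards [this] with n hn
    have hsub : tsupport (mol n f) ⊆ closedBall p (3 / 2 * ρ) := by
      refine closure_minimal (fun x hx => ?_) isClosed_closedBall
      by_contra hx'
      refine hx (mol_eq_zero (p := p) (ρ := ρ) (fun z hz => by simp [f, hz]) fun h => hx' ?_)
      rw [mem_ball] at h
      rw [mem_closedBall]
      linarith
    exact ⟨contDiff_mol n hfloc, (isCompact_closedBall p _).of_isClosed_subset
      (isClosed_tsupport _) hsub, hsub.trans (closedBall_subset_ball (by linarith))⟩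
  have hbn : ∀ᶠ n : ℕ in atTop, |∫ x, X₀ x * mol n f x| ≤ L * √(∫ x in ball p ρ, X₀ x ^ 2) := by
    filter_upwards [hev] with n hn
    refine (hb _ hn).trans (mul_le_mul_of_nonneg_left (Real.sqrt_le_sqrt ?_) hL0)
    rw [← hfsq]
    exact integral_mol_sq_le n hf
  have hlim : Tendsto (fun n => ∫ x, X₀ x * mol n f x) atTop (𝓝 (∫ x in ball p ρ, X₀ x ^ 2)) := by
    rw [← hfX, tendsto_iff_norm_sub_tendsto_zero]
    have h0 : Tendsto (fun n => √(∫ x, X₀ x ^ 2) * √(∫ x, (mol n f x - f x) ^ 2)) atTop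
        (𝓝 0) := by
      simpa using ((tendsto_integral_sq_mol_sub hf).sqrt).const_mul √(∫ x, X₀ x ^ 2)
    refine squeeze_zero (fun n => norm_nonneg _) (fun n => ?_) h0
    have hmn := memLp_mol n hf
    have i1 : Integrable fun x => X₀ x * mol n f x := hX₀.integrable_mul hmn
    have i2 : Integrable fun x => X₀ x * f x := hX₀.integrable_mul hf
    rw [← integral_sub i1 i2, Real.norm_eq_abs]
    refine le_trans (le_of_eq ?_) (abs_integral_mul_le_sqrt hX₀ (hmn.sub hf))
    congr 1
    exact integral_congr_ae (ae_of_all _ fun x => by simp; ring)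
  have hfin := le_of_tendsto hlim.abs hbn
  have hnn : 0 ≤ ∫ x in ball p ρ, X₀ x ^ 2 := integral_nonneg fun _ => sq_nonneg _
  rw [abs_of_nonneg hnn] at hfin
  have h1 : √(∫ x in ball p ρ, X₀ x ^ 2) ≤ L := by
    set s := √(∫ x in ball p ρ, X₀ x ^ 2) with hs
    have hs2 : s ^ 2 = ∫ x in ball p ρ, X₀ x ^ 2 := Real.sq_sqrt hnn
    rw [← hs2] at hfin
    by_contra hlt
    have : 0 ≤ s := Real.sqrt_nonneg _
    nlinarith
  refine h1.trans ?_
  rw [hL]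
  have : 0 ≤ C * M := by positivity
  have e : C * (2 * ρ / r) * XX = 2 * C * (ρ / r) * XX := by ring
  linarith

end Duality

/-! ### Weak derivatives on the disk and smooth approximation. -/

section Sobolev

theorem isOpen_D2 : IsOpen D2 := isOpen_ball

theorem measurableSet_D2 : MeasurableSet D2 := measurableSet_ball

instance isFiniteMeasure_restrict_D2 : IsFiniteMeasure (volume.restrict D2) :=
  isFiniteMeasure_restrict_ball 0 1

theorem ball_subset_D2 {R : ℝ} (hR : R < 1) : ball (0 : Plane) R ⊆ D2 := ball_subset_ball hR.le

theorem integrable_mul_of_locallyIntegrableOn {U : Set Plane} {g φ : Plane → ℝ}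
    (hg : LocallyIntegrableOn g U) (hφ : Continuous φ) (hs : HasCompactSupport φ)
    (hU : tsupport φ ⊆ U) : Integrable fun x => g x * φ x := by
  have h1 : IntegrableOn g (tsupport φ) := hg.integrableOn_compact_subset hU hs
  obtain ⟨M, hM0, hM⟩ := exists_abs_le_of_hasCompactSupport hφ hs
  have h2 : IntegrableOn (fun x => g x * φ x) (tsupport φ) := by
    have := Integrable.bdd_mul (c := M) h1 (f := φ) hφ.aestronglyMeasurable (ae_of_all _ hM)
    simpa [mul_comm, IntegrableOn] using this
  refine (integrableOn_iff_integrable_of_support_subset fun x hx => ?_).1 h2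
  exact subset_tsupport φ (right_ne_zero_of_mul hx)

theorem setIntegral_mul_test {U : Set Plane} {g φ : Plane → ℝ} (hφ : IsTestFunction U φ) :
    ∫ x in U, g x * φ x = ∫ x, g x * φ x :=
  setIntegral_eq_integral_of_forall_compl_eq_zero fun x hx => by simp [hφ.eq_zero hx]

theorem IsTestFunction.integrable_mul {U : Set Plane} {g φ : Plane → ℝ} (hφ : IsTestFunction U φ)
    (hg : LocallyIntegrableOn g U) : Integrable fun x => g x * φ x :=
  integrable_mul_of_locallyIntegrableOn hg hφ.1.continuous hφ.2.1 hφ.2.2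

/-- Locally integrable functions with the same integrals against test functions agree. -/
theorem ae_eq_of_forall_test {U : Set Plane} (hU : IsOpen U) {g g' : Plane → ℝ}
    (hg : LocallyIntegrableOn g U) (hg' : LocallyIntegrableOn g' U)
    (h : ∀ φ, IsTestFunction U φ → ∫ x in U, g x * φ x = ∫ x in U, g' x * φ x) :
    g =ᵐ[volume.restrict U] g' := by
  have key := hU.ae_eq_zero_of_integral_contDiff_smul_eq_zero (f := fun x => g x - g' x)
    (μ := volume) (hg.sub hg') fun φ hφ hs hsu => by
      have hφt : IsTestFunction U φ := ⟨hφ, hs, hsu⟩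
      have h1 := h φ hφt
      rw [setIntegral_mul_test hφt, setIntegral_mul_test hφt] at h1
      have h2 := integral_sub (hφt.integrable_mul hg) (hφt.integrable_mul hg')
      rw [h1, sub_self] at h2
      rw [← h2]
      exact integral_congr_ae (ae_of_all _ fun x => by simp; ring)
  rw [Filter.EventuallyEq, ae_restrict_iff' hU.measurableSet]
  filter_upwards [key] with x hx hxU
  exact sub_eq_zero.1 (hx hxU)

theorem IsWeakPartial.ae_eq {U : Set Plane} (hU : IsOpen U) {k : Fin 2} {f g g' : Plane → ℝ}
    (h : IsWeakPartial U k f g) (h' : IsWeakPartial U k f g') : g =ᵐ[volume.restrict U] g' :=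
  ae_eq_of_forall_test hU h.2.1 h'.2.1 fun φ hφ => by
    have h1 := h.2.2 φ hφ
    rw [h'.2.2 φ hφ, neg_inj] at h1
    exact h1.symm

theorem locallyIntegrableOn_of_memLp {U : Set Plane} {f : Plane → ℝ} {p : ℝ≥0∞} (hp : 1 ≤ p)
    (hU : IsOpen U) (hf : MemLp f p (volume.restrict U)) : LocallyIntegrableOn f U := by
  rw [locallyIntegrableOn_iff hU.isLocallyClosed]
  intro K hK hKc
  have h1 : MemLp f p (volume.restrict K) := hf.mono_measure (Measure.restrict_mono hK le_rfl)
  have : IsFiniteMeasure (volume.restrict K) :=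
    ⟨by rw [Measure.restrict_apply_univ]; exact hKc.measure_lt_top⟩
  exact h1.integrable hp

/-- `f` belongs to `W^{1,2}(D2)` with weak gradient `g`. -/
structure Sob (f : Plane → ℝ) (g : Fin 2 → Plane → ℝ) : Prop where
  memLp : MemLp f 2 (volume.restrict D2)
  weak : ∀ k, IsWeakPartial D2 k f (g k)
  memLp_grad : ∀ k, MemLp (g k) 2 (volume.restrict D2)

theorem MemW1p.sob {f : Plane → ℝ} (h : MemW1p 2 D2 f) : Sob f (grad f) := by
  refine ⟨h.1, fun k => ?_, fun k => ?_⟩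
  · obtain ⟨g, hg, -⟩ := h.2 k
    exact isWeakPartial_weakPartial hg
  · obtain ⟨g, hg, hg2⟩ := h.2 k
    exact hg2.ae_eq (hg.ae_eq isOpen_D2 (isWeakPartial_weakPartial hg))

theorem Sob.ae_eq_grad {f : Plane → ℝ} {g g' : Fin 2 → Plane → ℝ} (h : Sob f g) (h' : Sob f g')
    (k : Fin 2) : g k =ᵐ[volume.restrict D2] g' k :=
  (h.weak k).ae_eq isOpen_D2 (h'.weak k)

theorem Sob.mk' {f : Plane → ℝ} {g : Fin 2 → Plane → ℝ} (hf : MemLp f 2 (volume.restrict D2))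
    (hg : ∀ k, MemLp (g k) 2 (volume.restrict D2))
    (h : ∀ k φ, IsTestFunction D2 φ →
      ∫ x in D2, f x * partialDeriv k φ x = -∫ x in D2, g k x * φ x) : Sob f g :=
  ⟨hf, fun k => ⟨locallyIntegrableOn_of_memLp (by norm_num) isOpen_D2 hf,
    locallyIntegrableOn_of_memLp (by norm_num) isOpen_D2 (hg k), h k⟩, hg⟩

theorem Sob.congr {f f' : Plane → ℝ} {g g' : Fin 2 → Plane → ℝ} (h : Sob f g)
    (hf : f =ᵐ[volume.restrict D2] f') (hg : ∀ k, g k =ᵐ[volume.restrict D2] g' k) : Sob f' g' := by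
  refine Sob.mk' (h.memLp.ae_eq hf) (fun k => (h.memLp_grad k).ae_eq (hg k)) fun k φ hφ => ?_
  have e1 : ∫ x in D2, f x * partialDeriv k φ x = ∫ x in D2, f' x * partialDeriv k φ x :=
    integral_congr_ae (hf.mul EventuallyEq.rfl)
  have e2 : ∫ x in D2, g k x * φ x = ∫ x in D2, g' k x * φ x :=
    integral_congr_ae ((hg k).mul EventuallyEq.rfl)
  rw [← e1, ← e2]
  exact (h.weak k).2.2 φ hφ

theorem partialDeriv_mol (n : ℕ) {f : Plane → ℝ} (hf : LocallyIntegrable f) (k : Fin 2)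
    (x : Plane) : partialDeriv k (mol n f) x = ∫ t, f t * partialDeriv k (molKer n) (x - t) := by
  have e : mol n f = convolution f (molKer n) (ContinuousLinearMap.mul ℝ ℝ) volume := by
    funext x
    rw [mol_apply, convolution_mul_swap]
    simp_rw [mul_comm]
  have hκ := contDiff_molKer n
  have sκ := hasCompactSupport_molKer n
  have h := sκ.hasFDerivAt_convolution_right (ContinuousLinearMap.mul ℝ ℝ) hf (hκ.of_le (by simp)) x
  rw [partialDeriv, e, h.fderiv, convolution_precompR_apply _ hf (sκ.fderiv ℝ)
    (hκ.continuous_fderiv (by simp))]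
  rfl

/-- As long as the kernel centred at `x` fits into the disk it is an admissible test function;
beyond that the jump of the extension by zero is felt. For this reason the approximation holds only
on smaller disks. -/
theorem partialDeriv_mol_indicator {f g : Plane → ℝ} {k : Fin 2} (h : IsWeakPartial D2 k f g)
    (hf : LocallyIntegrable (D2.indicator f)) {n : ℕ} {x : Plane}
    (hx : ‖x‖ + 1 / ((n : ℝ) + 1) < 1) :
    partialDeriv k (mol n (D2.indicator f)) x = mol n (D2.indicator g) x := by
  have hκ := contDiff_molKer n
  have sκ := hasCompactSupport_molKer n
  have htest : IsTestFunction D2 fun t => molKer n (x - t) := by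
    refine ⟨contDiff_comp_const_sub hκ x, hasCompactSupport_comp_const_sub sκ x, ?_⟩
    have hsub : tsupport (fun t => molKer n (x - t)) ⊆ closedBall x (1 / ((n : ℝ) + 1)) := by
      refine closure_minimal (fun t ht => ?_) isClosed_closedBall
      by_contra hn
      refine ht (molKer_eq_zero ?_)
      rw [mem_closedBall, not_le, dist_comm, dist_eq_norm] at hn
      exact hn.le
    refine hsub.trans fun t ht => ?_
    rw [mem_closedBall, dist_eq_norm] at ht
    rw [D2, mem_ball_zero_iff]
    calc ‖t‖ = ‖x + (t - x)‖ := by congr 1; abel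
      _ ≤ ‖x‖ + ‖t - x‖ := norm_add_le _ _
      _ < 1 := by linarith
  have h1 := h.2.2 _ htest
  rw [partialDeriv_mol n hf]
  simp_rw [partialDeriv_comp_const_sub hκ, mul_neg, integral_neg, neg_inj] at h1
  have e1 : ∫ t, D2.indicator f t * partialDeriv k (molKer n) (x - t) =
      ∫ t in D2, f t * partialDeriv k (molKer n) (x - t) := by
    rw [← integral_indicator measurableSet_D2]
    refine integral_congr_ae (ae_of_all _ fun t => ?_)
    by_cases ht : t ∈ D2 <;> simp [ht]
  have e2 : mol n (D2.indicator g) x = ∫ t in D2, g t * molKer n (x - t) := by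
    rw [mol_apply, ← integral_indicator measurableSet_D2,
      ← integral_sub_left_eq_self _ volume x]
    refine integral_congr_ae (ae_of_all _ fun t => ?_)
    by_cases ht : t ∈ D2 <;> simp [ht, mul_comm]
  rw [e1, e2, h1]

/-- Convergence in `L²(B_R)` for every `R < 1`. -/
def TendstoL2Loc (H : ℕ → Plane → ℝ) (h : Plane → ℝ) : Prop :=
  ∀ R < 1, (∀ n, MemLp (fun x => H n x - h x) 2 (volume.restrict (ball 0 R))) ∧
    Tendsto (fun n => ∫ x in ball 0 R, (H n x - h x) ^ 2) atTop (𝓝 0)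

theorem memLp_ball_of_D2 {f : Plane → ℝ} {p : ℝ≥0∞} (hf : MemLp f p (volume.restrict D2)) {R : ℝ}
    (hR : R < 1) : MemLp f p (volume.restrict (ball 0 R)) :=
  hf.mono_measure (Measure.restrict_mono (ball_subset_D2 hR) le_rfl)

theorem memLp_ball_of_continuous {f : Plane → ℝ} (hf : Continuous f) (c : Plane) (R : ℝ)
    (p : ℝ≥0∞) : MemLp f p (volume.restrict (ball c R)) := by
  have := isFiniteMeasure_restrict_ball c R
  obtain ⟨M, hM⟩ := (isCompact_closedBall c R).exists_bound_of_continuousOn hf.continuousOn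
  refine MemLp.of_bound hf.aestronglyMeasurable M ?_
  refine (ae_restrict_iff' measurableSet_ball).2 (ae_of_all _ fun x hx => ?_)
  exact hM x (ball_subset_closedBall hx)

theorem tendstoL2Loc_mol {f : Plane → ℝ} (hf : MemLp f 2 (volume.restrict D2))
    {H : ℕ → Plane → ℝ} (hH : ∀ n, Continuous (H n))
    (hHf : ∀ (n : ℕ) x, ‖x‖ + 1 / ((n : ℝ) + 1) < 1 → H n x = mol n (D2.indicator f) x) :
    TendstoL2Loc H f := by
  have hf' : MemLp (D2.indicator f) 2 := (memLp_indicator_iff_restrict measurableSet_D2).2 hf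
  intro R hR
  refine ⟨fun n => (memLp_ball_of_continuous (hH n) 0 R 2).sub (memLp_ball_of_D2 hf hR), ?_⟩
  have hlim := tendsto_integral_sq_mol_sub hf'
  have hev : ∀ᶠ n : ℕ in atTop, 1 / ((n : ℝ) + 1) < 1 - R :=
    tendsto_one_div_succ.eventually (gt_mem_nhds (by linarith))
  refine squeeze_zero' (Eventually.of_forall fun n => integral_nonneg fun _ => sq_nonneg _) ?_ hlim
  filter_upwards [hev] with n hn
  have hi : Integrable fun x => (mol n (D2.indicator f) x - D2.indicator f x) ^ 2 :=
    ((memLp_mol n hf').sub hf').integrable_sq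
  refine le_trans (le_of_eq ?_) (setIntegral_le_integral (s := ball 0 R) hi
    (ae_of_all _ fun x => sq_nonneg _))
  refine setIntegral_congr_fun measurableSet_ball fun x hx => ?_
  have hx1 : x ∈ D2 := ball_subset_D2 hR hx
  rw [mem_ball_zero_iff] at hx
  simp [hHf n x (by linarith), hx1]

/-- Smooth approximation in `W^{1,2}_loc(D2)`. -/
theorem Sob.exists_approx {f : Plane → ℝ} {g : Fin 2 → Plane → ℝ} (h : Sob f g) :
    ∃ F : ℕ → Plane → ℝ, (∀ n, ContDiff ℝ ∞ (F n)) ∧ TendstoL2Loc F f ∧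
      (∀ k, TendstoL2Loc (fun n => partialDeriv k (F n)) (g k)) ∧
      (∀ᵐ x ∂volume.restrict D2, Tendsto (fun n => F n x) atTop (𝓝 (f x))) ∧
      ∀ M, (∀ᵐ x ∂volume.restrict D2, |f x| ≤ M) → 0 ≤ M → ∀ n x, |F n x| ≤ M := by
  have hf' : MemLp (D2.indicator f) 2 := (memLp_indicator_iff_restrict measurableSet_D2).2 h.memLp
  have hloc := locallyIntegrable_of_memLp hf'
  refine ⟨fun n => mol n (D2.indicator f), fun n => contDiff_mol n hloc, ?_, fun k => ?_, ?_, ?_⟩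
  · exact tendstoL2Loc_mol h.memLp (fun n => (contDiff_mol n hloc).continuous) fun n x _ => rfl
  · exact tendstoL2Loc_mol (h.memLp_grad k)
      (fun n => (contDiff_partialDeriv (contDiff_mol n hloc) k).continuous)
      fun n x hx => partialDeriv_mol_indicator (h.weak k) hloc hx
  · rw [ae_restrict_iff' measurableSet_D2]
    filter_upwards [ae_tendsto_mol hloc] with x hx hxD
    simpa [hxD] using hx
  · intro M hM hM0 n x
    refine abs_mol_le n ?_ x
    rw [ae_restrict_iff' measurableSet_D2] at hM
    filter_upwards [hM] with y hy
    by_cases hyD : y ∈ D2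
    · simpa [hyD] using hy hyD
    · simpa [hyD] using hM0

theorem IsTestFunction.exists_radius {φ : Plane → ℝ} (hφ : IsTestFunction D2 φ) :
    ∃ R < 1, tsupport φ ⊆ ball 0 R := by
  obtain ⟨R, hR, h⟩ := exists_lt_subset_ball (isClosed_tsupport φ) hφ.2.2
  exact ⟨R, hR, h⟩

theorem tendsto_integral_mul_of_L2Loc {H : ℕ → Plane → ℝ} {h G η : Plane → ℝ}
    (hH : TendstoL2Loc H h) (hh : MemLp h 2 (volume.restrict D2))
    (hG : MemLp G 2 (volume.restrict D2)) (hη : IsTestFunction D2 η) :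
    Tendsto (fun n => ∫ x in D2, G x * (H n x * η x)) atTop
      (𝓝 (∫ x in D2, G x * (h x * η x))) := by
  obtain ⟨R, hR, hsupp⟩ := hη.exists_radius
  obtain ⟨M, hM0, hM⟩ := exists_abs_le_of_hasCompactSupport hη.1.continuous hη.2.1
  have hred : ∀ F : Plane → ℝ, ∫ x in D2, G x * (F x * η x) =
      ∫ x in ball 0 R, (G x * η x) * F x := by
    intro F
    rw [setIntegral_eq_integral_of_forall_compl_eq_zero fun x hx => by simp [hη.eq_zero hx],
      setIntegral_eq_integral_of_forall_compl_eq_zero fun x hx => by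
        simp [image_eq_zero_of_notMem_tsupport fun h' => hx (hsupp h')]]
    exact integral_congr_ae (ae_of_all _ fun x => by ring)
  simp_rw [hred]
  have hGη : MemLp (fun x => G x * η x) 2 (volume.restrict (ball 0 R)) :=
    (memLp_of_smooth hη.1.continuous hη.2.1 ⊤).restrict _ |>.mul (memLp_ball_of_D2 hG hR)
  have hhR := memLp_ball_of_D2 hh hR
  obtain ⟨hmem, hlim⟩ := hH R hR
  rw [tendsto_iff_norm_sub_tendsto_zero]
  have h0 : Tendsto (fun n => √(∫ x in ball 0 R, (G x * η x) ^ 2) *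
      √(∫ x in ball 0 R, (H n x - h x) ^ 2)) atTop (𝓝 0) := by
    simpa using (hlim.sqrt).const_mul √(∫ x in ball 0 R, (G x * η x) ^ 2)
  refine squeeze_zero (fun n => norm_nonneg _) (fun n => ?_) h0
  have hHn : MemLp (H n) 2 (volume.restrict (ball 0 R)) := by
    have e : H n = (fun x => H n x - h x) + h := by funext x; simp
    rw [e]
    exact (hmem n).add hhR
  have i1 : Integrable (fun x => G x * η x * H n x) (volume.restrict (ball 0 R)) :=
    hGη.integrable_mul hHn
  have i2 : Integrable (fun x => G x * η x * h x) (volume.restrict (ball 0 R)) :=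
    hGη.integrable_mul hhR
  rw [← integral_sub i1 i2, Real.norm_eq_abs]
  refine le_trans (le_of_eq ?_) (abs_integral_mul_le_sqrt hGη (hmem n))
  congr 1
  exact integral_congr_ae (ae_of_all _ fun x => by ring)

end Sobolev

/-! ### Products of Sobolev functions and testing with Sobolev functions. -/

section Algebra

theorem exists_ae_abs_le {f : Plane → ℝ} {μ : Measure Plane} (hf : MemLp f ⊤ μ) :
    ∃ M, 0 ≤ M ∧ ∀ᵐ x ∂μ, |f x| ≤ M := by
  refine ⟨(eLpNormEssSup f μ).toReal, ENNReal.toReal_nonneg, ?_⟩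
  have hne : eLpNormEssSup f μ ≠ ⊤ := by
    have := hf.2
    rw [eLpNorm_exponent_top] at this
    exact this.ne
  filter_upwards [ae_le_eLpNormEssSup (f := f) (μ := μ)] with x hx
  rw [← Real.norm_eq_abs, ← toReal_enorm]
  exact ENNReal.toReal_mono hne hx

theorem integrable_mul_top {f g : Plane → ℝ} {μ : Measure Plane} (hf : Integrable f μ)
    (hg : MemLp g ⊤ μ) : Integrable (fun x => f x * g x) μ := by
  obtain ⟨M, -, hM⟩ := exists_ae_abs_le hg
  have := hf.bdd_mul hg.1 hM
  simpa [mul_comm] using this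

theorem memLp_mul_top {f g : Plane → ℝ} {p : ℝ≥0∞} {μ : Measure Plane} (hf : MemLp f ⊤ μ)
    (hg : MemLp g p μ) : MemLp (fun x => f x * g x) p μ :=
  hg.mul hf

theorem memLp_top_test {η : Plane → ℝ} {U V : Set Plane} (hη : IsTestFunction U η) :
    MemLp η ⊤ (volume.restrict V) :=
  (memLp_of_smooth hη.1.continuous hη.2.1 ⊤).restrict _

variable {F : Fin 2 → Plane → ℝ} {f h η : Plane → ℝ} {g : Fin 2 → Plane → ℝ}

/-- Test with `f_n η`, `f_n` smooth, and let `n → ∞`; the terms with `F` converge by `L²` pairing.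
The limit of the term with `h` stays a hypothesis because it has two sources: `h` in `L²`, or `h`
integrable and `f` bounded. -/
theorem Sob.extend_test_aux {Fn : ℕ → Plane → ℝ} (hF : ∀ k, MemLp (F k) 2 (volume.restrict D2))
    (hFh : ∀ φ, IsTestFunction D2 φ →
      ∫ x in D2, ∑ k, F k x * partialDeriv k φ x = ∫ x in D2, h x * φ x)
    (hf : Sob f g) (hη : IsTestFunction D2 η) (hs : ∀ n, ContDiff ℝ ∞ (Fn n))
    (hl : TendstoL2Loc Fn f) (hd : ∀ k, TendstoL2Loc (fun n => partialDeriv k (Fn n)) (g k))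
    (hlim : Tendsto (fun n => ∫ x in D2, h x * (Fn n x * η x)) atTop
      (𝓝 (∫ x in D2, h x * (f x * η x)))) :
    ∫ x in D2, ∑ k, F k x * (f x * partialDeriv k η x + g k x * η x) =
      ∫ x in D2, h x * (f x * η x) := by
  have key : ∀ (a : Plane → ℝ) (b : Fin 2 → Plane → ℝ),
      (∀ k, Integrable (fun x => F k x * (a x * partialDeriv k η x)) (volume.restrict D2)) →
      (∀ k, Integrable (fun x => F k x * (b k x * η x)) (volume.restrict D2)) →
      ∫ x in D2, ∑ k, F k x * (a x * partialDeriv k η x + b k x * η x) =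
        ∑ k, ((∫ x in D2, F k x * (a x * partialDeriv k η x)) +
          ∫ x in D2, F k x * (b k x * η x)) := by
    intro a b ha hb
    have hab : ∀ k, Integrable (fun x => F k x * (a x * partialDeriv k η x) +
        F k x * (b k x * η x)) (volume.restrict D2) := fun k => (ha k).add (hb k)
    simp_rw [mul_add]
    rw [integral_finsetSum _ fun k _ => hab k]
    exact Finset.sum_congr rfl fun k _ => integral_add (ha k) (hb k)
  have hbd : ∀ {φ : Plane → ℝ}, IsTestFunction D2 φ → ∀ k,
      MemLp (fun x => F k x * φ x) 2 (volume.restrict D2) := fun hφ k => by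
    have := memLp_mul_top (memLp_top_test (V := D2) hφ) (hF k)
    simpa [mul_comm] using this
  have hsm : ∀ {φ ψ : Plane → ℝ}, IsTestFunction D2 φ → ContDiff ℝ ∞ ψ → ∀ k,
      Integrable (fun x => F k x * (ψ x * φ x)) (volume.restrict D2) := fun hφ hψ k =>
    (hF k).integrable_mul ((memLp_of_smooth (hφ.mul_left hψ).1.continuous
      (hφ.mul_left hψ).2.1 2).restrict D2)
  have hL2 : ∀ {φ ψ : Plane → ℝ}, IsTestFunction D2 φ → MemLp ψ 2 (volume.restrict D2) → ∀ k,
      Integrable (fun x => F k x * (ψ x * φ x)) (volume.restrict D2) := fun hφ hψ k => by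
    refine ((hbd hφ k).integrable_mul hψ).congr (ae_of_all _ fun x => ?_)
    simp only [Pi.mul_apply]; ring
  have eqn : ∀ n, ∑ k, ((∫ x in D2, F k x * (Fn n x * partialDeriv k η x)) +
      ∫ x in D2, F k x * (partialDeriv k (Fn n) x * η x)) =
        ∫ x in D2, h x * (Fn n x * η x) := by
    intro n
    rw [← hFh _ (hη.mul_left (hs n)), ← key (Fn n) (fun k => partialDeriv k (Fn n))
      (fun k => hsm (hη.partialDeriv k) (hs n) k)
      (fun k => hsm hη (contDiff_partialDeriv (hs n) k) k)]
    simp_rw [partialDeriv_mul (hs n) hη.1]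
  rw [key f g (fun k => hL2 (hη.partialDeriv k) hf.memLp k) fun k => hL2 hη (hf.memLp_grad k) k]
  refine tendsto_nhds_unique ?_ hlim
  simp_rw [← eqn]
  refine tendsto_finsetSum _ fun k _ => Tendsto.add ?_ ?_
  · exact tendsto_integral_mul_of_L2Loc hl hf.memLp (hF k) (hη.partialDeriv k)
  · exact tendsto_integral_mul_of_L2Loc (hd k) (hf.memLp_grad k) (hF k) hη

theorem Sob.extend_test (hF : ∀ k, MemLp (F k) 2 (volume.restrict D2))
    (hh : MemLp h 2 (volume.restrict D2))
    (hFh : ∀ φ, IsTestFunction D2 φ →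
      ∫ x in D2, ∑ k, F k x * partialDeriv k φ x = ∫ x in D2, h x * φ x)
    (hf : Sob f g) (hη : IsTestFunction D2 η) :
    ∫ x in D2, ∑ k, F k x * (f x * partialDeriv k η x + g k x * η x) =
      ∫ x in D2, h x * (f x * η x) := by
  obtain ⟨Fn, hs, hl, hd, -, -⟩ := hf.exists_approx
  exact Sob.extend_test_aux hF hFh hf hη hs hl hd
    (tendsto_integral_mul_of_L2Loc hl hf.memLp hh hη)

/-- Mollification preserves sup bounds, so dominated convergence handles a source term that is
merely integrable, such as `Ω·∇u`. -/
theorem Sob.extend_test_of_bdd (hF : ∀ k, MemLp (F k) 2 (volume.restrict D2))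
    (hh : Integrable h (volume.restrict D2))
    (hFh : ∀ φ, IsTestFunction D2 φ →
      ∫ x in D2, ∑ k, F k x * partialDeriv k φ x = ∫ x in D2, h x * φ x)
    (hf : Sob f g) (hfb : MemLp f ⊤ (volume.restrict D2)) (hη : IsTestFunction D2 η) :
    ∫ x in D2, ∑ k, F k x * (f x * partialDeriv k η x + g k x * η x) =
      ∫ x in D2, h x * (f x * η x) := by
  obtain ⟨Fn, hs, hl, hd, hae, hbd⟩ := hf.exists_approx
  obtain ⟨M, hM0, hM⟩ := exists_ae_abs_le hfb
  refine Sob.extend_test_aux hF hFh hf hη hs hl hd ?_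
  refine tendsto_integral_of_dominated_convergence (fun x => |h x * η x| * M) (fun n => ?_)
    ((integrable_mul_top hh (memLp_top_test hη)).abs.mul_const M) (fun n => ?_) ?_
  · exact hh.1.mul ((hs n).continuous.mul hη.1.continuous).aestronglyMeasurable
  · refine ae_of_all _ fun x => ?_
    have := hbd M hM hM0 n x
    rw [Real.norm_eq_abs, show h x * (Fn n x * η x) = (h x * η x) * Fn n x by ring, abs_mul]
    gcongr
  · filter_upwards [hae] with x hx
    exact (hx.mul_const _).const_mul _

theorem integral_partialDeriv_test {φ : Plane → ℝ} (hφ : IsTestFunction D2 φ) (k : Fin 2) :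
    ∫ x in D2, partialDeriv k φ x = 0 := by
  have h := integral_mul_partialDeriv (contDiff_const (c := (1 : ℝ))) hφ.1 hφ.2.1 k
  have h1 := setIntegral_mul_test (g := fun _ => (1 : ℝ)) (hφ.partialDeriv k)
  simp only [one_mul] at h h1
  rw [h1, h]
  simp [partialDeriv]

theorem Sob.const (c : ℝ) : Sob (fun _ => c) (fun _ _ => 0) := by
  refine Sob.mk' (memLp_const c) (fun k => memLp_const 0) fun k φ hφ => ?_
  rw [integral_const_mul, integral_partialDeriv_test hφ]
  simp

theorem Sob.add {f₁ f₂ : Plane → ℝ} {g₁ g₂ : Fin 2 → Plane → ℝ} (h₁ : Sob f₁ g₁)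
    (h₂ : Sob f₂ g₂) : Sob (fun x => f₁ x + f₂ x) (fun k x => g₁ k x + g₂ k x) := by
  refine Sob.mk' (h₁.memLp.add h₂.memLp) (fun k => (h₁.memLp_grad k).add (h₂.memLp_grad k))
    fun k φ hφ => ?_
  have a1 := ((hφ.partialDeriv k).integrable_mul (h₁.weak k).1).integrableOn (s := D2)
  have a2 := ((hφ.partialDeriv k).integrable_mul (h₂.weak k).1).integrableOn (s := D2)
  have b1 := (hφ.integrable_mul (h₁.weak k).2.1).integrableOn (s := D2)
  have b2 := (hφ.integrable_mul (h₂.weak k).2.1).integrableOn (s := D2)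
  simp_rw [add_mul]
  rw [integral_add a1 a2, integral_add b1 b2, (h₁.weak k).2.2 φ hφ, (h₂.weak k).2.2 φ hφ, neg_add]

theorem Sob.sum {ι : Type*} (s : Finset ι) {f : ι → Plane → ℝ} {g : ι → Fin 2 → Plane → ℝ}
    (h : ∀ i, Sob (f i) (g i)) : Sob (fun x => ∑ i ∈ s, f i x) (fun k x => ∑ i ∈ s, g i k x) := by
  classical
  induction s using Finset.induction_on with
  | empty => simpa using Sob.const 0
  | insert i s hi ih => simpa [Finset.sum_insert hi] using (h i).add ih

theorem Sob.mul {f₁ f₂ : Plane → ℝ} {g₁ g₂ : Fin 2 → Plane → ℝ} (h₁ : Sob f₁ g₁)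
    (h₂ : Sob f₂ g₂) (b₁ : MemLp f₁ ⊤ (volume.restrict D2)) (b₂ : MemLp f₂ ⊤ (volume.restrict D2)) :
    Sob (fun x => f₁ x * f₂ x) (fun k x => f₁ x * g₂ k x + f₂ x * g₁ k x) := by
  have m1 : ∀ k, MemLp (fun x => f₁ x * g₂ k x) 2 (volume.restrict D2) := fun k =>
    memLp_mul_top b₁ (h₂.memLp_grad k)
  have m2 : ∀ k, MemLp (fun x => f₂ x * g₁ k x) 2 (volume.restrict D2) := fun k =>
    memLp_mul_top b₂ (h₁.memLp_grad k)
  refine Sob.mk' (memLp_mul_top b₁ h₂.memLp) (fun k => (m1 k).add (m2 k)) fun k φ hφ => ?_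
  have hF : ∀ j, MemLp (fun x => if j = k then f₂ x else 0) 2 (volume.restrict D2) := fun j => by
    by_cases hj : j = k
    · simpa [hj] using h₂.memLp
    · simp [hj]
  -- The field with `k`-th component `f₂` and all others zero has divergence `g₂ k`; testing it with
  -- `f₁φ` is the product rule.
  have h := Sob.extend_test (F := fun j x => if j = k then f₂ x else 0) (h := fun x => - g₂ k x)
    hF (h₂.memLp_grad k).neg (fun φ hφ => by
      simpa [integral_neg] using (h₂.weak k).2.2 φ hφ) h₁ hφ
  have l1 : LocallyIntegrableOn (fun x => f₁ x * f₂ x) D2 :=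
    locallyIntegrableOn_of_memLp (p := 2) (by norm_num) isOpen_D2 (memLp_mul_top b₁ h₂.memLp)
  have l2 := locallyIntegrableOn_of_memLp (by norm_num) isOpen_D2 (m1 k)
  have l3 := locallyIntegrableOn_of_memLp (by norm_num) isOpen_D2 (m2 k)
  have i1 := ((hφ.partialDeriv k).integrable_mul l1).integrableOn (s := D2)
  have i2 := (hφ.integrable_mul l2).integrableOn (s := D2)
  have i3 := (hφ.integrable_mul l3).integrableOn (s := D2)
  simp only [ite_mul, zero_mul, Finset.sum_ite_eq', Finset.mem_univ, if_true] at h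
  have e1 : ∫ x in D2, f₂ x * (f₁ x * partialDeriv k φ x + g₁ k x * φ x) =
      (∫ x in D2, f₁ x * f₂ x * partialDeriv k φ x) + ∫ x in D2, f₂ x * g₁ k x * φ x := by
    rw [← integral_add i1 i3]
    exact integral_congr_ae (ae_of_all _ fun x => by ring)
  have e2 : ∫ x in D2, -g₂ k x * (f₁ x * φ x) = - ∫ x in D2, f₁ x * g₂ k x * φ x := by
    rw [← integral_neg]
    exact integral_congr_ae (ae_of_all _ fun x => by ring)
  rw [e1, e2] at h
  simp_rw [add_mul]
  rw [integral_add i2 i3]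
  linarith

/-- Bounded functions of class `W^{1,2}`. -/
def BddSob (f : Plane → ℝ) : Prop := (∃ g, Sob f g) ∧ MemLp f ⊤ (volume.restrict D2)

theorem BddSob.const (c : ℝ) : BddSob fun _ => c := ⟨⟨_, Sob.const c⟩, memLp_const c⟩

theorem BddSob.add {f₁ f₂ : Plane → ℝ} (h₁ : BddSob f₁) (h₂ : BddSob f₂) :
    BddSob fun x => f₁ x + f₂ x :=
  ⟨⟨_, h₁.1.choose_spec.add h₂.1.choose_spec⟩, h₁.2.add h₂.2⟩

theorem BddSob.mul {f₁ f₂ : Plane → ℝ} (h₁ : BddSob f₁) (h₂ : BddSob f₂) :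
    BddSob fun x => f₁ x * f₂ x :=
  ⟨⟨_, h₁.1.choose_spec.mul h₂.1.choose_spec h₁.2 h₂.2⟩, memLp_mul_top h₁.2 h₂.2⟩

theorem BddSob.sum {ι : Type*} (s : Finset ι) {f : ι → Plane → ℝ} (h : ∀ i, BddSob (f i)) :
    BddSob fun x => ∑ i ∈ s, f i x := by
  classical
  induction s using Finset.induction_on with
  | empty => simpa using BddSob.const 0
  | insert i s hi ih => simpa [Finset.sum_insert hi] using (h i).add ih

theorem BddSob.prod {ι : Type*} (s : Finset ι) {f : ι → Plane → ℝ} (h : ∀ i, BddSob (f i)) :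
    BddSob fun x => ∏ i ∈ s, f i x := by
  classical
  induction s using Finset.induction_on with
  | empty => simpa using BddSob.const 1
  | insert i s hi ih => simpa [Finset.prod_insert hi] using (h i).mul ih

theorem BddSob.congr {f f' : Plane → ℝ} (h : BddSob f) (hff : f =ᵐ[volume.restrict D2] f') :
    BddSob f' :=
  ⟨⟨_, h.1.choose_spec.congr hff fun _ => EventuallyEq.rfl⟩, h.2.ae_eq hff⟩

theorem BddSob.det {m : ℕ} {A : Plane → Matrix (Fin m) (Fin m) ℝ}
    (h : ∀ i j, BddSob fun x => A x i j) : BddSob fun x => (A x).det := by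
  simp_rw [Matrix.det_apply']
  exact BddSob.sum _ fun σ => (BddSob.const _).mul (BddSob.prod _ fun i => h _ _)

theorem BddSob.adjugate {m : ℕ} {A : Plane → Matrix (Fin m) (Fin m) ℝ}
    (h : ∀ i j, BddSob fun x => A x i j) (i j : Fin m) : BddSob fun x => (A x).adjugate i j := by
  simp_rw [Matrix.adjugate_apply]
  refine BddSob.det fun a b => ?_
  by_cases ha : a = j
  · subst ha
    simpa using BddSob.const _
  · simpa [Matrix.updateRow_ne ha] using h a b

theorem memLp_top_det {m : ℕ} {A : Plane → Matrix (Fin m) (Fin m) ℝ} {μ : Measure Plane}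
    [IsFiniteMeasure μ] (h : ∀ i j, MemLp (fun x => A x i j) ⊤ μ) :
    MemLp (fun x => (A x).det) ⊤ μ := by
  have hprod : ∀ (s : Finset (Fin m)) (f : Fin m → Plane → ℝ), (∀ i, MemLp (f i) ⊤ μ) →
      MemLp (fun x => ∏ i ∈ s, f i x) ⊤ μ := by
    intro s f hf
    induction s using Finset.induction_on with
    | empty => simpa using memLp_const (1 : ℝ)
    | insert i s hi ih => simpa [Finset.prod_insert hi] using memLp_mul_top (hf i) ih
  simp_rw [Matrix.det_apply']
  exact memLp_finsetSum _ fun σ _ => memLp_mul_top (memLp_const _) (hprod _ _ fun i => h _ _)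

end Algebra

/-! ### The inverse of a bounded Sobolev matrix is a bounded Sobolev matrix. -/

section Inverse

/-- Weak derivatives survive dominated convergence almost everywhere of the functions and of their
gradients; it is applied to the partial sums of a power series. -/
theorem Sob.of_tendsto {f : Plane → ℝ} {g G : Fin 2 → Plane → ℝ} {fn : ℕ → Plane → ℝ}
    {gn : ℕ → Fin 2 → Plane → ℝ} {M : ℝ} (h : ∀ n, Sob (fn n) (gn n))
    (hb : ∀ᵐ x ∂volume.restrict D2, ∀ n, |fn n x| ≤ M)
    (hG : ∀ k, MemLp (G k) 2 (volume.restrict D2))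
    (hgb : ∀ k, ∀ᵐ x ∂volume.restrict D2, ∀ n, |gn n k x| ≤ G k x)
    (hf : ∀ᵐ x ∂volume.restrict D2, Tendsto (fun n => fn n x) atTop (𝓝 (f x)))
    (hg : ∀ k, ∀ᵐ x ∂volume.restrict D2, Tendsto (fun n => gn n k x) atTop (𝓝 (g k x))) :
    Sob f g := by
  have mf : AEStronglyMeasurable f (volume.restrict D2) :=
    aestronglyMeasurable_of_tendsto_ae atTop (fun n => (h n).memLp.1) hf
  have mg : ∀ k, AEStronglyMeasurable (g k) (volume.restrict D2) := fun k =>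
    aestronglyMeasurable_of_tendsto_ae atTop (fun n => ((h n).memLp_grad k).1) (hg k)
  have bf : ∀ᵐ x ∂volume.restrict D2, ‖f x‖ ≤ M := by
    filter_upwards [hb, hf] with x h1 h2
    exact le_of_tendsto h2.norm (Eventually.of_forall h1)
  have bg : ∀ k, ∀ᵐ x ∂volume.restrict D2, ‖g k x‖ ≤ ‖G k x‖ := fun k => by
    filter_upwards [hgb k, hg k] with x h1 h2
    exact le_of_tendsto h2.norm (Eventually.of_forall fun n => (h1 n).trans (le_abs_self _))
  refine Sob.mk' (MemLp.of_bound mf M bf) (fun k => (hG k).mono (mg k) (bg k)) fun k φ hφ => ?_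
  have t1 : Tendsto (fun n => ∫ x in D2, fn n x * partialDeriv k φ x) atTop
      (𝓝 (∫ x in D2, f x * partialDeriv k φ x)) := by
    have hi : Integrable (partialDeriv k φ) (volume.restrict D2) :=
      memLp_one_iff_integrable.1 ((memLp_of_smooth (hφ.partialDeriv k).1.continuous
        (hφ.partialDeriv k).2.1 1).restrict _)
    refine tendsto_integral_of_dominated_convergence (fun x => M * |partialDeriv k φ x|)
      (fun n => (h n).memLp.1.mul hi.1) (hi.abs.const_mul M) (fun n => ?_) ?_
    · filter_upwards [hb] with x hx
      rw [Real.norm_eq_abs, abs_mul]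
      exact mul_le_mul_of_nonneg_right (hx n) (abs_nonneg _)
    · filter_upwards [hf] with x hx
      exact hx.mul_const _
  have t2 : Tendsto (fun n => ∫ x in D2, gn n k x * φ x) atTop (𝓝 (∫ x in D2, g k x * φ x)) := by
    have hi := integrable_mul_top ((hG k).integrable (by norm_num)) (memLp_top_test (V := D2) hφ)
    refine tendsto_integral_of_dominated_convergence (fun x => |G k x * φ x|)
      (fun n => ((h n).memLp_grad k).1.mul hφ.1.continuous.aestronglyMeasurable) hi.abs
      (fun n => ?_) ?_
    · filter_upwards [hgb k] with x hx
      rw [Real.norm_eq_abs, abs_mul, abs_mul]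
      exact mul_le_mul_of_nonneg_right ((hx n).trans (le_abs_self _)) (abs_nonneg _)
    · filter_upwards [hg k] with x hx
      exact hx.mul_const _
  refine tendsto_nhds_unique t1 ?_
  have e : ∀ n, ∫ x in D2, fn n x * partialDeriv k φ x = - ∫ x in D2, gn n k x * φ x := fun n =>
    ((h n).weak k).2.2 φ hφ
  simp_rw [e]
  exact t2.neg

/-- The truncated exponent at `n = 0` is harmless because the coefficient `n` vanishes there. -/
theorem Sob.pow {f : Plane → ℝ} {g : Fin 2 → Plane → ℝ} (h : Sob f g)
    (b : MemLp f ⊤ (volume.restrict D2)) (n : ℕ) :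
    Sob (fun x => f x ^ n) (fun k x => n * f x ^ (n - 1) * g k x) ∧
      MemLp (fun x => f x ^ n) ⊤ (volume.restrict D2) := by
  induction n with
  | zero => simpa using ⟨Sob.const 1, memLp_const (1 : ℝ)⟩
  | succ n ih =>
    refine ⟨?_, by simpa [pow_succ] using memLp_mul_top ih.2 b⟩
    refine (ih.1.mul h ih.2 b).congr (ae_of_all _ fun x => by simp [pow_succ])
      fun k => ae_of_all _ fun x => ?_
    rcases n with _ | n
    · simp
    · simp; ring

/-- The Neumann series of a function whose absolute value stays away from `1`. -/
theorem BddSob.tsum_pow {f : Plane → ℝ} (h : BddSob f) {θ : ℝ} (hθ0 : 0 ≤ θ) (hθ : θ < 1)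
    (hf : ∀ᵐ x ∂volume.restrict D2, |f x| ≤ θ) : BddSob fun x => ∑' n : ℕ, f x ^ n := by
  obtain ⟨⟨g, hg⟩, hb⟩ := h
  have s0 : Summable fun n : ℕ => θ ^ n := summable_geometric_of_lt_one hθ0 hθ
  have s1 : Summable fun n : ℕ => (n : ℝ) * θ ^ (n - 1) := by
    rw [← summable_nat_add_iff 1]
    have := (summable_pow_mul_geometric_of_norm_lt_one 1 (r := θ)
      (by rwa [Real.norm_eq_abs, abs_of_nonneg hθ0])).add s0
    refine this.congr fun n => ?_
    push_cast
    simp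
    ring
  have b0 : ∀ x : ℝ, |x| ≤ θ → ∀ n : ℕ, |x ^ n| ≤ θ ^ n := fun x hx n => by
    rw [abs_pow]
    exact pow_le_pow_left₀ (abs_nonneg _) hx n
  have b1 : ∀ x : ℝ, |x| ≤ θ → ∀ n : ℕ, |(n : ℝ) * x ^ (n - 1)| ≤ n * θ ^ (n - 1) :=
    fun x hx n => by
      rw [abs_mul, abs_of_nonneg (Nat.cast_nonneg n)]
      exact mul_le_mul_of_nonneg_left (b0 x hx _) (Nat.cast_nonneg n)
  set C₀ := ∑' n : ℕ, θ ^ n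
  set C₁ := ∑' n : ℕ, (n : ℝ) * θ ^ (n - 1)
  have p0 : ∀ x : ℝ, |x| ≤ θ → ∀ N : ℕ, |∑ n ∈ Finset.range N, x ^ n| ≤ C₀ := fun x hx N =>
    (Finset.abs_sum_le_sum_abs _ _).trans ((Finset.sum_le_sum fun n _ => b0 x hx n).trans
      (s0.sum_le_tsum _ fun n _ => pow_nonneg hθ0 n))
  have p1 : ∀ x : ℝ, |x| ≤ θ → ∀ N : ℕ, |∑ n ∈ Finset.range N, (n : ℝ) * x ^ (n - 1)| ≤ C₁ :=
    fun x hx N => (Finset.abs_sum_le_sum_abs _ _).trans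
      ((Finset.sum_le_sum fun n _ => b1 x hx n).trans
        (s1.sum_le_tsum _ fun n _ => mul_nonneg (Nat.cast_nonneg n) (pow_nonneg hθ0 _)))
  have hlim : ∀ᵐ x ∂volume.restrict D2,
      Tendsto (fun N => ∑ n ∈ Finset.range N, f x ^ n) atTop (𝓝 (∑' n : ℕ, f x ^ n)) := by
    filter_upwards [hf] with x hx
    exact (Summable.of_norm_bounded s0 (b0 _ hx)).hasSum.tendsto_sum_nat
  have hsob : Sob (fun x => ∑' n : ℕ, f x ^ n)
      (fun k x => (∑' n : ℕ, (n : ℝ) * f x ^ (n - 1)) * g k x) := by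
    refine Sob.of_tendsto (M := C₀) (G := fun k x => C₁ * |g k x|)
      (fun N => Sob.sum (Finset.range N) fun n => (hg.pow hb n).1) ?_
      (fun k => (hg.memLp_grad k).abs.const_mul C₁) (fun k => ?_) hlim fun k => ?_
    · filter_upwards [hf] with x hx N
      exact p0 _ hx N
    · filter_upwards [hf] with x hx N
      rw [← Finset.sum_mul, abs_mul]
      exact mul_le_mul_of_nonneg_right (p1 _ hx N) (abs_nonneg _)
    · filter_upwards [hf] with x hx
      simp_rw [← Finset.sum_mul]
      exact (Summable.of_norm_bounded s1 (b1 _ hx)).hasSum.tendsto_sum_nat.mul_const _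
  refine ⟨⟨_, hsob⟩, memLp_top_of_bound hsob.memLp.1 C₀ ?_⟩
  filter_upwards [hf, hlim] with x hx h2
  exact le_of_tendsto h2.norm (Eventually.of_forall (p0 _ hx))

/-- Since `f` may change sign, write `1/f = f/f²` and expand `1/f² = b⁻¹ ∑ (1 - f²/b)ⁿ` with `b`
above the sup of `f²`. The bound on `1/f` keeps the ratio of the series below one. -/
theorem BddSob.inv {f : Plane → ℝ} (h : BddSob f) (hne : ∀ᵐ x ∂volume.restrict D2, f x ≠ 0)
    (hi : MemLp (fun x => (f x)⁻¹) ⊤ (volume.restrict D2)) : BddSob fun x => (f x)⁻¹ := by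
  obtain ⟨M, hM0, hM⟩ := exists_ae_abs_le h.2
  obtain ⟨K, hK0, hK⟩ := exists_ae_abs_le hi
  set b := M ^ 2 + 1 with hb
  -- From `|1/f| ≤ K + 1` follows `f²/b ≥ δ`, so the ratio is at most `1 - δ`.
  set δ := ((K + 1) ^ 2 * b)⁻¹ with hδ
  have hb0 : 0 < b := by positivity
  have hbound : 1 ≤ (K + 1) ^ 2 * b := by
    have : 1 ≤ (K + 1) ^ 2 := by nlinarith
    have : 1 ≤ b := by rw [hb]; nlinarith [sq_nonneg M]
    nlinarith
  have hδ0 : 0 < δ := by positivity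
  have hδ1 : δ ≤ 1 := inv_le_one_of_one_le₀ hbound
  have hq : BddSob fun x => 1 + (-b⁻¹) * (f x * f x) :=
    (BddSob.const 1).add ((BddSob.const _).mul (h.mul h))
  have hqb : ∀ᵐ x ∂volume.restrict D2, |1 + (-b⁻¹) * (f x * f x)| ≤ 1 - δ := by
    filter_upwards [hM, hK, hne] with x h1 h2 h3
    have e1 : f x * f x ≤ b := by
      have := sq_le_sq' (by linarith [neg_abs_le (f x)]) ((le_abs_self (f x)).trans h1)
      rw [hb]; nlinarith
    have e2 : 1 ≤ (K + 1) ^ 2 * (f x * f x) := by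
      have h4 : 1 ≤ (K + 1) * |f x| := by
        have : |f x|⁻¹ ≤ K + 1 := by rw [← abs_inv]; linarith
        rwa [inv_le_iff_one_le_mul₀ (abs_pos.2 h3)] at this
      have := one_le_pow₀ h4 (n := 2)
      rw [mul_pow, sq_abs] at this
      nlinarith
    have e3 : b⁻¹ * (f x * f x) ≤ 1 := by
      rw [inv_mul_le_iff₀ hb0]; linarith
    have e4 : δ ≤ b⁻¹ * (f x * f x) := by
      rw [hδ, mul_inv, mul_comm]
      refine mul_le_mul_of_nonneg_left ?_ (by positivity)
      rw [inv_le_iff_one_le_mul₀ (by positivity)]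
      linarith
    rw [abs_le]
    constructor <;> linarith
  have hs := hq.tsum_pow (by linarith) (by linarith) hqb
  refine ((BddSob.const b⁻¹).mul (h.mul hs)).congr ?_
  filter_upwards [hqb, hne] with x hx h3
  rw [tsum_geometric_of_abs_lt_one (by linarith)]
  field_simp
  ring

/-- Cramer's rule; the reciprocal of the determinant is bounded because it is the determinant of the
bounded matrix `A⁻¹`. -/
theorem BddSob.matrix_inv {m : ℕ} {A : Plane → Matrix (Fin m) (Fin m) ℝ}
    (h : ∀ i j, BddSob fun x => A x i j) (hu : ∀ᵐ x ∂volume.restrict D2, IsUnit (A x))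
    (hi : MatMemLp ⊤ fun x => (A x)⁻¹) (i j : Fin m) : BddSob fun x => (A x)⁻¹ i j := by
  have hd : MemLp (fun x => ((A x).det)⁻¹) ⊤ (volume.restrict D2) := by
    refine (memLp_top_det hi).ae_eq (ae_of_all _ fun x => ?_)
    simp [Matrix.det_nonsing_inv]
  have hne : ∀ᵐ x ∂volume.restrict D2, (A x).det ≠ 0 := by
    filter_upwards [hu] with x hx
    exact ((Matrix.isUnit_iff_isUnit_det _).1 hx).ne_zero
  have := ((BddSob.det h).inv hne hd).mul (BddSob.adjugate h i j)
  refine this.congr (ae_of_all _ fun x => ?_)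
  simp [Matrix.inv_def]

/-- The weak derivative of `A⁻¹ A = 1`. -/
theorem sum_grad_inv_mul {m : ℕ} {A : Plane → Matrix (Fin m) (Fin m) ℝ}
    {a b : Fin m → Fin m → Fin 2 → Plane → ℝ} (ha : ∀ i j, Sob (fun x => A x i j) (a i j))
    (hab : MatMemLp ⊤ A) (hb : ∀ i j, Sob (fun x => (A x)⁻¹ i j) (b i j))
    (hi : MatMemLp ⊤ fun x => (A x)⁻¹) (hu : ∀ᵐ x ∂volume.restrict D2, IsUnit (A x))
    (l j : Fin m) (k : Fin 2) : ∀ᵐ x ∂volume.restrict D2,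
      ∑ i, ((A x)⁻¹ l i * a i j k x + A x i j * b l i k x) = 0 := by
  have h1 := Sob.sum Finset.univ fun i => (hb l i).mul (ha i j) (hi l i) (hab i j)
  have h2 : Sob (fun x => ∑ i, (A x)⁻¹ l i * A x i j) (fun _ _ => 0) := by
    refine (Sob.const ((1 : Matrix (Fin m) (Fin m) ℝ) l j)).congr ?_ fun _ => EventuallyEq.rfl
    filter_upwards [hu] with x hx
    rw [← Matrix.mul_apply, Matrix.nonsing_inv_mul _ ((Matrix.isUnit_iff_isUnit_det _).1 hx)]
  exact h1.ae_eq_grad h2 k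

end Inverse

/-! ### Multiplication of weak systems by matrices. -/

section Equivalence

/-- Proves an identity of weak forms pointwise, modulo a finite sum of functions that integrate to
zero by earlier weak identities. -/
theorem integral_eq_of_sum {ι : Type*} [Fintype ι] {μ : Measure Plane} {S T : Plane → ℝ}
    {Φ : ι → Plane → ℝ} (hS : Integrable S μ) (hT : Integrable T μ) (hΦ : ∀ i, Integrable (Φ i) μ)
    (h0 : ∀ i, ∫ x, Φ i x ∂μ = 0) (h : ∀ᵐ x ∂μ, S x - T x = ∑ i, Φ i x) :
    ∫ x, S x ∂μ = ∫ x, T x ∂μ := by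
  rw [← sub_eq_zero, ← integral_sub hS hT, integral_congr_ae h, integral_finsetSum _ fun i _ => hΦ i]
  simp [h0]

theorem integrable_mul_test {U : Set Plane} {F φ : Plane → ℝ}
    (hF : Integrable F (volume.restrict D2)) (hφ : IsTestFunction U φ) :
    Integrable (fun x => F x * φ x) (volume.restrict D2) :=
  integrable_mul_top hF (memLp_top_test hφ)

theorem integrable_mul_D2 {f g : Plane → ℝ} (hf : MemLp f 2 (volume.restrict D2))
    (hg : MemLp g 2 (volume.restrict D2)) :
    Integrable (fun x => f x * g x) (volume.restrict D2) :=
  hf.integrable_mul hg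

theorem integrable_extend_test {F g : Fin 2 → Plane → ℝ} {f η : Plane → ℝ}
    (hF : ∀ k, MemLp (F k) 2 (volume.restrict D2)) (hf : Sob f g) (hη : IsTestFunction D2 η) :
    Integrable (fun x => ∑ k, F k x * (f x * partialDeriv k η x + g k x * η x))
      (volume.restrict D2) := by
  refine integrable_finsetSum _ fun k _ => ?_
  refine ((integrable_mul_test (integrable_mul_D2 (hF k) hf.memLp) (hη.partialDeriv k)).add
    (integrable_mul_test (integrable_mul_D2 (hF k) (hf.memLp_grad k)) hη)).congr
    (ae_of_all _ fun x => ?_)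
  simp only [Pi.add_apply]
  ring

/-- The difference of the two sides of `Sob.extend_test`, as one integral. -/
theorem integral_extend_test_sub {F g : Fin 2 → Plane → ℝ} {f h η : Plane → ℝ}
    (hF : ∀ k, MemLp (F k) 2 (volume.restrict D2)) (hh : Integrable h (volume.restrict D2))
    (hFh : ∀ φ, IsTestFunction D2 φ →
      ∫ x in D2, ∑ k, F k x * partialDeriv k φ x = ∫ x in D2, h x * φ x)
    (hf : Sob f g) (hfb : MemLp f ⊤ (volume.restrict D2)) (hη : IsTestFunction D2 η) :
    Integrable (fun x => ∑ k, F k x * (f x * partialDeriv k η x + g k x * η x) -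
      h x * (f x * η x)) (volume.restrict D2) ∧
    ∫ x in D2, (∑ k, F k x * (f x * partialDeriv k η x + g k x * η x) - h x * (f x * η x)) = 0 := by
  have i1 := integrable_extend_test hF hf hη
  have i2 : Integrable (fun x => h x * (f x * η x)) (volume.restrict D2) := by
    refine (integrable_mul_test (integrable_mul_top hh hfb) hη).congr (ae_of_all _ fun x => ?_)
    simp only
    ring
  exact ⟨i1.sub i2, by rw [integral_sub i1 i2, Sob.extend_test_of_bdd hF hh hFh hf hfb hη, sub_self]⟩

/-- A weak gradient, rotated by a right angle, is weakly divergence free. -/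
theorem Sob.integral_perp {u : Plane → ℝ} {U : Fin 2 → Plane → ℝ} (hu : Sob u U) {φ : Plane → ℝ}
    (hφ : IsTestFunction D2 φ) :
    ∫ x in D2, ∑ k, ![-U 1 x, U 0 x] k * partialDeriv k φ x = 0 := by
  have i : ∀ k l, Integrable (fun x => U k x * partialDeriv l φ x) (volume.restrict D2) :=
    fun k l => integrable_mul_test ((hu.memLp_grad k).integrable (by norm_num)) (hφ.partialDeriv l)
  have e : ∀ k l, ∫ x in D2, U k x * partialDeriv l φ x =
      - ∫ x in D2, u x * partialDeriv k (partialDeriv l φ) x := fun k l => by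
    rw [(hu.weak k).2.2 _ (hφ.partialDeriv l), neg_neg]
  have e1 : ∀ x, ∑ k, ![-U 1 x, U 0 x] k * partialDeriv k φ x =
      U 0 x * partialDeriv 1 φ x - U 1 x * partialDeriv 0 φ x := fun x => by
    simp [Fin.sum_univ_two]; ring
  simp_rw [e1]
  rw [integral_sub (i 0 1) (i 1 0), e, e]
  simp_rw [partialDeriv_comm hφ.1 0 1]
  ring

/-- Integration by parts for the Jacobian determinant of two functions of class `W^{1,2}`. -/
theorem Sob.integral_mul_perp {u f η : Plane → ℝ} {U g : Fin 2 → Plane → ℝ} (hu : Sob u U)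
    (hf : Sob f g) (hη : IsTestFunction D2 η) :
    ∫ x in D2, ∑ k, ![-U 1 x, U 0 x] k * (f x * partialDeriv k η x + g k x * η x) = 0 := by
  have := Sob.extend_test (F := fun k x => ![-U 1 x, U 0 x] k) (h := fun _ => 0) (fun k => by
    fin_cases k
    · exact (hu.memLp_grad 1).neg
    · exact hu.memLp_grad 0) (memLp_const 0) (fun φ hφ => by
      rw [hu.integral_perp hφ]; simp) hf hη
  simpa using this

variable {m : ℕ} {A B Inv : Plane → Matrix (Fin m) (Fin m) ℝ}
  {Ω a b c : Fin 2 → Plane → Matrix (Fin m) (Fin m) ℝ} {U : Fin 2 → Plane → Fin m → ℝ}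
  {V : Fin m → Plane → ℝ}

theorem memLp_mulVec (hA : MatMemLp ⊤ A) (hU : ∀ k i, MemLp (fun x => U k x i) 2 (volume.restrict D2))
    (k : Fin 2) (i : Fin m) : MemLp (fun x => (A x *ᵥ U k x) i) 2 (volume.restrict D2) := by
  simp only [Matrix.mulVec, dotProduct]
  exact memLp_finsetSum _ fun j _ => memLp_mul_top (hA i j) (hU k j)

theorem integrable_mulVec (hA : MatMemLp 2 A)
    (hU : ∀ k i, MemLp (fun x => U k x i) 2 (volume.restrict D2))
    (k : Fin 2) (i : Fin m) : Integrable (fun x => (A x *ᵥ U k x) i) (volume.restrict D2) := by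
  simp only [Matrix.mulVec, dotProduct]
  exact integrable_finsetSum _ fun j _ => integrable_mul_D2 (hA i j) (hU k j)

theorem integrable_sum_mul_test {F : Fin 2 → Plane → ℝ} {η : Plane → ℝ}
    (hF : ∀ k, Integrable (F k) (volume.restrict D2)) (hη : IsTestFunction D2 η) :
    Integrable (fun x => ∑ k, F k x * partialDeriv k η x) (volume.restrict D2) :=
  integrable_finsetSum _ fun k _ => integrable_mul_test (hF k) (hη.partialDeriv k)

/-- Multiplying a system by a bounded matrix of class `W^{1,2}`. -/
theorem system_mul (hA : ∀ i j, Sob (fun x => A x i j) fun k x => a k x i j) (hAb : MatMemLp ⊤ A)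
    (hU : ∀ k i, MemLp (fun x => U k x i) 2 (volume.restrict D2))
    (hV : ∀ i, Integrable (V i) (volume.restrict D2))
    (h : ∀ i φ, IsTestFunction D2 φ →
      ∫ x in D2, ∑ k, U k x i * partialDeriv k φ x = ∫ x in D2, V i x * φ x)
    (i : Fin m) {φ : Plane → ℝ} (hφ : IsTestFunction D2 φ) :
    ∫ x in D2, ∑ k, (A x *ᵥ U k x) i * partialDeriv k φ x =
      ∫ x in D2, ((A x *ᵥ fun j => V j x) i - ∑ k, (a k x *ᵥ U k x) i) * φ x := by
  have hk := fun j => integral_extend_test_sub (F := fun k x => U k x j) (h := V j)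
    (fun k => hU k j) (hV j) (h j) (hA i j) (hAb i j) hφ
  refine integral_eq_of_sum ?_ ?_ (fun j => (hk j).1) (fun j => (hk j).2) (ae_of_all _ fun x => ?_)
  · exact integrable_sum_mul_test
      (fun k => (memLp_mulVec hAb hU k i).integrable (by norm_num)) hφ
  · refine integrable_mul_test (Integrable.sub ?_ (integrable_finsetSum _ fun k _ => ?_)) hφ
    · simp only [Matrix.mulVec, dotProduct]
      exact integrable_finsetSum _ fun j _ => by
        simpa [mul_comm] using integrable_mul_top (hV j) (hAb i j)
    · exact integrable_mulVec (fun i j => (hA i j).memLp_grad k) hU k i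
  · simp only [Fin.sum_univ_two, Matrix.mulVec, dotProduct, Finset.sum_mul, sub_mul, add_mul,
      ← Finset.sum_sub_distrib, ← Finset.sum_add_distrib]
    exact Finset.sum_congr rfl fun j _ => by ring

/-- The field `∇^⊥u` is divergence free, so in `div(B∇^⊥u)` the derivative falls on `B` alone and a
sum of Jacobians remains. -/
theorem sum_mulVec_perp (hB : ∀ i j, Sob (fun x => B x i j) fun k x => b k x i j)
    {u : Fin m → Plane → ℝ} (hu : ∀ i, Sob (u i) fun k x => U k x i)
    (i : Fin m) {φ : Plane → ℝ} (hφ : IsTestFunction D2 φ) :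
    ∫ x in D2, ∑ k, (B x *ᵥ ![-U 1 x, U 0 x] k) i * partialDeriv k φ x =
      ∫ x in D2, ((b 0 x *ᵥ U 1 x) i - (b 1 x *ᵥ U 0 x) i) * φ x := by
  have hU : ∀ k i, MemLp (fun x => U k x i) 2 (volume.restrict D2) := fun k i =>
    (hu i).memLp_grad k
  have hP : ∀ k i, MemLp (fun x => (![-U 1 x, U 0 x] : Fin 2 → Fin m → ℝ) k i) 2
      (volume.restrict D2) := fun k i => by
    fin_cases k
    · exact (hU 1 i).neg
    · exact hU 0 i
  have hk : ∀ j, Integrable (fun x => ∑ k, ![-U 1 x j, U 0 x j] k *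
      (B x i j * partialDeriv k φ x + b k x i j * φ x)) (volume.restrict D2) := fun j =>
    integrable_extend_test (F := fun k x => ![-U 1 x j, U 0 x j] k) (fun k => by
      fin_cases k
      · exact (hU 1 j).neg
      · exact hU 0 j) (hB i j) hφ
  refine integral_eq_of_sum ?_ ?_ hk (fun j => (hu j).integral_mul_perp (hB i j) hφ)
    (ae_of_all _ fun x => ?_)
  · exact integrable_sum_mul_test (fun k => integrable_mulVec (U := fun k x => ![-U 1 x, U 0 x] k)
      (fun i j => (hB i j).memLp) hP k i) hφ
  · exact integrable_mul_test ((integrable_mulVec (fun i j => (hB i j).memLp_grad 0) hU 1 i).sub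
      (integrable_mulVec (fun i j => (hB i j).memLp_grad 1) hU 0 i)) hφ
  · simp only [Fin.sum_univ_two, Matrix.mulVec, dotProduct, Finset.sum_mul, sub_mul,
      ← Finset.sum_sub_distrib, ← Finset.sum_add_distrib]
    exact Finset.sum_congr rfl fun j _ => by simp; ring

end Equivalence

/-! ### Equivalence of the system and the conservation law. -/

section WeakForms

variable {m : ℕ} {A B : Plane → Matrix (Fin m) (Fin m) ℝ}
  {Ω : Fin 2 → Plane → Matrix (Fin m) (Fin m) ℝ} {u : Plane → EuclideanSpace ℝ (Fin m)}

theorem VecW12.sob (hu : VecW12 u) (i : Fin m) :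
    Sob (fun x => u x i) fun k x => vecGrad u k x i := (hu i).sob

theorem MatW12.sob (hA : MatW12 A) (i j : Fin m) :
    Sob (fun x => A x i j) fun k x => matGrad A k x i j := (hA i j).sob

theorem VecW12.memLp_vecGrad (hu : VecW12 u) (k : Fin 2) (i : Fin m) :
    MemLp (fun x => vecGrad u k x i) 2 (volume.restrict D2) := (hu.sob i).memLp_grad k

theorem integrable_potentialTerm (hΩ : ∀ k, MatMemLp 2 (Ω k)) (hu : VecW12 u) (i : Fin m) :
    Integrable (fun x => potentialTerm Ω u x i) (volume.restrict D2) := by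
  simp only [potentialTerm, Finset.sum_apply]
  exact integrable_finsetSum _ fun k _ => integrable_mulVec (hΩ k) hu.memLp_vecGrad k i

theorem locallyIntegrableOn_D2 {f : Plane → ℝ} (hf : Integrable f (volume.restrict D2)) :
    LocallyIntegrableOn f D2 :=
  locallyIntegrableOn_of_memLp le_rfl isOpen_D2 (memLp_one_iff_integrable.2 hf)

theorem Sob.integral_laplacian {f : Plane → ℝ} {g : Fin 2 → Plane → ℝ} (hf : Sob f g)
    {φ : Plane → ℝ} (hφ : IsTestFunction D2 φ) :
    ∫ x in D2, f x * (Δ φ) x = - ∫ x in D2, ∑ k, g k x * partialDeriv k φ x := by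
  have i : ∀ k, Integrable (fun x => g k x * partialDeriv k φ x) (volume.restrict D2) := fun k =>
    integrable_mul_test ((hf.memLp_grad k).integrable (by norm_num)) (hφ.partialDeriv k)
  have i' : ∀ k, Integrable (fun x => f x * partialDeriv k (partialDeriv k φ) x)
      (volume.restrict D2) := fun k => integrable_mul_test (hf.memLp.integrable (by norm_num))
        ((hφ.partialDeriv k).partialDeriv k)
  rw [integral_finsetSum _ fun k _ => i k, ← Finset.sum_neg_distrib]
  simp_rw [laplacian_eq_sum_partialDeriv hφ.1, Finset.mul_sum]
  rw [integral_finsetSum _ fun k _ => i' k]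
  exact Finset.sum_congr rfl fun k _ => (hf.weak k).2.2 _ (hφ.partialDeriv k)

theorem solvesSchrodinger_iff (hΩ : ∀ k, MatMemLp 2 (Ω k)) (hu : VecW12 u) :
    SolvesSchrodinger Ω u ↔ ∀ i φ, IsTestFunction D2 φ →
      ∫ x in D2, ∑ k, vecGrad u k x i * partialDeriv k φ x =
        ∫ x in D2, potentialTerm Ω u x i * φ x := by
  have key : ∀ i φ, IsTestFunction D2 φ → (∫ x in D2, u x i * (Δ φ) x =
      ∫ x in D2, -potentialTerm Ω u x i * φ x ↔
      ∫ x in D2, ∑ k, vecGrad u k x i * partialDeriv k φ x =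
        ∫ x in D2, potentialTerm Ω u x i * φ x) := fun i φ hφ => by
    rw [(hu.sob i).integral_laplacian hφ]
    simp_rw [neg_mul]
    rw [integral_neg, neg_inj]
  refine forall_congr' fun i => ⟨fun h φ hφ => (key i φ hφ).1 (h.2.2 φ hφ), fun h => ⟨?_, ?_,
    fun φ hφ => (key i φ hφ).2 (h φ hφ)⟩⟩
  · exact ((hu.sob i).weak 0).1
  · exact locallyIntegrableOn_D2 (integrable_potentialTerm hΩ hu i).neg

/-- The right-hand condition is the weak system for `A∇u` that results from multiplying the
Schrödinger system by `A`. The relation between `A`, `B` and `Ω` identifies its source with the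
Jacobians of `B` and `u`, that is, with `div(B∇^⊥u)`. -/
theorem conservationLaw_iff (hA : MatW12 A) (hB : MatW12 B) (hu : VecW12 u)
    (hAB : ∀ᵐ x ∂volume.restrict D2, ∀ k, matGrad A k x - A x * Ω k x = -matGradPerp B k x) :
    ConservationLaw A B u ↔ ∀ i φ, IsTestFunction D2 φ →
      ∫ x in D2, ∑ k, (A x *ᵥ vecGrad u k x) i * partialDeriv k φ x =
        ∫ x in D2, ((A x *ᵥ fun j => potentialTerm Ω u x j) i -
          ∑ k, (matGrad A k x *ᵥ vecGrad u k x) i) * φ x := by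
  have hP : ∀ k x, vecGradPerp u k x = ![-vecGrad u 1 x, vecGrad u 0 x] k := fun k x => by
    fin_cases k <;> rfl
  have hPm : ∀ k i, MemLp (fun x => vecGradPerp u k x i) 2 (volume.restrict D2) := fun k i => by
    fin_cases k
    · exact (hu.memLp_vecGrad 1 i).neg
    · exact hu.memLp_vecGrad 0 i
  have iA := integrable_mulVec (fun i j => (hA.sob i j).memLp) hu.memLp_vecGrad
  have iB := integrable_mulVec (U := vecGradPerp u) (fun i j => (hB.sob i j).memLp) hPm
  have key : ∀ i φ, IsTestFunction D2 φ →
      (∫ x in D2, ∑ k, (A x *ᵥ vecGrad u k x - B x *ᵥ vecGradPerp u k x) i * partialDeriv k φ x = 0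
        ↔ ∫ x in D2, ∑ k, (A x *ᵥ vecGrad u k x) i * partialDeriv k φ x =
        ∫ x in D2, ((A x *ᵥ fun j => potentialTerm Ω u x j) i -
          ∑ k, (matGrad A k x *ᵥ vecGrad u k x) i) * φ x) := fun i φ hφ => by
    have e := sum_mulVec_perp (U := vecGrad u) hB.sob hu.sob i hφ
    have e2 : ∫ x in D2, ((matGrad B 0 x *ᵥ vecGrad u 1 x) i -
        (matGrad B 1 x *ᵥ vecGrad u 0 x) i) * φ x =
        ∫ x in D2, ((A x *ᵥ fun j => potentialTerm Ω u x j) i -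
          ∑ k, (matGrad A k x *ᵥ vecGrad u k x) i) * φ x := by
      refine integral_congr_ae ?_
      filter_upwards [hAB] with x hx
      have h0 : matGrad B 1 x = matGrad A 0 x - A x * Ω 0 x := by
        rw [hx 0]; ext i j; simp [matGrad, matGradPerp, gradPerp]
      have h1 : matGrad B 0 x = A x * Ω 1 x - matGrad A 1 x := by
        rw [← neg_sub, hx 1]; ext i j; simp [matGrad, matGradPerp, gradPerp]
      have h2 : (fun j => potentialTerm Ω u x j) =
          Ω 0 x *ᵥ vecGrad u 0 x + Ω 1 x *ᵥ vecGrad u 1 x := by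
        funext j
        simp [potentialTerm, Fin.sum_univ_two]
      rw [h0, h1, h2, Matrix.mulVec_add, Matrix.sub_mulVec, Matrix.sub_mulVec,
        Matrix.mulVec_mulVec, Matrix.mulVec_mulVec, Fin.sum_univ_two]
      simp only [Pi.sub_apply, Pi.add_apply]
      ring
    rw [← e2, ← e]
    simp_rw [← hP, Pi.sub_apply, sub_mul, Finset.sum_sub_distrib]
    rw [integral_sub (integrable_sum_mul_test (fun k => iA k i) hφ)
      (integrable_sum_mul_test (fun k => iB k i) hφ), sub_eq_zero]
  refine forall_congr' fun i => ⟨fun h φ hφ => (key i φ hφ).1 (h.2 φ hφ), fun h =>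
    ⟨fun k => ?_, fun φ hφ => (key i φ hφ).2 (h φ hφ)⟩⟩
  exact locallyIntegrableOn_D2 ((iA k i).sub (iB k i))

theorem solvesSchrodinger_iff_conservationLaw (hΩ : ∀ k, MatMemLp 2 (Ω k)) (hA : MatW12 A)
    (hB : MatW12 B)
    (hAB : ∀ᵐ x ∂volume.restrict D2, ∀ k, matGrad A k x - A x * Ω k x = -matGradPerp B k x)
    (hA_unit : ∀ᵐ x ∂volume.restrict D2, IsUnit (A x)) (hA_bdd : MatMemLp ⊤ A)
    (hA_inv_bdd : MatMemLp ⊤ fun x => (A x)⁻¹) (hu : VecW12 u) :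
    SolvesSchrodinger Ω u ↔ ConservationLaw A B u := by
  rw [solvesSchrodinger_iff hΩ hu, conservationLaw_iff hA hB hu hAB]
  have hpot := integrable_potentialTerm hΩ hu
  refine ⟨fun h i φ hφ => ?_, fun h l φ hφ => ?_⟩
  · exact system_mul (U := vecGrad u) (a := matGrad A) (V := fun i x => potentialTerm Ω u x i)
      hA.sob hA_bdd hu.memLp_vecGrad hpot h i hφ
  -- For the converse, the system for `A∇u` is multiplied by `A⁻¹`, which therefore needs weak
  -- derivatives.
  have hinv : ∀ i j, BddSob fun x => (A x)⁻¹ i j :=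
    BddSob.matrix_inv (fun i j => ⟨⟨_, hA.sob i j⟩, hA_bdd i j⟩) hA_unit hA_inv_bdd
  choose b hb using fun i j => (hinv i j).1
  -- This cancels the two gradient terms in `A⁻¹(AΩ·∇u - ∇A·∇u) - ∇(A⁻¹)·A∇u` and leaves `Ω·∇u`.
  have hprod : ∀ᵐ x ∂volume.restrict D2, ∀ k,
      (A x)⁻¹ * matGrad A k x + Matrix.of (fun i j => b i j k x) * A x = 0 := by
    rw [ae_all_iff]
    intro k
    have h0 : ∀ᵐ x ∂volume.restrict D2, ∀ l j,
        ∑ i, ((A x)⁻¹ l i * matGrad A k x i j + A x i j * b l i k x) = 0 := by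
      rw [ae_all_iff]; intro l
      rw [ae_all_iff]; intro j
      exact sum_grad_inv_mul hA.sob hA_bdd hb hA_inv_bdd hA_unit l j k
    filter_upwards [h0] with x hx
    ext l j
    rw [Matrix.add_apply, Matrix.mul_apply, Matrix.mul_apply, ← Finset.sum_add_distrib,
      Matrix.zero_apply, ← hx l j]
    exact Finset.sum_congr rfl fun i _ => by simp [mul_comm]
  have hV : ∀ i, Integrable (fun x => (A x *ᵥ fun j => potentialTerm Ω u x j) i -
      ∑ k, (matGrad A k x *ᵥ vecGrad u k x) i) (volume.restrict D2) := fun i => by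
    refine Integrable.sub ?_ (integrable_finsetSum _ fun k _ => ?_)
    · simp only [Matrix.mulVec, dotProduct]
      exact integrable_finsetSum _ fun j _ => by
        simpa [mul_comm] using integrable_mul_top (hpot j) (hA_bdd i j)
    · exact integrable_mulVec (fun i j => (hA.sob i j).memLp_grad k) hu.memLp_vecGrad k i
  have hs := system_mul (A := fun x => (A x)⁻¹) (U := fun k x => A x *ᵥ vecGrad u k x)
    (a := fun k x => Matrix.of fun i j => b i j k x) (V := fun i x =>
      (A x *ᵥ fun j => potentialTerm Ω u x j) i - ∑ k, (matGrad A k x *ᵥ vecGrad u k x) i)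
    hb hA_inv_bdd (memLp_mulVec hA_bdd hu.memLp_vecGrad) hV h l hφ
  have hone : ∀ᵐ x ∂volume.restrict D2, (A x)⁻¹ * A x = 1 := by
    filter_upwards [hA_unit] with x hx
    exact Matrix.nonsing_inv_mul _ ((Matrix.isUnit_iff_isUnit_det _).1 hx)
  refine (integral_congr_ae ?_).trans (hs.trans (integral_congr_ae ?_))
  · filter_upwards [hone] with x hx
    simp [Matrix.mulVec_mulVec, hx]
  · filter_upwards [hone, hprod] with x hx hp
    have e1 : (fun j => (A x *ᵥ fun j => potentialTerm Ω u x j) j -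
        ∑ k, (matGrad A k x *ᵥ vecGrad u k x) j) =
        (A x *ᵥ potentialTerm Ω u x) - ∑ k, matGrad A k x *ᵥ vecGrad u k x := by
      funext j
      simp
    have e2 : ∀ k, (A x)⁻¹ *ᵥ (matGrad A k x *ᵥ vecGrad u k x) =
        - (Matrix.of (fun i j => b i j k x) *ᵥ (A x *ᵥ vecGrad u k x)) := fun k => by
      rw [Matrix.mulVec_mulVec, Matrix.mulVec_mulVec, ← Matrix.neg_mulVec,
        eq_neg_of_add_eq_zero_left (hp k)]
    simp only [e1]
    rw [Matrix.mulVec_sub, Matrix.mulVec_mulVec, hx, Matrix.one_mulVec, Matrix.mulVec_sum]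
    simp_rw [e2]
    simp only [Fin.sum_univ_two, Pi.sub_apply, Pi.add_apply, Pi.neg_apply]
    ring

end WeakForms

/-! ### The trilinear estimate for Sobolev functions and smallness on small balls. -/

section SobolevTrilinear

theorem tendsto_integral_sq_of_L2Loc {H : ℕ → Plane → ℝ} {h : Plane → ℝ} (hH : TendstoL2Loc H h)
    (hh : MemLp h 2 (volume.restrict D2)) {p : Plane} {s : ℝ} (hps : ‖p‖ + s < 1) :
    Tendsto (fun n => ∫ x in ball p s, H n x ^ 2) atTop (𝓝 (∫ x in ball p s, h x ^ 2)) := by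
  have hsub : ball p s ⊆ ball 0 (‖p‖ + s) := ball_subset_ball' (by simp [add_comm])
  obtain ⟨hmem, hlim⟩ := hH _ hps
  have hhs : MemLp h 2 (volume.restrict (ball p s)) :=
    (memLp_ball_of_D2 hh hps).mono_measure (Measure.restrict_mono hsub le_rfl)
  have hms : ∀ n, MemLp (fun x => H n x - h x) 2 (volume.restrict (ball p s)) := fun n =>
    (hmem n).mono_measure (Measure.restrict_mono hsub le_rfl)
  have hlim' : Tendsto (fun n => ∫ x in ball p s, (H n x - h x) ^ 2) atTop (𝓝 0) := by
    refine squeeze_zero (fun n => integral_nonneg fun _ => sq_nonneg _) (fun n => ?_) hlim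
    exact setIntegral_mono_set (hmem n).integrable_sq (ae_of_all _ fun _ => sq_nonneg _)
      hsub.eventuallyLE
  have hcross : Tendsto (fun n => ∫ x in ball p s, h x * (H n x - h x)) atTop (𝓝 0) := by
    have h0 : Tendsto (fun n => √(∫ x in ball p s, h x ^ 2) *
        √(∫ x in ball p s, (H n x - h x) ^ 2)) atTop (𝓝 0) := by
      simpa using hlim'.sqrt.const_mul √(∫ x in ball p s, h x ^ 2)
    exact squeeze_zero_norm (fun n => abs_integral_mul_le_sqrt hhs (hms n)) h0
  have e : ∀ n, ∫ x in ball p s, H n x ^ 2 = (∫ x in ball p s, h x ^ 2) +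
      (2 * (∫ x in ball p s, h x * (H n x - h x)) + ∫ x in ball p s, (H n x - h x) ^ 2) := by
    intro n
    have i1 := hhs.integrable_sq
    have i2 : Integrable (fun x => h x * (H n x - h x)) (volume.restrict (ball p s)) :=
      hhs.integrable_mul (hms n)
    have i3 := (hms n).integrable_sq
    have i4 : Integrable (fun x => 2 * (h x * (H n x - h x)) + (H n x - h x) ^ 2)
        (volume.restrict (ball p s)) := (i2.const_mul 2).add i3
    rw [← integral_const_mul, ← integral_add (i2.const_mul 2) i3, ← integral_add i1 i4]
    exact integral_congr_ae (ae_of_all _ fun x => by simp only; ring)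
  simp_rw [e]
  simpa using tendsto_const_nhds.add ((hcross.const_mul 2).add hlim')

theorem tendsto_sqrt_integral_of_L2Loc {H : Fin 2 → ℕ → Plane → ℝ} {h : Fin 2 → Plane → ℝ}
    (hH : ∀ k, TendstoL2Loc (H k) (h k)) (hHc : ∀ k n, Continuous (H k n))
    (hh : ∀ k, MemLp (h k) 2 (volume.restrict D2)) {p : Plane} {s : ℝ} (hps : ‖p‖ + s < 1) :
    Tendsto (fun n => √(∫ x in ball p s, (H 0 n x ^ 2 + H 1 n x ^ 2))) atTop
      (𝓝 √(∫ x in ball p s, (h 0 x ^ 2 + h 1 x ^ 2))) := by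
  have hsub : ball p s ⊆ ball 0 (‖p‖ + s) := ball_subset_ball' (by simp [add_comm])
  have hi : ∀ k, Integrable (fun x => h k x ^ 2) (volume.restrict (ball p s)) := fun k =>
    ((memLp_ball_of_D2 (hh k) hps).mono_measure
      (Measure.restrict_mono hsub le_rfl)).integrable_sq
  have hHi : ∀ k n, Integrable (fun x => H k n x ^ 2) (volume.restrict (ball p s)) := fun k n =>
    (memLp_ball_of_continuous (hHc k n) p s 2).integrable_sq
  refine Tendsto.sqrt ?_
  simp_rw [integral_add (hHi 0 _) (hHi 1 _)]
  rw [integral_add (hi 0) (hi 1)]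
  exact (tendsto_integral_sq_of_L2Loc (hH 0) (hh 0) hps).add
    (tendsto_integral_sq_of_L2Loc (hH 1) (hh 1) hps)

theorem integrable_mul_mul_test {G h φ : Plane → ℝ} (hG : MemLp G 2 (volume.restrict D2))
    (hh : MemLp h 2 (volume.restrict D2)) (hφ : IsTestFunction D2 φ) :
    Integrable (fun x => G x * (h x * φ x)) (volume.restrict D2) := by
  refine (integrable_mul_test (integrable_mul_D2 hG hh) hφ).congr (ae_of_all _ fun x => ?_)
  simp only
  ring

theorem memLp_D2_of_continuous {f : Plane → ℝ} (hf : Continuous f) :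
    MemLp f 2 (volume.restrict D2) := memLp_ball_of_continuous hf 0 1 2

theorem tendsto_integral_jac {H : Fin 2 → ℕ → Plane → ℝ} {h G : Fin 2 → Plane → ℝ} {φ : Plane → ℝ}
    (hH : ∀ k, TendstoL2Loc (H k) (h k)) (hHc : ∀ k n, Continuous (H k n))
    (hh : ∀ k, MemLp (h k) 2 (volume.restrict D2)) (hG : ∀ k, MemLp (G k) 2 (volume.restrict D2))
    (hφ : IsTestFunction D2 φ) :
    Tendsto (fun n => ∫ x in D2, (G 0 x * (H 1 n x * φ x) - G 1 x * (H 0 n x * φ x))) atTop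
      (𝓝 (∫ x in D2, (G 0 x * (h 1 x * φ x) - G 1 x * (h 0 x * φ x)))) := by
  simp_rw [fun n => integral_sub
    (integrable_mul_mul_test (hG 0) (memLp_D2_of_continuous (hHc 1 n)) hφ)
    (integrable_mul_mul_test (hG 1) (memLp_D2_of_continuous (hHc 0 n)) hφ)]
  rw [integral_sub (integrable_mul_mul_test (hG 0) (hh 1) hφ)
    (integrable_mul_mul_test (hG 1) (hh 0) hφ)]
  exact (tendsto_integral_mul_of_L2Loc (hH 1) (hh 1) (hG 0) hφ).sub
    (tendsto_integral_mul_of_L2Loc (hH 0) (hh 0) (hG 1) hφ)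

/-- The localized trilinear estimate for functions of class `W^{1,2}`. -/
theorem exists_sob_trilinear_bound : ∃ C : ℝ, 0 < C ∧ ∀ (p : Plane) (r : ℝ), 0 < r →
    ‖p‖ + 2 * r < 1 → ∀ (φ f u : Plane → ℝ) (g U : Fin 2 → Plane → ℝ),
    IsTestFunction (ball p r) φ → Sob f g → Sob u U →
    |∫ x in D2, (g 0 x * (U 1 x * φ x) - g 1 x * (U 0 x * φ x))| ≤ C * √(∫ x, gradSq φ x) *
      (√(∫ x in ball p (2 * r), (g 0 x ^ 2 + g 1 x ^ 2)) *
        √(∫ x in ball p (2 * r), (U 0 x ^ 2 + U 1 x ^ 2))) := by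
  obtain ⟨C, hC, htri⟩ := exists_local_trilinear_bound
  refine ⟨C, hC, fun p r hr hpr φ f u g U hφ hf hu => ?_⟩
  have hφD : IsTestFunction D2 φ := hφ.mono (ball_subset_ball' (by simp; linarith))
  obtain ⟨Fn, hFs, -, hFd, -, -⟩ := hf.exists_approx
  obtain ⟨Vn, hVs, -, hVd, -, -⟩ := hu.exists_approx
  have cF : ∀ k n, Continuous (partialDeriv k (Fn n)) := fun k n =>
    (contDiff_partialDeriv (hFs n) k).continuous
  have cV : ∀ k n, Continuous (partialDeriv k (Vn n)) := fun k n =>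
    (contDiff_partialDeriv (hVs n) k).continuous
  -- The two functions are approximated one after the other, so that each limit pairs an `L²`
  -- convergent sequence with a fixed `L²` function.
  have step : ∀ n, |∫ x in D2, (partialDeriv 0 (Fn n) x * (U 1 x * φ x) -
      partialDeriv 1 (Fn n) x * (U 0 x * φ x))| ≤ C * √(∫ x, gradSq φ x) *
      (√(∫ x in ball p (2 * r), gradSq (Fn n) x) *
        √(∫ x in ball p (2 * r), (U 0 x ^ 2 + U 1 x ^ 2))) := by
    intro n
    refine le_of_tendsto_of_tendsto'
      (tendsto_integral_jac (H := fun k j => partialDeriv k (Vn j))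
        (G := fun k => partialDeriv k (Fn n)) hVd cV hu.memLp_grad
        (fun k => memLp_D2_of_continuous (cF k n)) hφD).abs
      (((tendsto_sqrt_integral_of_L2Loc (H := fun k j => partialDeriv k (Vn j)) hVd cV
        hu.memLp_grad hpr).const_mul _).const_mul _) fun j => ?_
    refine le_trans (le_of_eq ?_) (htri p r hr φ (Fn n) (Vn j) hφ (hFs n) (hVs j))
    congr 1
    have := setIntegral_mul_test (g := jac (Fn n) (Vn j)) hφD
    simp_rw [mul_comm (φ _)]
    rw [← this]
    refine integral_congr_ae (ae_of_all _ fun x => ?_)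
    simp only [jac]
    ring
  have e : ∀ (a b : Fin 2 → Plane → ℝ),
      ∫ x in D2, (a 0 x * (b 1 x * φ x) - a 1 x * (b 0 x * φ x)) =
      - ∫ x in D2, (b 0 x * (a 1 x * φ x) - b 1 x * (a 0 x * φ x)) := fun a b => by
    rw [← integral_neg]
    exact integral_congr_ae (ae_of_all _ fun x => by simp only; ring)
  rw [e, abs_neg]
  refine le_of_tendsto_of_tendsto'
    (tendsto_integral_jac (H := fun k j => partialDeriv k (Fn j)) (G := U) hFd cF hf.memLp_grad
      hu.memLp_grad hφD).abs
    (((tendsto_sqrt_integral_of_L2Loc (H := fun k j => partialDeriv k (Fn j)) hFd cF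
      hf.memLp_grad hpr).mul_const _).const_mul _) fun n => ?_
  rw [e (fun k => U k) (fun k => partialDeriv k (Fn n)), abs_neg]
  exact step n

/-- Absolute continuity of the integral; it is uniform in the centre since the area of a ball
depends only on its radius. -/
theorem exists_radius_setIntegral_lt {e : Plane → ℝ} (he : Integrable e) (h0 : ∀ x, 0 ≤ e x)
    {ε : ℝ} (hε : 0 < ε) : ∃ s₀ : ℝ, 0 < s₀ ∧ ∀ p s, s < s₀ → ∫ x in ball p s, e x < ε := by
  have hfin : ∫⁻ x, ENNReal.ofReal (e x) ≠ ⊤ := he.lintegral_lt_top.ne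
  obtain ⟨δ, hδ, h⟩ := exists_pos_setLIntegral_lt_of_measure_lt hfin
    (ENNReal.ofReal_pos.2 hε).ne'
  have hlim : Tendsto (fun s : ℝ => volume (ball (0 : Plane) s)) (𝓝[>] 0) (𝓝 0) := by
    have : Tendsto (fun s : ℝ => ENNReal.ofReal (Real.pi * s ^ 2)) (𝓝 0) (𝓝 0) := by
      have := ENNReal.tendsto_ofReal ((continuous_const.mul (continuous_pow 2) :
        Continuous fun s : ℝ => Real.pi * s ^ 2).tendsto 0)
      simpa using this
    refine (this.mono_left nhdsWithin_le_nhds).congr' ?_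
    filter_upwards [self_mem_nhdsWithin] with s hs
    rw [← volume_real_ball_plane 0 (le_of_lt hs), measureReal_def,
      ENNReal.ofReal_toReal measure_ball_lt_top.ne]
  obtain ⟨s₀, hs₀, hlt⟩ := ((hlim.eventually (gt_mem_nhds hδ)).and self_mem_nhdsWithin).exists
  refine ⟨s₀, hlt, fun p s hs => ?_⟩
  have hm : volume (ball p s) < δ := by
    refine lt_of_le_of_lt ?_ hs₀
    rw [EuclideanSpace.volume_ball, EuclideanSpace.volume_ball]
    gcongr
  have h1 := h _ hm
  rw [integral_eq_lintegral_of_nonneg_ae (ae_of_all _ h0) he.1.restrict]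
  rw [← ENNReal.ofReal_lt_ofReal_iff hε, ENNReal.ofReal_toReal (h1.ne_top)]
  exact h1

end SobolevTrilinear

/-! ### One step of energy decay. -/

section DecayStep

variable {m : ℕ} {A B : Plane → Matrix (Fin m) (Fin m) ℝ} {u : Plane → EuclideanSpace ℝ (Fin m)}

/-- The energy density `|∇u|²`. -/
noncomputable def energy (u : Plane → EuclideanSpace ℝ (Fin m)) (x : Plane) : ℝ :=
  ∑ k, ∑ i, vecGrad u k x i ^ 2

theorem energy_nonneg (u : Plane → EuclideanSpace ℝ (Fin m)) (x : Plane) : 0 ≤ energy u x :=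
  Finset.sum_nonneg fun _ _ => Finset.sum_nonneg fun _ _ => sq_nonneg _

theorem integrable_energy (hu : VecW12 u) : Integrable (energy u) (volume.restrict D2) :=
  integrable_finsetSum _ fun k _ => integrable_finsetSum _ fun i _ =>
    (hu.memLp_vecGrad k i).integrable_sq

theorem MatMemLp.exists_bound (hA : MatMemLp ⊤ A) :
    ∃ K, 0 ≤ K ∧ ∀ᵐ x ∂volume.restrict D2, ∀ i j, |A x i j| ≤ K := by
  choose M hM0 hM using fun i j => exists_ae_abs_le (hA i j)
  refine ⟨∑ i, ∑ j, M i j, Finset.sum_nonneg fun i _ => Finset.sum_nonneg fun j _ => hM0 i j, ?_⟩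
  rw [ae_all_iff]; intro i
  rw [ae_all_iff]; intro j
  filter_upwards [hM i j] with x hx
  refine hx.trans ?_
  refine (Finset.single_le_sum (f := fun j => M i j) (fun j _ => hM0 i j) (Finset.mem_univ j)).trans ?_
  exact Finset.single_le_sum (f := fun i => ∑ j, M i j)
    (fun i _ => Finset.sum_nonneg fun j _ => hM0 i j) (Finset.mem_univ i)

theorem sq_mulVec_le {W : Matrix (Fin m) (Fin m) ℝ} {K : ℝ} (hW : ∀ i j, |W i j| ≤ K)
    (v : Fin m → ℝ) (i : Fin m) : (W *ᵥ v) i ^ 2 ≤ m * K ^ 2 * ∑ j, v j ^ 2 := by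
  simp only [Matrix.mulVec, dotProduct]
  refine (sq_sum_le_card_mul_sum_sq (s := Finset.univ)).trans ?_
  rw [Finset.card_univ, Fintype.card_fin, mul_assoc]
  refine mul_le_mul_of_nonneg_left ?_ (Nat.cast_nonneg m)
  rw [Finset.mul_sum]
  refine Finset.sum_le_sum fun j _ => ?_
  rw [mul_pow]
  refine mul_le_mul_of_nonneg_right ?_ (sq_nonneg _)
  exact sq_le_sq' (by linarith [neg_abs_le (W i j), hW i j]) ((le_abs_self _).trans (hW i j))

theorem ball_subset_D2' {p : Plane} {s : ℝ} (hps : ‖p‖ + s < 1) : ball p s ⊆ D2 :=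
  ball_subset_ball' (by simp; linarith)

theorem sqrt_setIntegral_le_energy (hu : VecW12 u) {p : Plane} {s : ℝ} (hps : ‖p‖ + s < 1)
    (j : Fin m) : √(∫ x in ball p s, (vecGrad u 0 x j ^ 2 + vecGrad u 1 x j ^ 2)) ≤
      √(∫ x in ball p s, energy u x) := by
  have hr : volume.restrict (ball p s) ≤ volume.restrict D2 :=
    Measure.restrict_mono (ball_subset_D2' hps) le_rfl
  refine Real.sqrt_le_sqrt (integral_mono ?_ ((integrable_energy hu).mono_measure hr) fun x => ?_)
  · exact (((hu.memLp_vecGrad 0 j).integrable_sq.add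
      (hu.memLp_vecGrad 1 j).integrable_sq)).mono_measure hr
  · simp only [energy, Fin.sum_univ_two]
    exact add_le_add
      (Finset.single_le_sum (f := fun i => vecGrad u 0 x i ^ 2) (fun i _ => sq_nonneg _)
        (Finset.mem_univ j))
      (Finset.single_le_sum (f := fun i => vecGrad u 1 x i ^ 2) (fun i _ => sq_nonneg _)
        (Finset.mem_univ j))

/-- It is used with `B` for the divergence of `A∇u`, and with `A` in place of `B` for its curl. -/
theorem exists_abs_integral_mulVec_jac_le : ∃ C : ℝ, 0 < C ∧ ∀ (m : ℕ)
    (u : Plane → EuclideanSpace ℝ (Fin m)), VecW12 u → ∀ (B : Plane → Matrix (Fin m) (Fin m) ℝ),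
    MatW12 B → ∀ (p : Plane) (r δ : ℝ), 0 < r → ‖p‖ + 2 * r < 1 → 0 ≤ δ →
    (∀ i j, √(∫ x in ball p (2 * r), (matGrad B 0 x i j ^ 2 + matGrad B 1 x i j ^ 2)) ≤ δ) →
    ∀ i φ, IsTestFunction (ball p r) φ →
    |∫ x in D2, ((matGrad B 0 x *ᵥ vecGrad u 1 x) i - (matGrad B 1 x *ᵥ vecGrad u 0 x) i) * φ x| ≤
      (C * m * δ * √(∫ x in ball p (2 * r), energy u x)) * √(∫ x, gradSq φ x) := by
  obtain ⟨C, hC, htri⟩ := exists_sob_trilinear_bound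
  refine ⟨C, hC, fun m u hu B hB p r δ hr hpr hδ hBδ i φ hφ => ?_⟩
  have hφD : IsTestFunction D2 φ := hφ.mono (ball_subset_D2' (by linarith))
  have e : ∫ x in D2, ((matGrad B 0 x *ᵥ vecGrad u 1 x) i - (matGrad B 1 x *ᵥ vecGrad u 0 x) i) *
      φ x = ∑ j, ∫ x in D2, (matGrad B 0 x i j * (vecGrad u 1 x j * φ x) -
        matGrad B 1 x i j * (vecGrad u 0 x j * φ x)) := by
    rw [← integral_finsetSum]
    · refine integral_congr_ae (ae_of_all _ fun x => ?_)
      simp only [Matrix.mulVec, dotProduct, ← Finset.sum_sub_distrib, Finset.sum_mul]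
      exact Finset.sum_congr rfl fun j _ => by ring
    · intro j _
      exact (integrable_mul_mul_test ((hB.sob i j).memLp_grad 0) (hu.memLp_vecGrad 1 j) hφD).sub
        (integrable_mul_mul_test ((hB.sob i j).memLp_grad 1) (hu.memLp_vecGrad 0 j) hφD)
  rw [e]
  refine (Finset.abs_sum_le_sum_abs _ _).trans ?_
  have hj : ∀ j, |∫ x in D2, (matGrad B 0 x i j * (vecGrad u 1 x j * φ x) -
        matGrad B 1 x i j * (vecGrad u 0 x j * φ x))| ≤
      C * √(∫ x, gradSq φ x) * (δ * √(∫ x in ball p (2 * r), energy u x)) := fun j => by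
    refine (htri p r hr hpr φ _ _ _ _ hφ (hB.sob i j) (hu.sob j)).trans ?_
    exact mul_le_mul_of_nonneg_left (mul_le_mul (hBδ i j) (sqrt_setIntegral_le_energy hu hpr j)
      (Real.sqrt_nonneg _) hδ) (by positivity)
  refine (Finset.sum_le_sum fun j _ => hj j).trans (le_of_eq ?_)
  rw [Finset.sum_const, Finset.card_univ, Fintype.card_fin, nsmul_eq_mul]
  ring

theorem integral_indicator_mul_add {X Y φ ψ : Plane → ℝ} :
    ∫ x, (D2.indicator X x * φ x + D2.indicator Y x * ψ x) = ∫ x in D2, (X x * φ x + Y x * ψ x) := by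
  rw [← integral_indicator measurableSet_D2]
  refine integral_congr_ae (ae_of_all _ fun x => ?_)
  by_cases hx : x ∈ D2 <;> simp [hx]

/-- One step of the decay of the Dirichlet energy for a solution of the conservation law. -/
theorem exists_decay_step (hA : MatW12 A) (hB : MatW12 B) (hu : VecW12 u)
    (hA_unit : ∀ᵐ x ∂volume.restrict D2, IsUnit (A x)) (hA_bdd : MatMemLp ⊤ A)
    (hA_inv_bdd : MatMemLp ⊤ fun x => (A x)⁻¹) (hcons : ConservationLaw A B u) :
    ∃ C : ℝ, 0 < C ∧ ∀ (p : Plane) (s ρ δ : ℝ), 0 < ρ → 16 * ρ ≤ s → ‖p‖ + s < 1 → 0 ≤ δ →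
      (∀ i j, √(∫ x in ball p s, (matGrad A 0 x i j ^ 2 + matGrad A 1 x i j ^ 2)) ≤ δ) →
      (∀ i j, √(∫ x in ball p s, (matGrad B 0 x i j ^ 2 + matGrad B 1 x i j ^ 2)) ≤ δ) →
      √(∫ x in ball p ρ, energy u x) ≤ C * (ρ / s + δ) * √(∫ x in ball p s, energy u x) := by
  obtain ⟨C₀, hC₀, hjac⟩ := exists_abs_integral_mulVec_jac_le
  obtain ⟨C₁, hC₁, hdual⟩ := exists_duality_bound
  obtain ⟨K, hK0, hK⟩ := hA_bdd.exists_bound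
  obtain ⟨K', hK'0, hK'⟩ := hA_inv_bdd.exists_bound
  set C₂ := 2 * C₁ * √(m * K ^ 2) + C₁ * (C₀ * m) with hC₂
  set C₃ := √(2 * (m * (m * K' ^ 2 * m))) with hC₃
  refine ⟨C₃ * C₂ + 1, by positivity, fun p s ρ δ hρ hρs hps hδ hAδ hBδ => ?_⟩
  -- The trilinear estimate for test functions in `B_r` needs energies on `B_{2r}`, and `16ρ ≤ s`
  -- becomes the condition `8ρ ≤ r` of the duality bound.
  set r := s / 2 with hr
  have hr0 : 0 < r := by linarith
  have h2r : 2 * r = s := by rw [hr]; ring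
  have hmono : ∀ t, t ≤ s → volume.restrict (ball p t) ≤ volume.restrict D2 := fun t ht =>
    Measure.restrict_mono ((ball_subset_ball ht).trans (ball_subset_D2' hps)) le_rfl
  set S := √(∫ x in ball p s, energy u x) with hS
  set M := C₀ * m * δ * S with hM
  set X : Fin 2 → Fin m → Plane → ℝ := fun k i => D2.indicator fun x => (A x *ᵥ vecGrad u k x) i
    with hX
  have mX : ∀ k i, MemLp (X k i) 2 := fun k i =>
    (memLp_indicator_iff_restrict measurableSet_D2).2 (memLp_mulVec hA_bdd hu.memLp_vecGrad k i)
  -- The conservation law replaces the pairing of `A∇u` with `∇φ` by that of `B∇^⊥u`, which consists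
  -- of Jacobians of `B` and `u`.
  have hdiv : ∀ i φ, IsTestFunction (ball p r) φ →
      |∫ x, (X 0 i x * partialDeriv 0 φ x + X 1 i x * partialDeriv 1 φ x)| ≤
        M * √(∫ x, gradSq φ x) := fun i φ hφ => by
    have hφD : IsTestFunction D2 φ := hφ.mono (ball_subset_D2' (by linarith))
    have h1 := hjac m u hu B hB p r δ hr0 (by linarith) hδ (by rwa [h2r]) i φ hφ
    rw [h2r, ← sum_mulVec_perp (U := vecGrad u) hB.sob hu.sob i hφD] at h1
    refine le_trans (le_of_eq ?_) h1
    congr 1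
    rw [hX, integral_indicator_mul_add]
    have h2 := (hcons i).2 φ hφD
    have iA := integrable_mulVec (fun i j => (hA.sob i j).memLp) hu.memLp_vecGrad
    have hPm : ∀ k i, MemLp (fun x => vecGradPerp u k x i) 2 (volume.restrict D2) := fun k i => by
      fin_cases k
      · exact (hu.memLp_vecGrad 1 i).neg
      · exact hu.memLp_vecGrad 0 i
    have iB := integrable_mulVec (U := vecGradPerp u) (fun i j => (hB.sob i j).memLp) hPm
    simp_rw [Pi.sub_apply, sub_mul, Finset.sum_sub_distrib] at h2
    rw [integral_sub (integrable_sum_mul_test (fun k => iA k i) hφD)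
      (integrable_sum_mul_test (fun k => iB k i) hφD), sub_eq_zero] at h2
    have hP : ∀ k x, vecGradPerp u k x = ![-vecGrad u 1 x, vecGrad u 0 x] k := fun k x => by
      fin_cases k <;> rfl
    simp_rw [← hP, ← h2, Fin.sum_univ_two]
  -- Here no equation is needed: the rotated pairing is that of `A∇^⊥u` with `∇φ`, a sum of
  -- Jacobians of `A` and `u`.
  have hcurl : ∀ i φ, IsTestFunction (ball p r) φ →
      |∫ x, (X 0 i x * partialDeriv 1 φ x - X 1 i x * partialDeriv 0 φ x)| ≤
        M * √(∫ x, gradSq φ x) := fun i φ hφ => by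
    have hφD : IsTestFunction D2 φ := hφ.mono (ball_subset_D2' (by linarith))
    have h1 := hjac m u hu A hA p r δ hr0 (by linarith) hδ (by rwa [h2r]) i φ hφ
    rw [h2r, ← sum_mulVec_perp (U := vecGrad u) hA.sob hu.sob i hφD] at h1
    refine le_trans (le_of_eq ?_) h1
    congr 1
    rw [← integral_indicator measurableSet_D2]
    refine integral_congr_ae (ae_of_all _ fun x => ?_)
    by_cases hx : x ∈ D2
    · simp [hX, hx, Matrix.mulVec_neg]; ring
    · simp [hX, hx]
  set Q := C₁ * (ρ / r) * √(m * K ^ 2) * S + C₁ * M with hQ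
  have hXr : ∀ i, √(∫ x in ball p r, (X 0 i x ^ 2 + X 1 i x ^ 2)) ≤ √(m * K ^ 2) * S := fun i => by
    rw [hS, ← Real.sqrt_mul (by positivity)]
    refine Real.sqrt_le_sqrt ?_
    rw [← integral_const_mul]
    have hi : Integrable (fun x => m * K ^ 2 * energy u x) (volume.restrict (ball p s)) :=
      ((integrable_energy hu).mono_measure (hmono s le_rfl)).const_mul _
    have hi2 : Integrable (fun x => X 0 i x ^ 2 + X 1 i x ^ 2) :=
      (mX 0 i).integrable_sq.add (mX 1 i).integrable_sq
    refine le_trans (setIntegral_mono_set hi2.integrableOn (ae_of_all _ fun x => by positivity)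
      (ball_subset_ball (by linarith : r ≤ s)).eventuallyLE) ?_
    refine integral_mono_ae hi2.integrableOn hi ?_
    filter_upwards [ae_mono (hmono s le_rfl) hK, ae_restrict_mem measurableSet_ball] with x hx hxb
    have hxD : x ∈ D2 := ball_subset_D2' hps hxb
    simp only [hX, hxD, Set.indicator_of_mem, energy, Fin.sum_univ_two, mul_add]
    exact add_le_add (sq_mulVec_le hx _ i) (sq_mulVec_le hx _ i)
  have hXQ : ∀ k i, √(∫ x in ball p ρ, X k i x ^ 2) ≤ Q := fun k i => by
    have hM0 : 0 ≤ M := by positivity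
    have hf : ∀ Z, Z ≤ √(m * K ^ 2) * S → C₁ * (ρ / r) * Z + C₁ * M ≤ Q := fun Z hZ => by
      rw [hQ, mul_assoc (C₁ * (ρ / r))]
      gcongr
    fin_cases k
    · exact (hdual p r ρ M hr0 hρ (by linarith) hM0 _ _ (mX 0 i) (mX 1 i) (hdiv i)
        (hcurl i)).trans (hf _ (hXr i))
    -- The second component is the first component of the rotated field `(X₁, -X₀)`, for which
    -- divergence and curl change roles up to sign.
    · refine (hdual p r ρ M hr0 hρ (by linarith) hM0 (X 1 i) (fun x => -X 0 i x) (mX 1 i)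
        (mX 0 i).neg (fun φ hφ => ?_) (fun φ hφ => ?_)).trans (hf _ ?_)
      · rw [← abs_neg, ← integral_neg]
        refine le_trans (le_of_eq ?_) (hcurl i φ hφ)
        congr 2
        funext x
        ring
      · refine le_trans (le_of_eq ?_) (hdiv i φ hφ)
        congr 2
        funext x
        ring
      · refine le_trans (le_of_eq ?_) (hXr i)
        congr 2
        funext x
        ring
  have hQ0 : 0 ≤ Q := by positivity
  -- The bounded inverse recovers `∇u = A⁻¹(A∇u)` from the estimate for `A∇u`.
  have hE : ∫ x in ball p ρ, energy u x ≤ 2 * (m * (m * K' ^ 2 * m)) * Q ^ 2 := by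
    have hi : ∀ k i, Integrable (fun x => X k i x ^ 2) (volume.restrict (ball p ρ)) := fun k i =>
      (mX k i).integrable_sq.restrict
    have hle : ∫ x in ball p ρ, energy u x ≤
        ∫ x in ball p ρ, ∑ k, (m : ℝ) * (m * K' ^ 2 * ∑ i, X k i x ^ 2) := by
      refine integral_mono_ae ((integrable_energy hu).mono_measure (hmono ρ (by linarith)))
        (integrable_finsetSum _ fun k _ => ((integrable_finsetSum _ fun i _ =>
          hi k i).const_mul _).const_mul _) ?_
      filter_upwards [ae_mono (hmono ρ (by linarith)) hK', ae_mono (hmono ρ (by linarith)) hA_unit,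
        ae_restrict_mem measurableSet_ball] with x hx hxu hxb
      have hxD : x ∈ D2 := (ball_subset_ball (by linarith : ρ ≤ s)).trans (ball_subset_D2' hps) hxb
      refine Finset.sum_le_sum fun k _ => ?_
      have hj : ∀ j ∈ Finset.univ, vecGrad u k x j ^ 2 ≤ m * K' ^ 2 * ∑ i, X k i x ^ 2 := by
        intro j _
        have h1 := sq_mulVec_le hx (A x *ᵥ vecGrad u k x) j
        rw [Matrix.mulVec_mulVec, Matrix.nonsing_inv_mul _ ((Matrix.isUnit_iff_isUnit_det _).1 hxu),
          Matrix.one_mulVec] at h1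
        simpa [hX, hxD] using h1
      refine (Finset.sum_le_card_nsmul _ _ _ hj).trans (le_of_eq ?_)
      simp
    refine hle.trans ?_
    rw [integral_finsetSum _ fun k _ => ((integrable_finsetSum _ fun i _ =>
          hi k i).const_mul _).const_mul _]
    have hk : ∀ k ∈ (Finset.univ : Finset (Fin 2)),
        ∫ x in ball p ρ, (m : ℝ) * (m * K' ^ 2 * ∑ i, X k i x ^ 2) ≤
          m * (m * K' ^ 2 * (m * Q ^ 2)) := by
      intro k _
      rw [integral_const_mul, integral_const_mul, integral_finsetSum _ fun i _ => hi k i]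
      gcongr
      refine (Finset.sum_le_card_nsmul _ _ (Q ^ 2) fun i _ => ?_).trans (le_of_eq (by simp))
      exact (Real.sqrt_le_left hQ0).1 (hXQ k i)
    refine (Finset.sum_le_card_nsmul _ _ _ hk).trans (le_of_eq ?_)
    simp
    ring
  have hfin : √(∫ x in ball p ρ, energy u x) ≤ C₃ * Q := by
    refine (Real.sqrt_le_sqrt hE).trans (le_of_eq ?_)
    rw [Real.sqrt_mul (by positivity), Real.sqrt_sq hQ0]
  have hS0 : 0 ≤ S := Real.sqrt_nonneg _
  have hs0 : 0 < s := by linarith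
  have hρr : ρ / r = 2 * (ρ / s) := by rw [hr]; field_simp
  have hQle : Q ≤ C₂ * (ρ / s + δ) * S := by
    have h1 : 0 ≤ ρ / s := by positivity
    have h2 : 0 ≤ 2 * C₁ * √(m * K ^ 2) := by positivity
    have h3 : 0 ≤ C₁ * (C₀ * m) := by positivity
    have : Q = (2 * C₁ * √(m * K ^ 2) * (ρ / s) + C₁ * (C₀ * m) * δ) * S := by
      rw [hQ, hM, hρr]; ring
    rw [this, hC₂]
    refine mul_le_mul_of_nonneg_right ?_ hS0
    nlinarith [mul_nonneg h2 hδ, mul_nonneg h3 h1]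
  have hC₃0 : 0 ≤ C₃ := Real.sqrt_nonneg _
  calc √(∫ x in ball p ρ, energy u x) ≤ C₃ * (C₂ * (ρ / s + δ) * S) :=
        hfin.trans (mul_le_mul_of_nonneg_left hQle hC₃0)
    _ ≤ (C₃ * C₂ + 1) * (ρ / s + δ) * S := by
        have : 0 ≤ (ρ / s + δ) * S := by positivity
        nlinarith

end DecayStep

/-! ### Iteration of the decay step. -/

section Decay

/-- Iterate along the radii `θⁿ s₁` and fill the gaps by monotonicity; rounding `ρ` up to such a
radius costs one factor `θ`, whence the denominator `θ s₁`. -/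
theorem le_rpow_mul_of_decay_step {F : ℝ → ℝ} {θ α s₁ T : ℝ} (hθ : 0 < θ) (hθ1 : θ < 1)
    (hα : 0 < α) (hs₁ : 0 < s₁) (hF : Monotone F) (hT0 : 0 ≤ T) (hT : ∀ s, F s ≤ T)
    (hstep : ∀ s, 0 < s → s ≤ s₁ → F (θ * s) ≤ θ ^ α * F s) {ρ : ℝ} (hρ : 0 < ρ) :
    F ρ ≤ (ρ / (θ * s₁)) ^ α * T := by
  rcases le_or_gt s₁ ρ with h | h
  · have h1 : 1 ≤ ρ / (θ * s₁) := by
      rw [one_le_div (by positivity)]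
      nlinarith
    calc F ρ ≤ 1 * T := by simpa using hT ρ
      _ ≤ (ρ / (θ * s₁)) ^ α * T :=
        mul_le_mul_of_nonneg_right (Real.one_le_rpow h1 hα.le) hT0
  · have hiter : ∀ n : ℕ, F (θ ^ n * s₁) ≤ (θ ^ n) ^ α * T := by
      intro n
      induction n with
      | zero => simpa using hT s₁
      | succ n ih =>
        have hle : θ ^ n * s₁ ≤ s₁ := by
          have : θ ^ n ≤ 1 := pow_le_one₀ hθ.le hθ1.le
          nlinarith
        have h1 := hstep (θ ^ n * s₁) (by positivity) hle
        calc F (θ ^ (n + 1) * s₁) = F (θ * (θ ^ n * s₁)) := by congr 1; ring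
          _ ≤ θ ^ α * ((θ ^ n) ^ α * T) :=
            h1.trans (mul_le_mul_of_nonneg_left ih (by positivity))
          _ = (θ ^ (n + 1)) ^ α * T := by
            rw [← mul_assoc, ← Real.mul_rpow hθ.le (by positivity), pow_succ']
    obtain ⟨n, hn1, hn2⟩ := exists_nat_pow_near_of_lt_one (x := ρ / s₁) (by positivity)
      ((div_le_one hs₁).2 h.le) hθ hθ1
    have h1 : ρ ≤ θ ^ n * s₁ := by rwa [div_le_iff₀ hs₁] at hn2
    have h2 : θ ^ n ≤ ρ / (θ * s₁) := by
      rw [lt_div_iff₀ hs₁] at hn1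
      rw [le_div_iff₀ (by positivity)]
      calc θ ^ n * (θ * s₁) = θ ^ (n + 1) * s₁ := by ring
        _ ≤ ρ := hn1.le
    calc F ρ ≤ (θ ^ n) ^ α * T := (hF h1).trans (hiter n)
      _ ≤ (ρ / (θ * s₁)) ^ α * T := mul_le_mul_of_nonneg_right
        (Real.rpow_le_rpow (by positivity) h2 hα.le) hT0

theorem setIntegral_ball_indicator {f : Plane → ℝ} {p : Plane} {s : ℝ} (hps : ‖p‖ + s < 1) :
    ∫ x in ball p s, D2.indicator f x = ∫ x in ball p s, f x :=
  setIntegral_congr_fun measurableSet_ball fun x hx => by simp [ball_subset_D2' hps hx]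

variable {m : ℕ} {A B : Plane → Matrix (Fin m) (Fin m) ℝ} {u : Plane → EuclideanSpace ℝ (Fin m)}

theorem exists_radius_matGrad_small (hA : MatW12 A) {δ : ℝ} (hδ : 0 < δ) :
    ∃ s₀ : ℝ, 0 < s₀ ∧ ∀ p s, s < s₀ → ‖p‖ + s < 1 → ∀ i j,
      √(∫ x in ball p s, (matGrad A 0 x i j ^ 2 + matGrad A 1 x i j ^ 2)) ≤ δ := by
  set e : Plane → ℝ := fun x => ∑ i, ∑ j, (matGrad A 0 x i j ^ 2 + matGrad A 1 x i j ^ 2) with he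
  have hi : ∀ i j, Integrable (fun x => matGrad A 0 x i j ^ 2 + matGrad A 1 x i j ^ 2)
      (volume.restrict D2) := fun i j =>
    ((hA.sob i j).memLp_grad 0).integrable_sq.add ((hA.sob i j).memLp_grad 1).integrable_sq
  have hei : Integrable e (volume.restrict D2) :=
    integrable_finsetSum _ fun i _ => integrable_finsetSum _ fun j _ => hi i j
  obtain ⟨s₀, hs₀, h⟩ := exists_radius_setIntegral_lt
    ((integrable_indicator_iff measurableSet_D2).2 hei) (fun x => Set.indicator_nonneg
      (fun x _ => Finset.sum_nonneg fun i _ => Finset.sum_nonneg fun j _ => by positivity) x)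
    (pow_pos hδ 2)
  refine ⟨s₀, hs₀, fun p s hs hps i j => ?_⟩
  have h1 := h p s hs
  rw [setIntegral_ball_indicator hps] at h1
  rw [Real.sqrt_le_left hδ.le]
  refine le_trans ?_ h1.le
  have hr : volume.restrict (ball p s) ≤ volume.restrict D2 :=
    Measure.restrict_mono (ball_subset_D2' hps) le_rfl
  refine integral_mono ((hi i j).mono_measure hr) (hei.mono_measure hr) fun x => ?_
  refine le_trans ?_ (Finset.single_le_sum (f := fun i => ∑ j, (matGrad A 0 x i j ^ 2 +
    matGrad A 1 x i j ^ 2)) (fun i _ => Finset.sum_nonneg fun j _ => by positivity)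
    (Finset.mem_univ i))
  exact Finset.single_le_sum (f := fun j => matGrad A 0 x i j ^ 2 + matGrad A 1 x i j ^ 2)
    (fun j _ => by positivity) (Finset.mem_univ j)

/-- The Dirichlet energy of a solution decays like every power less than two of the radius. -/
theorem exists_energy_decay (hA : MatW12 A) (hB : MatW12 B) (hu : VecW12 u)
    (hA_unit : ∀ᵐ x ∂volume.restrict D2, IsUnit (A x)) (hA_bdd : MatMemLp ⊤ A)
    (hA_inv_bdd : MatMemLp ⊤ fun x => (A x)⁻¹) (hcons : ConservationLaw A B u) {α R : ℝ}
    (hα : 0 < α) (hα1 : α < 1) (hR : R < 1) :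
    ∃ C : ℝ, 0 ≤ C ∧ ∀ p : Plane, ‖p‖ ≤ R → ∀ ρ : ℝ, 0 < ρ →
      √(∫ x in ball p ρ, D2.indicator (energy u) x) ≤ C * ρ ^ α := by
  obtain ⟨C, hC, hstep⟩ := exists_decay_step hA hB hu hA_unit hA_bdd hA_inv_bdd hcons
  -- As `α < 1`, a small `θ` satisfies `Cθ ≤ θ^α/2`. With `δ` chosen so that `Cδ = θ^α/2`, the
  -- factor `C(θ + δ)` of the decay step is at most `θ^α`. The bound `1/16` is the ratio of radii
  -- which that step requires.
  set θ := min (1 / 16) ((2 * C)⁻¹ ^ (1 / (1 - α))) with hθ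
  have hθ0 : 0 < θ := lt_min (by norm_num) (by positivity)
  have hθ16 : θ ≤ 1 / 16 := min_le_left _ _
  have hα' : 0 < 1 - α := by linarith
  have hθC : C * θ ≤ θ ^ α / 2 := by
    have h1 : θ ^ (1 - α) ≤ (2 * C)⁻¹ := by
      calc θ ^ (1 - α) ≤ ((2 * C)⁻¹ ^ (1 / (1 - α))) ^ (1 - α) :=
            Real.rpow_le_rpow hθ0.le (min_le_right _ _) hα'.le
        _ = (2 * C)⁻¹ := by
            rw [← Real.rpow_mul (by positivity), one_div, inv_mul_cancel₀ hα'.ne', Real.rpow_one]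
    have h2 : θ = θ ^ (1 - α) * θ ^ α := by
      rw [← Real.rpow_add hθ0]; simp
    have h3 : 0 < θ ^ α := by positivity
    calc C * θ = C * (θ ^ (1 - α) * θ ^ α) := by rw [← h2]
      _ ≤ C * ((2 * C)⁻¹ * θ ^ α) := by gcongr
      _ = θ ^ α / 2 := by field_simp
  set δ := θ ^ α / (2 * C) with hδ
  have hδ0 : 0 < δ := by positivity
  have hδC : C * δ = θ ^ α / 2 := by rw [hδ]; field_simp
  obtain ⟨sA, hsA, hAs⟩ := exists_radius_matGrad_small hA hδ0
  obtain ⟨sB, hsB, hBs⟩ := exists_radius_matGrad_small hB hδ0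
  -- The halving makes all three inequalities strict: small gradients of `A` and `B`, and balls
  -- inside the disk for centres of norm at most `R`.
  set s₁ := min (min sA sB) (1 - R) / 2 with hs₁
  have hm0 : 0 < min (min sA sB) (1 - R) := lt_min (lt_min hsA hsB) (by linarith)
  have hs₁0 : 0 < s₁ := by positivity
  have hs₁A : s₁ < sA := by
    have := (min_le_left (min sA sB) (1 - R)).trans (min_le_left _ _); linarith
  have hs₁B : s₁ < sB := by
    have := (min_le_left (min sA sB) (1 - R)).trans (min_le_right _ _); linarith
  have hs₁R : s₁ < 1 - R := by
    have := min_le_right (min sA sB) (1 - R); linarith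
  have hei : Integrable (D2.indicator (energy u)) :=
    (integrable_indicator_iff measurableSet_D2).2 (integrable_energy hu)
  have he0 : ∀ x, 0 ≤ D2.indicator (energy u) x := fun x =>
    Set.indicator_nonneg (fun x _ => energy_nonneg u x) x
  set T := √(∫ x, D2.indicator (energy u) x) with hT
  refine ⟨T / (θ * s₁) ^ α, by positivity, fun p hp ρ hρ => ?_⟩
  have hmain := le_rpow_mul_of_decay_step (F := fun s => √(∫ x in ball p s, D2.indicator (energy u) x))
    (T := T) hθ0 (by linarith) hα hs₁0 (fun s t hst => ?_) (Real.sqrt_nonneg _) (fun s => ?_)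
    (fun s hs hss => ?_) hρ
  · refine hmain.trans (le_of_eq ?_)
    rw [Real.div_rpow hρ.le (by positivity)]
    ring
  · exact Real.sqrt_le_sqrt (setIntegral_mono_set hei.integrableOn (ae_of_all _ he0)
      (ball_subset_ball hst).eventuallyLE)
  · exact Real.sqrt_le_sqrt (setIntegral_le_integral hei (ae_of_all _ he0))
  · have hps : ‖p‖ + s < 1 := by linarith
    have hθs : θ * s ≤ s := by nlinarith
    rw [setIntegral_ball_indicator hps, setIntegral_ball_indicator (by linarith : ‖p‖ + θ * s < 1)]
    refine (hstep p s (θ * s) δ (by positivity) (by nlinarith) hps hδ0.le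
      (hAs p s (by linarith) hps) (hBs p s (by linarith) hps)).trans ?_
    have : θ * s / s = θ := by field_simp
    rw [this]
    refine mul_le_mul_of_nonneg_right ?_ (Real.sqrt_nonneg _)
    rw [mul_add, hδC]
    linarith

end Decay

/-! ### Riesz and logarithmic potentials of Morrey densities. -/

section RieszPotential

/-- The Riesz potential of order `-β` of a measure with Morrey growth of order `α > β` is bounded. -/
theorem lintegral_rpow_neg_le {ν : Measure Plane} {x : Plane} {C α β : ℝ} (hβ : 0 < β)
    (hν : ∀ ρ, 0 < ρ → ν (ball x ρ) ≤ ENNReal.ofReal (C * ρ ^ α)) :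
    ∫⁻ y, ENNReal.ofReal (‖x - y‖ ^ (-β)) ∂ν ≤
      ν Set.univ + ∑' n : ℕ, ENNReal.ofReal (C * 2 ^ (α + β) * ((1 / 2 : ℝ) ^ (α - β)) ^ n) := by
  set a : ℕ → ℝ := fun n => (1 / 2) ^ n with ha
  have ha0 : ∀ n, 0 < a n := fun n => by simp only [ha]; positivity
  -- A dyadic decomposition: a point at distance below one lies in some annulus `2⁻ⁿ⁻¹ < |x - y| ≤
  -- 2⁻ⁿ`, and the ball of twice the outer radius contains it.
  have hpt : ∀ y, ENNReal.ofReal (‖x - y‖ ^ (-β)) ≤ 1 + ∑' n : ℕ,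
      (ball x (2 * a n)).indicator (fun _ => ENNReal.ofReal ((a n / 2) ^ (-β))) y := by
    intro y
    -- At `y = x` the convention `0 ^ (-β) = 0` makes the bound trivial.
    rcases eq_or_lt_of_le (norm_nonneg (x - y)) with h0 | h0
    · rw [← h0, Real.zero_rpow (by linarith)]
      simp
    rcases le_or_gt 1 ‖x - y‖ with h1 | h1
    · refine le_trans ?_ le_self_add
      rw [← ENNReal.ofReal_one]
      exact ENNReal.ofReal_le_ofReal (Real.rpow_le_one_of_one_le_of_nonpos h1 (by linarith))
    · obtain ⟨n, hn1, hn2⟩ := exists_nat_pow_near_of_lt_one h0 h1.le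
        (by norm_num : (0 : ℝ) < 1 / 2) (by norm_num)
      refine le_trans ?_ le_add_self
      refine le_trans ?_ (ENNReal.le_tsum n)
      have hmem : y ∈ ball x (2 * a n) := by
        rw [mem_ball, dist_comm, dist_eq_norm]
        have := ha0 n
        simp only [ha] at this ⊢
        linarith
      rw [Set.indicator_of_mem hmem]
      refine ENNReal.ofReal_le_ofReal (Real.rpow_le_rpow_of_nonpos ?_ ?_ (by linarith))
      · have := ha0 n; positivity
      · simp only [ha]
        rw [pow_succ] at hn1
        linarith
  refine (lintegral_mono hpt).trans ?_
  rw [lintegral_add_left measurable_const, lintegral_one]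
  gcongr
  rw [lintegral_tsum fun n => (measurable_const.indicator measurableSet_ball).aemeasurable]
  refine ENNReal.tsum_le_tsum fun n => ?_
  rw [lintegral_indicator_const measurableSet_ball]
  refine (mul_le_mul_right (hν _ (by have := ha0 n; positivity)) _).trans ?_
  rw [← ENNReal.ofReal_mul (by have := ha0 n; positivity)]
  refine ENNReal.ofReal_le_ofReal (le_of_eq ?_)
  have h0 := ha0 n
  have e1 : (a n / 2) ^ (-β) = a n ^ (-β) * 2 ^ β := by
    rw [Real.div_rpow h0.le (by norm_num), Real.rpow_neg (by norm_num : (0 : ℝ) ≤ 2),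
      div_inv_eq_mul]
  have e2 : ((1 / 2 : ℝ) ^ (α - β)) ^ n = a n ^ α * a n ^ (-β) := by
    rw [← Real.rpow_add h0, ← sub_eq_add_neg, ← Real.rpow_natCast, ← Real.rpow_mul (by norm_num),
      mul_comm, Real.rpow_mul (by norm_num), Real.rpow_natCast]
  rw [e1, e2, Real.mul_rpow (by norm_num) h0.le, Real.rpow_add (by norm_num)]
  ring

/-- The Riesz potentials of all orders below `α` are bounded, uniformly on the set of centers. -/
theorem exists_lintegral_rpow_neg_le {ν : Measure Plane} [IsFiniteMeasure ν] {S : Set Plane}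
    {C α β : ℝ} (hβ : 0 < β) (hβα : β < α)
    (hν : ∀ x ∈ S, ∀ ρ, 0 < ρ → ν (ball x ρ) ≤ ENNReal.ofReal (C * ρ ^ α)) :
    ∃ K : ℝ, 0 ≤ K ∧ ∀ x ∈ S, ∫⁻ y, ENNReal.ofReal (‖x - y‖ ^ (-β)) ∂ν ≤ ENNReal.ofReal K := by
  have hfin : ν Set.univ + ∑' n : ℕ, ENNReal.ofReal (C * 2 ^ (α + β) *
      ((1 / 2 : ℝ) ^ (α - β)) ^ n) ≠ ⊤ := by
    refine ENNReal.add_ne_top.2 ⟨measure_ne_top _ _, ?_⟩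
    have hs : Summable fun n : ℕ => C * 2 ^ (α + β) * ((1 / 2 : ℝ) ^ (α - β)) ^ n :=
      (summable_geometric_of_lt_one (by positivity)
        (Real.rpow_lt_one (by norm_num) (by norm_num) (by linarith))).mul_left _
    exact hs.tsum_ofReal_ne_top
  refine ⟨(ν Set.univ + ∑' n : ℕ, ENNReal.ofReal (C * 2 ^ (α + β) *
      ((1 / 2 : ℝ) ^ (α - β)) ^ n)).toReal, ENNReal.toReal_nonneg, fun x hx => ?_⟩
  rw [ENNReal.ofReal_toReal hfin]
  exact lintegral_rpow_neg_le hβ (hν x hx)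

/-- With `t = (b - a)/a`, subadditivity of the power gives `β log(1 + t) ≤ log(1 + t^β) ≤ t^β`. -/
theorem log_sub_log_le {a b β : ℝ} (hβ : 0 < β) (hβ1 : β ≤ 1) (ha : 0 < a) (hab : a ≤ b) :
    Real.log b - Real.log a ≤ (b - a) ^ β / β * a ^ (-β) := by
  have hb : 0 < b := ha.trans_le hab
  set t := (b - a) / a with ht
  have ht0 : 0 ≤ t := div_nonneg (by linarith) ha.le
  have h1 : Real.log b - Real.log a = Real.log (1 + t) := by
    rw [← Real.log_div hb.ne' ha.ne']
    congr 1
    rw [ht]; field_simp; ring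
  have h2 : β * Real.log (1 + t) ≤ t ^ β := by
    rw [← Real.log_rpow (by linarith)]
    calc Real.log ((1 + t) ^ β) ≤ Real.log (1 + t ^ β) := by
          refine Real.log_le_log (by positivity) ?_
          simpa using Real.rpow_add_le_add_rpow zero_le_one ht0 hβ.le hβ1
      _ ≤ t ^ β := by
          have := Real.log_le_sub_one_of_pos (by positivity : 0 < 1 + t ^ β)
          linarith
  have h3 : t ^ β = (b - a) ^ β * a ^ (-β) := by
    rw [ht, Real.div_rpow (by linarith) ha.le, Real.rpow_neg ha.le, div_eq_mul_inv]
  rw [h1, div_mul_eq_mul_div, le_div_iff₀ hβ, ← h3]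
  linarith

theorem abs_log_sub_log_le {a b β : ℝ} (hβ : 0 < β) (hβ1 : β ≤ 1) (ha : 0 < a) (hb : 0 < b) :
    |Real.log a - Real.log b| ≤ |a - b| ^ β / β * (a ^ (-β) + b ^ (-β)) := by
  have hpos : 0 ≤ |a - b| ^ β / β := by positivity
  have ha' : 0 ≤ a ^ (-β) := by positivity
  have hb' : 0 ≤ b ^ (-β) := by positivity
  rcases le_total a b with h | h
  · rw [abs_sub_comm, abs_of_nonneg (sub_nonneg.2 (Real.log_le_log ha h))]
    have := log_sub_log_le hβ hβ1 ha h
    rw [abs_sub_comm, abs_of_nonneg (by linarith : 0 ≤ b - a)] at *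
    nlinarith
  · rw [abs_of_nonneg (sub_nonneg.2 (Real.log_le_log hb h))]
    have := log_sub_log_le hβ hβ1 hb h
    rw [abs_of_nonneg (by linarith : 0 ≤ a - b)] at *
    nlinarith

/-- Integrable functions whose masses on balls centered in `S` satisfy Morrey bounds of all orders
less than one. -/
structure MorreyDensity (S : Set Plane) (g : Plane → ℝ) : Prop where
  integrable : Integrable g
  eq_zero : ∀ x ∉ D2, g x = 0
  decay : ∀ α : ℝ, 0 < α → α < 1 → ∃ C : ℝ, ∀ x ∈ S, ∀ ρ, 0 < ρ → ∫ y in ball x ρ, |g y| ≤ C * ρ ^ α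

/-- The measure `|g| dx`. -/
noncomputable def absMeasure (g : Plane → ℝ) : Measure Plane :=
  volume.withDensity fun y => ENNReal.ofReal |g y|

theorem absMeasure_apply {g : Plane → ℝ} (hg : Integrable g) {s : Set Plane}
    (hs : MeasurableSet s) : absMeasure g s = ENNReal.ofReal (∫ y in s, |g y|) := by
  rw [absMeasure, withDensity_apply _ hs,
    ofReal_integral_eq_lintegral_ofReal hg.abs.restrict (ae_of_all _ fun _ => abs_nonneg _)]

theorem isFiniteMeasure_absMeasure {g : Plane → ℝ} (hg : Integrable g) :
    IsFiniteMeasure (absMeasure g) :=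
  ⟨by rw [absMeasure_apply hg MeasurableSet.univ]; exact ENNReal.ofReal_lt_top⟩

theorem lintegral_absMeasure {g : Plane → ℝ} (hg : Integrable g) {f : Plane → ℝ} (hf : Measurable f)
    (hf0 : ∀ y, 0 ≤ f y) :
    ∫⁻ y, ENNReal.ofReal (f y) ∂absMeasure g = ∫⁻ y, ENNReal.ofReal (f y * |g y|) := by
  rw [absMeasure, lintegral_withDensity_eq_lintegral_mul₀
    hg.abs.1.aemeasurable.ennreal_ofReal hf.ennreal_ofReal.aemeasurable]
  refine lintegral_congr fun y => ?_
  rw [Pi.mul_apply, mul_comm, ENNReal.ofReal_mul (hf0 y)]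

theorem measurable_riesz (x : Plane) (β : ℝ) : Measurable fun y : Plane => ‖x - y‖ ^ β :=
  (measurable_const.sub measurable_id).norm.pow_const β

variable {S : Set Plane} {g : Plane → ℝ}

theorem MorreyDensity.exists_lintegral_le (h : MorreyDensity S g) {β : ℝ} (hβ : 0 < β)
    (hβ1 : β < 1) : ∃ K : ℝ, 0 ≤ K ∧ ∀ x ∈ S,
      ∫⁻ y, ENNReal.ofReal (‖x - y‖ ^ (-β)) ∂absMeasure g ≤ ENNReal.ofReal K := by
  -- Any order strictly between `β` and one would do.
  obtain ⟨C, hC⟩ := h.decay ((β + 1) / 2) (by linarith) (by linarith)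
  have := isFiniteMeasure_absMeasure h.integrable
  refine exists_lintegral_rpow_neg_le (C := C) hβ (by linarith : β < (β + 1) / 2) fun x hx ρ hρ => ?_
  rw [absMeasure_apply h.integrable measurableSet_ball]
  exact ENNReal.ofReal_le_ofReal (hC x hx ρ hρ)

theorem MorreyDensity.exists_integral_le (h : MorreyDensity S g) {β : ℝ} (hβ : 0 < β)
    (hβ1 : β < 1) : ∃ K : ℝ, 0 ≤ K ∧ ∀ x ∈ S, Integrable (fun y => ‖x - y‖ ^ (-β) * |g y|) ∧
      ∫ y, ‖x - y‖ ^ (-β) * |g y| ≤ K := by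
  obtain ⟨K, hK0, hK⟩ := h.exists_lintegral_le hβ hβ1
  refine ⟨K, hK0, fun x hx => ?_⟩
  have h1 := hK x hx
  rw [lintegral_absMeasure h.integrable (measurable_riesz x _) fun y => by positivity] at h1
  have hm : AEStronglyMeasurable fun y => ‖x - y‖ ^ (-β) * |g y| :=
    (measurable_riesz x _).aestronglyMeasurable.mul h.integrable.abs.1
  have h0 : ∀ y, 0 ≤ ‖x - y‖ ^ (-β) * |g y| := fun y => by positivity
  refine ⟨⟨hm, ?_⟩, ?_⟩
  · rw [hasFiniteIntegral_iff_ofReal (ae_of_all _ h0)]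
    exact h1.trans_lt ENNReal.ofReal_lt_top
  · rw [integral_eq_lintegral_of_nonneg_ae (ae_of_all _ h0) hm]
    exact ENNReal.toReal_le_of_le_ofReal hK0 h1

/-- The logarithmic potential. -/
noncomputable def logPot (g : Plane → ℝ) (x : Plane) : ℝ := ∫ y, Real.log ‖x - y‖ * g y

theorem MorreyDensity.integrable_log (h : MorreyDensity S g) (hS : S ⊆ D2) {x : Plane}
    (hx : x ∈ S) : Integrable fun y => Real.log ‖x - y‖ * g y := by
  obtain ⟨K, hK0, hK⟩ := h.exists_integral_le (β := 1 / 2) (by norm_num) (by norm_num)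
  have hdom : Integrable fun y => 2 * (‖x - y‖ ^ (-(1 / 2) : ℝ) * |g y| + |g y|) :=
    ((hK x hx).1.add h.integrable.abs).const_mul 2
  refine hdom.mono' ((Real.measurable_log.comp
    (measurable_const.sub measurable_id).norm).aestronglyMeasurable.mul h.integrable.1) ?_
  refine ae_of_all _ fun y => ?_
  by_cases hy : y ∈ D2
  · rw [Real.norm_eq_abs, abs_mul]
    have hle : ‖x - y‖ ≤ 2 := by
      have h1 := hS hx
      rw [D2, mem_ball_zero_iff] at h1 hy
      exact (norm_sub_le _ _).trans (by linarith)
    rcases eq_or_lt_of_le (norm_nonneg (x - y)) with h0 | h0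
    · rw [← h0, Real.log_zero, abs_zero, zero_mul]
      positivity
    -- Comparison with `log 1 = 0` bounds the logarithm; distances in the disk are at most two, so
    -- the numerator is at most one.
    have h2 := abs_log_sub_log_le (β := 1 / 2) (by norm_num) (by norm_num) h0 one_pos
    have h3 : |‖x - y‖ - 1| ^ (1 / 2 : ℝ) ≤ 1 := by
      refine Real.rpow_le_one (abs_nonneg _) ?_ (by norm_num)
      rw [abs_le]
      constructor <;> linarith
    have h4 : 0 ≤ ‖x - y‖ ^ (-(1 / 2) : ℝ) := by positivity
    simp only [Real.log_one, sub_zero, Real.one_rpow] at h2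
    calc |Real.log ‖x - y‖| * |g y|
        ≤ (|‖x - y‖ - 1| ^ (1 / 2 : ℝ) / (1 / 2) * (‖x - y‖ ^ (-(1 / 2) : ℝ) + 1)) * |g y| := by
          gcongr
      _ ≤ (1 / (1 / 2) * (‖x - y‖ ^ (-(1 / 2) : ℝ) + 1)) * |g y| := by gcongr
      _ = 2 * (‖x - y‖ ^ (-(1 / 2) : ℝ) * |g y| + |g y|) := by ring
  · simp [h.eq_zero y hy]

theorem ae_ne_plane (x : Plane) : ∀ᵐ y : Plane, 0 < ‖x - y‖ := by
  have h : ∀ᵐ y : Plane, y ≠ x := by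
    rw [ae_iff]
    simp
  filter_upwards [h] with y hy
  exact norm_pos_iff.2 (sub_ne_zero.2 hy.symm)

/-- The difference of logarithms is at most `|x - x'|^β/β` times the sum of the two Riesz kernels of
order `-β`, and these have bounded potentials for `β < 1`. -/
theorem MorreyDensity.exists_holder (h : MorreyDensity S g) (hS : S ⊆ D2) {β : ℝ} (hβ : 0 < β)
    (hβ1 : β < 1) : ∃ K : ℝ, 0 ≤ K ∧ ∀ x ∈ S, ∀ x' ∈ S,
      |logPot g x - logPot g x'| ≤ K * ‖x - x'‖ ^ β := by
  obtain ⟨K, hK0, hK⟩ := h.exists_integral_le hβ hβ1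
  refine ⟨2 * K / β, by positivity, fun x hx x' hx' => ?_⟩
  rw [logPot, logPot, ← integral_sub (h.integrable_log hS hx) (h.integrable_log hS hx')]
  obtain ⟨i1, k1⟩ := hK x hx
  obtain ⟨i2, k2⟩ := hK x' hx'
  have i3 : Integrable fun y => ‖x - x'‖ ^ β / β *
      (‖x - y‖ ^ (-β) * |g y| + ‖x' - y‖ ^ (-β) * |g y|) := (i1.add i2).const_mul _
  rw [← Real.norm_eq_abs]
  refine (norm_integral_le_of_norm_le i3 ?_).trans ?_
  · filter_upwards [ae_ne_plane x, ae_ne_plane x'] with y hy hy'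
    rw [← sub_mul, Real.norm_eq_abs, abs_mul]
    have h1 := abs_log_sub_log_le hβ hβ1.le hy hy'
    have h2 : |‖x - y‖ - ‖x' - y‖| ≤ ‖x - x'‖ := by
      refine (abs_norm_sub_norm_le _ _).trans (le_of_eq ?_)
      congr 1
      abel
    calc |Real.log ‖x - y‖ - Real.log ‖x' - y‖| * |g y|
        ≤ (|‖x - y‖ - ‖x' - y‖| ^ β / β * (‖x - y‖ ^ (-β) + ‖x' - y‖ ^ (-β))) * |g y| := by gcongr
      _ ≤ (‖x - x'‖ ^ β / β * (‖x - y‖ ^ (-β) + ‖x' - y‖ ^ (-β))) * |g y| := by gcongr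
      _ = _ := by ring
  · rw [integral_const_mul, integral_add i1 i2]
    have : 0 ≤ ‖x - x'‖ ^ β / β := by positivity
    calc ‖x - x'‖ ^ β / β * (_ + _) ≤ ‖x - x'‖ ^ β / β * (K + K) := by gcongr
      _ = 2 * K / β * ‖x - x'‖ ^ β := by ring

end RieszPotential

/-! ### Representation of a function by the potential of its Laplacian. -/

section Representation

theorem integrable_riesz_kernel {s : ℝ} (hs : s < 2) :
    Integrable ((ball (0 : Plane) 2).indicator fun z => ‖z‖ ^ (-s)) := by
  rw [integrable_indicator_iff measurableSet_ball]
  refine (integrableOn_fun_norm_addHaar volume (f := fun t : ℝ => t ^ (-s))).2 ?_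
  have h := (intervalIntegral.integrableOn_Ioo_rpow_iff (s := 1 - s) (by norm_num : (0 : ℝ) < 2)).2
    (by linarith)
  refine h.congr_fun (fun t ht => ?_) measurableSet_Ioo
  simp only [finrank_euclideanSpace, Fintype.card_fin, smul_eq_mul]
  rw [sub_eq_add_neg, Real.rpow_add ht.1]
  simp

/-- Passage to the limit in a double integral against kernels with a common integrable bound. -/
theorem tendsto_integral_kernel {κ : ℕ → Plane → ℝ} {κ' g φ : Plane → ℝ} {C : ℝ}
    (hκ : ∀ n, Measurable (κ n)) (hκ' : Measurable κ')
    (hb : ∀ n z, z ≠ 0 → ‖z‖ < 2 → |κ n z| ≤ C * ‖z‖⁻¹)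
    (hb' : ∀ z, z ≠ 0 → ‖z‖ < 2 → |κ' z| ≤ C * ‖z‖⁻¹)
    (hlim : ∀ z, z ≠ 0 → Tendsto (fun n => κ n z) atTop (𝓝 (κ' z)))
    (hg : Integrable g) (hg0 : ∀ x ∉ D2, g x = 0) (hφ : IsTestFunction D2 φ) :
    Tendsto (fun n => ∫ y, g y * ∫ x, κ n (x - y) * φ x) atTop
      (𝓝 (∫ x, φ x * ∫ y, κ' (x - y) * g y)) := by
  obtain ⟨M, hM0, hM⟩ := exists_abs_le_of_hasCompactSupport hφ.1.continuous hφ.2.1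
  -- A convolution integrand of two integrable functions. Truncating the kernel at `2` loses nothing
  -- because both variables range over the unit disk.
  set D : Plane × Plane → ℝ := fun p =>
    C * M * (|g p.2| * (ball (0 : Plane) 2).indicator (fun z => ‖z‖ ^ (-(1 : ℝ))) (p.1 - p.2))
    with hD
  have hDi : Integrable D (volume.prod volume) :=
    (hg.abs.convolution_integrand (ContinuousLinearMap.mul ℝ ℝ)
      (integrable_riesz_kernel (by norm_num : (1 : ℝ) < 2))).const_mul _
  have hne : ∀ᵐ p : Plane × Plane ∂(volume.prod volume), p.1 - p.2 ≠ 0 := by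
    have h0 : ∀ᵐ z : Plane, z ≠ 0 := by
      rw [ae_iff]
      simp
    exact (quasiMeasurePreserving_sub_of_right_invariant volume volume).ae h0
  have hbound : ∀ k : Plane → ℝ, (∀ z, z ≠ 0 → ‖z‖ < 2 → |k z| ≤ C * ‖z‖⁻¹) →
      ∀ᵐ p : Plane × Plane ∂(volume.prod volume),
        ‖g p.2 * (k (p.1 - p.2) * φ p.1)‖ ≤ D p := by
    intro k hk
    filter_upwards [hne] with p hp
    by_cases h2 : p.2 ∈ D2
    · by_cases h1 : p.1 ∈ D2
      · have hlt : ‖p.1 - p.2‖ < 2 := by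
          rw [D2, mem_ball_zero_iff] at h1 h2
          exact (norm_sub_le _ _).trans_lt (by linarith)
        have hmem : p.1 - p.2 ∈ ball (0 : Plane) 2 := mem_ball_zero_iff.2 hlt
        have hC := (abs_nonneg _).trans (hk _ hp hlt)
        rw [hD, Real.norm_eq_abs, abs_mul, abs_mul]
        simp only
        rw [Set.indicator_of_mem hmem, Real.rpow_neg_one]
        calc |g p.2| * (|k (p.1 - p.2)| * |φ p.1|)
            ≤ |g p.2| * (C * ‖p.1 - p.2‖⁻¹ * M) := by
              gcongr
              · exact hk _ hp hlt
              · exact hM _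
          _ = _ := by ring
      · have hC : 0 ≤ C := by
          -- The sign of `C` is read off from the kernel bound at a unit vector.
          have := (abs_nonneg _).trans (hk (EuclideanSpace.single 0 1) (by simp) (by simp))
          simpa using this
        rw [hφ.eq_zero h1]
        simp only [mul_zero, norm_zero, hD]
        have : 0 ≤ (ball (0 : Plane) 2).indicator (fun z => ‖z‖ ^ (-(1 : ℝ))) (p.1 - p.2) :=
          Set.indicator_nonneg (fun z _ => by positivity) _
        positivity
    · simp [hg0 _ h2, hD]
  have hmeas : ∀ k : Plane → ℝ, Measurable k →
      AEStronglyMeasurable (fun p : Plane × Plane => g p.2 * (k (p.1 - p.2) * φ p.1))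
        (volume.prod volume) := fun k hk =>
    hg.1.comp_snd.mul ((hk.comp (measurable_fst.sub measurable_snd)).aestronglyMeasurable.mul
      (hφ.1.continuous.comp continuous_fst).aestronglyMeasurable)
  have hT := tendsto_integral_of_dominated_convergence D (fun n => hmeas _ (hκ n)) hDi
    (fun n => hbound _ (hb n)) (f := fun p : Plane × Plane => g p.2 * (κ' (p.1 - p.2) * φ p.1)) (by
      filter_upwards [hne] with p hp
      exact ((hlim _ hp).mul_const _).const_mul _)
  have hi : ∀ n, Integrable (fun p : Plane × Plane => g p.2 * (κ n (p.1 - p.2) * φ p.1))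
      (volume.prod volume) := fun n => hDi.mono' (hmeas _ (hκ n)) (hbound _ (hb n))
  have hi' : Integrable (fun p : Plane × Plane => g p.2 * (κ' (p.1 - p.2) * φ p.1))
      (volume.prod volume) := hDi.mono' (hmeas _ hκ') (hbound _ hb')
  rw [integral_prod _ hi'] at hT
  simp_rw [fun n => integral_prod_symm _ (hi n), integral_const_mul] at hT
  convert hT using 3
  funext x
  rw [← integral_const_mul]
  congr 1
  funext y
  ring

theorem tendsto_inv_succ_nhdsGT : Tendsto (fun n : ℕ => 1 / ((n : ℝ) + 1)) atTop (𝓝[>] 0) :=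
  tendsto_nhdsWithin_iff.2 ⟨tendsto_one_div_succ, Eventually.of_forall fun n => by
    simp only [Set.mem_Ioi]; positivity⟩

theorem inv_succ_mem (n : ℕ) : 0 < 1 / ((n : ℝ) + 1) ∧ 1 / ((n : ℝ) + 1) ≤ 1 := by
  refine ⟨by positivity, ?_⟩
  rw [div_le_one (by positivity)]
  have : (0 : ℝ) ≤ n := Nat.cast_nonneg n
  linarith

theorem abs_logKer_le {ε : ℝ} (hε : 0 < ε) (hε1 : ε ≤ 1) {z : Plane} (hz : z ≠ 0)
    (hz2 : ‖z‖ < 2) : |logKer ε z| ≤ 4 * ‖z‖⁻¹ := by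
  have h0 : 0 < ‖z‖ := norm_pos_iff.2 hz
  have hinv : 1 / 2 ≤ ‖z‖⁻¹ := by
    rw [← one_div]; exact one_div_le_one_div_of_le h0 hz2.le
  have h1 : Real.log (‖z‖ ^ 2 + ε ^ 2) ≤ ‖z‖ ^ 2 + ε ^ 2 - 1 :=
    Real.log_le_sub_one_of_pos (by positivity)
  have h2 : Real.log (‖z‖ ^ 2) ≤ Real.log (‖z‖ ^ 2 + ε ^ 2) :=
    Real.log_le_log (by positivity) (by nlinarith)
  have h3 := Real.one_sub_inv_le_log_of_pos h0
  rw [Real.log_pow] at h2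
  push_cast at h2
  rw [logKer, abs_le]
  constructor <;> nlinarith

theorem abs_log_norm_le {z : Plane} (hz : z ≠ 0) (hz2 : ‖z‖ < 2) :
    |Real.log ‖z‖| ≤ 4 * ‖z‖⁻¹ := by
  have h0 : 0 < ‖z‖ := norm_pos_iff.2 hz
  have hinv : 1 / 2 ≤ ‖z‖⁻¹ := by
    rw [← one_div]; exact one_div_le_one_div_of_le h0 hz2.le
  have h1 := Real.log_le_sub_one_of_pos h0
  have h3 := Real.one_sub_inv_le_log_of_pos h0
  rw [abs_le]
  constructor <;> linarith

theorem tendsto_logKer {z : Plane} (hz : z ≠ 0) :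
    Tendsto (fun n : ℕ => logKer (1 / ((n : ℝ) + 1)) z) atTop (𝓝 (Real.log ‖z‖)) := by
  have h0 : 0 < ‖z‖ := norm_pos_iff.2 hz
  have h1 : Tendsto (fun n : ℕ => ‖z‖ ^ 2 + (1 / ((n : ℝ) + 1)) ^ 2) atTop (𝓝 (‖z‖ ^ 2)) := by
    simpa using (tendsto_one_div_succ.pow 2).const_add (‖z‖ ^ 2)
  have h2 := (h1.log (by positivity)).div_const 2
  rw [Real.log_pow] at h2
  simpa [logKer] using h2

theorem pot_eq (ε : ℝ) (φ : Plane → ℝ) (y : Plane) : pot ε φ y = ∫ x, logKer ε (x - y) * φ x := by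
  rw [pot_apply, ← integral_sub_left_eq_self (fun x => logKer ε (x - y) * φ x) volume y]
  refine integral_congr_ae (ae_of_all _ fun t => ?_)
  simp [logKer]

/-- The gradient of the logarithmic potential. -/
noncomputable def gradPot (g : Plane → ℝ) (k : Fin 2) (x : Plane) : ℝ :=
  ∫ y, (x - y) k / ‖x - y‖ ^ 2 * g y

variable {v g φ : Plane → ℝ}

/-- The regularized potential of `φ` is itself used as test function in the equation for `v`. It has
no compact support, which is why the equation is assumed for all smooth `Φ`. -/
theorem tendsto_integral_mul_pot (hv : Integrable v)
    (hvg : ∀ Φ : Plane → ℝ, ContDiff ℝ ∞ Φ →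
      ∫ x, v x * ∑ k, partialDeriv k (partialDeriv k Φ) x = ∫ x, g x * Φ x)
    (hφ : IsTestFunction D2 φ) :
    Tendsto (fun n : ℕ => ∫ y, g y * pot (1 / ((n : ℝ) + 1)) φ y) atTop
      (𝓝 (diracMass * ∫ x, v x * φ x)) := by
  obtain ⟨M, hM0, hM⟩ := exists_abs_le_of_hasCompactSupport hφ.1.continuous hφ.2.1
  have hs := fun n : ℕ => contDiff_pot (inv_succ_mem n).1 hφ.1 hφ.2.1
  simp_rw [← fun n : ℕ => hvg _ (hs n)]
  rw [← integral_const_mul]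
  refine tendsto_integral_of_dominated_convergence (fun x => |v x| * (diracMass * M)) (fun n => ?_)
    (hv.abs.mul_const _) (fun n => ae_of_all _ fun x => ?_) (ae_of_all _ fun x => ?_)
  · exact hv.1.mul (continuous_finsetSum _ fun k _ => (contDiff_partialDeriv
      (contDiff_partialDeriv (hs n) k) k).continuous).aestronglyMeasurable
  · rw [Real.norm_eq_abs, abs_mul]
    exact mul_le_mul_of_nonneg_left
      (abs_sum_partialDeriv_pot_le (inv_succ_mem n).1 hφ.1 hφ.2.1 hM x) (abs_nonneg _)
  · have := ((tendsto_sum_partialDeriv_pot hφ.1 hφ.2.1 x).comp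
      tendsto_inv_succ_nhdsGT).const_mul (v x)
    simpa [Function.comp_def, mul_left_comm] using this

/-- Two evaluations of one limit: moving the Laplacian to `v` produces `diracMass · φ`, and letting
the kernel converge produces the logarithmic potential. -/
theorem integral_logPot (hv : Integrable v) (hg : Integrable g) (hg0 : ∀ x ∉ D2, g x = 0)
    (hvg : ∀ Φ : Plane → ℝ, ContDiff ℝ ∞ Φ →
      ∫ x, v x * ∑ k, partialDeriv k (partialDeriv k Φ) x = ∫ x, g x * Φ x)
    (hφ : IsTestFunction D2 φ) :
    diracMass * ∫ x, v x * φ x = ∫ x, φ x * logPot g x := by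
  refine tendsto_nhds_unique (tendsto_integral_mul_pot hv hvg hφ) ?_
  simp_rw [pot_eq]
  exact tendsto_integral_kernel (κ := fun n => logKer (1 / ((n : ℝ) + 1)))
    (κ' := fun z => Real.log ‖z‖) (C := 4)
    (fun n => (contDiff_logKer (inv_succ_mem n).1).continuous.measurable)
    (Real.measurable_log.comp measurable_norm)
    (fun n z hz hz2 => abs_logKer_le (inv_succ_mem n).1 (inv_succ_mem n).2 hz hz2)
    (fun z hz hz2 => abs_log_norm_le hz hz2) (fun z hz => tendsto_logKer hz) hg hg0 hφ

theorem partialDeriv_pot_eq {ε : ℝ} (hε : 0 < ε) (hφ : IsTestFunction D2 φ) (k : Fin 2)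
    (y : Plane) : pot ε (partialDeriv k φ) y = ∫ x, -((x - y) k / (‖x - y‖ ^ 2 + ε ^ 2)) * φ x := by
  rw [← partialDeriv_pot hε hφ.1 hφ.2.1, partialDeriv_pot_apply hε hφ.1 hφ.2.1,
    ← integral_sub_left_eq_self (fun x => -((x - y) k / (‖x - y‖ ^ 2 + ε ^ 2)) * φ x) volume y]
  refine integral_congr_ae (ae_of_all _ fun t => ?_)
  simp [partialDeriv_logKer hε, neg_div]

theorem integral_gradPot (hv : Integrable v) (hg : Integrable g) (hg0 : ∀ x ∉ D2, g x = 0)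
    (hvg : ∀ Φ : Plane → ℝ, ContDiff ℝ ∞ Φ →
      ∫ x, v x * ∑ k, partialDeriv k (partialDeriv k Φ) x = ∫ x, g x * Φ x)
    (hφ : IsTestFunction D2 φ) (k : Fin 2) :
    diracMass * ∫ x, v x * partialDeriv k φ x = - ∫ x, φ x * gradPot g k x := by
  refine tendsto_nhds_unique (tendsto_integral_mul_pot hv hvg (hφ.partialDeriv k)) ?_
  simp_rw [fun (n : ℕ) y => partialDeriv_pot_eq (inv_succ_mem n).1 hφ k y]
  have hm : Measurable fun z : Plane => z k := (EuclideanSpace.proj (𝕜 := ℝ) k).continuous.measurable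
  have hlim := tendsto_integral_kernel
    (κ := fun n z => -(z k / (‖z‖ ^ 2 + (1 / ((n : ℝ) + 1)) ^ 2)))
    (κ' := fun z => -(z k / ‖z‖ ^ 2)) (C := 1)
    (fun n => (hm.div ((measurable_norm.pow_const 2).add_const _)).neg)
    (hm.div (measurable_norm.pow_const 2)).neg
    (fun n z hz hz2 => by
      rw [abs_neg, one_mul, ← partialDeriv_logKer (inv_succ_mem n).1]
      exact abs_partialDeriv_logKer_le (inv_succ_mem n).1 k z)
    (fun z hz hz2 => by
      have h0 : 0 < ‖z‖ := norm_pos_iff.2 hz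
      rw [abs_neg, abs_div, abs_of_nonneg (sq_nonneg ‖z‖), one_mul, div_le_iff₀ (by positivity)]
      calc |z k| ≤ ‖z‖ := abs_apply_le_norm z k
        _ = ‖z‖⁻¹ * ‖z‖ ^ 2 := by field_simp)
    (fun z hz => by
      have h0 : 0 < ‖z‖ := norm_pos_iff.2 hz
      have h1 : Tendsto (fun n : ℕ => ‖z‖ ^ 2 + (1 / ((n : ℝ) + 1)) ^ 2) atTop (𝓝 (‖z‖ ^ 2)) := by
        simpa using (tendsto_one_div_succ.pow 2).const_add (‖z‖ ^ 2)
      exact (tendsto_const_nhds.div h1 (by positivity)).neg) hg hg0 hφ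
  convert hlim using 2
  rw [← integral_neg]
  refine integral_congr_ae (ae_of_all _ fun x => ?_)
  simp only [gradPot, neg_mul, integral_neg, mul_neg]

end Representation

/-! ### Integrability of the gradient of the logarithmic potential. -/

section GradientPotential

variable {S : Set Plane} {g : Plane → ℝ}

theorem enorm_gradPot_le (hg : Integrable g) (k : Fin 2) (x : Plane) :
    ‖gradPot g k x‖ₑ ≤ ∫⁻ y, ENNReal.ofReal (‖x - y‖ ^ (-(1 : ℝ))) ∂absMeasure g := by
  rw [lintegral_absMeasure hg (measurable_riesz x _) fun y => by positivity]
  refine (enorm_integral_le_lintegral_enorm _).trans (lintegral_mono_ae ?_)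
  filter_upwards [ae_ne_plane x] with y hy
  rw [Real.enorm_eq_ofReal_abs]
  refine ENNReal.ofReal_le_ofReal ?_
  rw [abs_mul, abs_div, abs_of_nonneg (sq_nonneg ‖x - y‖), Real.rpow_neg_one]
  refine mul_le_mul_of_nonneg_right ?_ (abs_nonneg _)
  rw [div_le_iff₀ (by positivity)]
  calc |(x - y) k| ≤ ‖x - y‖ := abs_apply_le_norm _ k
    _ = ‖x - y‖⁻¹ * ‖x - y‖ ^ 2 := by field_simp

theorem aestronglyMeasurable_gradPot (hg : Integrable g) (k : Fin 2) :
    AEStronglyMeasurable (gradPot g k) volume := by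
  have hm : Measurable fun z : Plane => z k := (EuclideanSpace.proj (𝕜 := ℝ) k).continuous.measurable
  have hk : Measurable fun z : Plane => z k / ‖z‖ ^ 2 := hm.div (measurable_norm.pow_const 2)
  have : AEStronglyMeasurable (fun p : Plane × Plane => (p.1 - p.2) k / ‖p.1 - p.2‖ ^ 2 * g p.2)
      (volume.prod volume) :=
    (hk.comp (measurable_fst.sub measurable_snd)).aestronglyMeasurable.mul hg.1.comp_snd
  exact this.integral_prod_right'

/-- Hölder's inequality with `|x - y|⁻¹` split into powers `-s` and `-(1 - s)`, where `sp = 3/2`.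
The first factor becomes a kernel of order `-3/2`, locally integrable in the plane; the second has
order `(p - 3/2)/(p - 1) < 1` in absolute value, which Morrey bounds control uniformly in `x`. -/
theorem riesz_rpow_le {ν : Measure Plane} (x : Plane) {p : ℝ} (hp : 2 ≤ p) :
    (∫⁻ y, ENNReal.ofReal (‖x - y‖ ^ (-(1 : ℝ))) ∂ν) ^ p ≤
      (∫⁻ y, ENNReal.ofReal (‖x - y‖ ^ (-(3 / 2 : ℝ))) ∂ν) *
      (∫⁻ y, ENNReal.ofReal (‖x - y‖ ^ (-((p - 3 / 2) / (p - 1)))) ∂ν) ^ (p - 1) := by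
  have hp0 : 0 < p := by linarith
  have hp1 : 0 < p - 1 := by linarith
  set q := p / (p - 1) with hq
  have hpq : p.HolderConjugate q := Real.HolderConjugate.conjExponent (by linarith)
  set s := 3 / (2 * p) with hs
  have hs0 : 0 < s := by positivity
  have hfm : ∀ c : ℝ, AEMeasurable (fun y => ENNReal.ofReal (‖x - y‖ ^ c)) ν := fun c =>
    (measurable_riesz x c).ennreal_ofReal.aemeasurable
  have h := ENNReal.lintegral_mul_le_Lp_mul_Lq ν hpq (hfm (-s)) (hfm (-(1 - s)))
  have e0 : ∀ y, ((fun y => ENNReal.ofReal (‖x - y‖ ^ (-s))) *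
      fun y => ENNReal.ofReal (‖x - y‖ ^ (-(1 - s)))) y =
      ENNReal.ofReal (‖x - y‖ ^ (-(1 : ℝ))) := fun y => by
    rw [Pi.mul_apply, ← ENNReal.ofReal_mul (by positivity), ← Real.rpow_add' (norm_nonneg _)]
    · congr 2; ring
    · have : -s + -(1 - s) = -1 := by ring
      rw [this]; norm_num
  have e1 : ∀ y, ENNReal.ofReal (‖x - y‖ ^ (-s)) ^ p =
      ENNReal.ofReal (‖x - y‖ ^ (-(3 / 2 : ℝ))) := fun y => by
    rw [ENNReal.ofReal_rpow_of_nonneg (by positivity) hp0.le, ← Real.rpow_mul (norm_nonneg _)]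
    congr 2
    rw [hs]; field_simp
  have e2 : ∀ y, ENNReal.ofReal (‖x - y‖ ^ (-(1 - s))) ^ q =
      ENNReal.ofReal (‖x - y‖ ^ (-((p - 3 / 2) / (p - 1)))) := fun y => by
    rw [ENNReal.ofReal_rpow_of_nonneg (by positivity) hpq.symm.nonneg,
      ← Real.rpow_mul (norm_nonneg _)]
    congr 2
    rw [hs, hq]; field_simp
  simp_rw [e0, e1, e2] at h
  refine (ENNReal.rpow_le_rpow h hp0.le).trans (le_of_eq ?_)
  rw [ENNReal.mul_rpow_of_nonneg _ _ hp0.le, ← ENNReal.rpow_mul, ← ENNReal.rpow_mul,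
    one_div_mul_cancel hp0.ne', ENNReal.rpow_one]
  congr 2
  rw [hq]; field_simp

theorem ae_mem_D2_absMeasure (hg0 : ∀ x ∉ D2, g x = 0) : ∀ᵐ y ∂absMeasure g, y ∈ D2 := by
  have h0 : absMeasure g D2ᶜ = 0 := by
    rw [absMeasure, withDensity_apply _ measurableSet_D2.compl]
    refine setLIntegral_eq_zero measurableSet_D2.compl fun y hy => ?_
    simp [hg0 y hy]
  rw [ae_iff]
  exact h0

/-- Tonelli's theorem: the kernel is integrated in `x` first, where its order `3/2 < 2` suffices and
only the total mass of `g` enters. -/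
theorem lintegral_riesz_lt_top (hg : Integrable g) (hg0 : ∀ x ∉ D2, g x = 0) (hS : S ⊆ D2)
    (hSm : MeasurableSet S) :
    ∫⁻ x in S, ∫⁻ y, ENNReal.ofReal (‖x - y‖ ^ (-(3 / 2 : ℝ))) ∂absMeasure g < ⊤ := by
  have := isFiniteMeasure_absMeasure hg
  set κ : Plane → ℝ≥0∞ := fun z =>
    ENNReal.ofReal ((ball (0 : Plane) 2).indicator (fun z => ‖z‖ ^ (-(3 / 2 : ℝ))) z) with hκ
  have hκm : Measurable κ :=
    ((measurable_norm.pow_const _).indicator measurableSet_ball).ennreal_ofReal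
  have hκi : ∫⁻ z, κ z < ⊤ :=
    (integrable_riesz_kernel (by norm_num : (3 / 2 : ℝ) < 2)).lintegral_lt_top
  calc ∫⁻ x in S, ∫⁻ y, ENNReal.ofReal (‖x - y‖ ^ (-(3 / 2 : ℝ))) ∂absMeasure g
      ≤ ∫⁻ x in S, ∫⁻ y, κ (x - y) ∂absMeasure g := by
        refine setLIntegral_mono' hSm fun x hx => lintegral_mono_ae ?_
        filter_upwards [ae_mem_D2_absMeasure hg0] with y hy
        have h1 := hS hx
        rw [D2, mem_ball_zero_iff] at h1 hy
        have hmem : x - y ∈ ball (0 : Plane) 2 :=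
          mem_ball_zero_iff.2 ((norm_sub_le _ _).trans_lt (by linarith))
        rw [hκ]
        simp only
        rw [Set.indicator_of_mem hmem]
    _ ≤ ∫⁻ x, ∫⁻ y, κ (x - y) ∂absMeasure g := setLIntegral_le_lintegral _ _
    _ = ∫⁻ y, (∫⁻ x, κ (x - y)) ∂absMeasure g := lintegral_lintegral_swap
        (hκm.comp (measurable_fst.sub measurable_snd)).aemeasurable
    _ = (∫⁻ z, κ z) * absMeasure g Set.univ := by
        simp_rw [lintegral_sub_right_eq_self]
        rw [lintegral_const]
    _ < ⊤ := ENNReal.mul_lt_top hκi (measure_lt_top _ _)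

theorem MorreyDensity.memLp_gradPot_of_two_le (h : MorreyDensity S g) (hS : S ⊆ D2)
    (hSm : MeasurableSet S) {p : ℝ} (hp : 2 ≤ p) (k : Fin 2) :
    MemLp (gradPot g k) (ENNReal.ofReal p) (volume.restrict S) := by
  have hp0 : 0 < p := by linarith
  have hp1 : 0 < p - 1 := by linarith
  obtain ⟨K, hK0, hK⟩ := h.exists_lintegral_le (β := (p - 3 / 2) / (p - 1))
    (div_pos (by linarith) hp1) (by rw [div_lt_one hp1]; linarith)
  refine ⟨(aestronglyMeasurable_gradPot h.integrable k).restrict, ?_⟩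
  rw [eLpNorm_lt_top_iff_lintegral_rpow_enorm_lt_top (by simpa using hp0) ENNReal.ofReal_ne_top,
    ENNReal.toReal_ofReal hp0.le]
  calc ∫⁻ x in S, ‖gradPot g k x‖ₑ ^ p
      ≤ ∫⁻ x in S, (∫⁻ y, ENNReal.ofReal (‖x - y‖ ^ (-(3 / 2 : ℝ))) ∂absMeasure g) *
          ENNReal.ofReal K ^ (p - 1) := by
        refine setLIntegral_mono' hSm fun x hx => ?_
        refine (ENNReal.rpow_le_rpow (enorm_gradPot_le h.integrable k x) hp0.le).trans ?_
        refine (riesz_rpow_le x hp).trans ?_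
        gcongr
        exact hK x hx
    _ = (∫⁻ x in S, ∫⁻ y, ENNReal.ofReal (‖x - y‖ ^ (-(3 / 2 : ℝ))) ∂absMeasure g) *
          ENNReal.ofReal K ^ (p - 1) :=
        lintegral_mul_const' _ _ (ENNReal.rpow_ne_top_of_nonneg hp1.le ENNReal.ofReal_ne_top)
    _ < ⊤ := ENNReal.mul_lt_top (lintegral_riesz_lt_top h.integrable h.eq_zero hS hSm)
        (ENNReal.rpow_lt_top_of_nonneg hp1.le ENNReal.ofReal_ne_top)

theorem MorreyDensity.memLp_gradPot (h : MorreyDensity S g) (hS : S ⊆ D2)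
    (hSm : MeasurableSet S) {p : ℝ≥0∞} (hp : p ≠ ⊤) (k : Fin 2) :
    MemLp (gradPot g k) p (volume.restrict S) := by
  have : IsFiniteMeasure (volume.restrict S) :=
    ⟨(Measure.restrict_mono hS le_rfl Set.univ).trans_lt (measure_lt_top (volume.restrict D2) _)⟩
  -- The splitting needs an exponent of at least two; smaller ones follow from finite measure.
  refine (h.memLp_gradPot_of_two_le hS hSm (p := max 2 p.toReal) (le_max_left _ _) k).mono_exponent ?_
  conv_lhs => rw [← ENNReal.ofReal_toReal hp]
  exact ENNReal.ofReal_le_ofReal (le_max_right _ _)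

theorem continuousOn_of_holder {w : Plane → ℝ} {S : Set Plane} {K β : ℝ} (hβ : 0 < β)
    (hK : ∀ x ∈ S, ∀ y ∈ S, |w x - w y| ≤ K * ‖x - y‖ ^ β) : ContinuousOn w S := by
  intro x hx
  rw [ContinuousWithinAt, tendsto_iff_dist_tendsto_zero]
  have hlim : Tendsto (fun y => K * ‖y - x‖ ^ β) (𝓝[S] x) (𝓝 0) := by
    have hc : Continuous fun y : Plane => K * ‖y - x‖ ^ β :=
      continuous_const.mul ((continuous_id.sub continuous_const).norm.rpow_const
        fun _ => Or.inr hβ.le)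
    have := (hc.tendsto x).mono_left (nhdsWithin_le_nhds (s := S))
    simpa [Real.zero_rpow hβ.ne'] using this
  refine squeeze_zero' (Eventually.of_forall fun y => dist_nonneg) ?_ hlim
  filter_upwards [self_mem_nhdsWithin] with y hy
  exact hK y hy x hx

theorem MorreyDensity.continuousOn_logPot (h : MorreyDensity S g) (hS : S ⊆ D2) :
    ContinuousOn (logPot g) S := by
  obtain ⟨K, -, hK⟩ := h.exists_holder hS (β := 1 / 2) (by norm_num) (by norm_num)
  exact continuousOn_of_holder (by norm_num) hK

/-- Regularity of a function whose distributional Laplacian satisfies Morrey bounds. -/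
theorem MorreyDensity.ae_eq_logPot {v : Plane → ℝ} (h : MorreyDensity S g) (hS : S ⊆ D2)
    (hSo : IsOpen S) (hv : Integrable v)
    (hvg : ∀ Φ : Plane → ℝ, ContDiff ℝ ∞ Φ →
      ∫ x, v x * ∑ k, partialDeriv k (partialDeriv k Φ) x = ∫ x, g x * Φ x) :
    v =ᵐ[volume.restrict S] fun x => diracMass⁻¹ * logPot g x := by
  have hc := diracMass_pos
  refine ae_eq_of_forall_test hSo (hv.locallyIntegrable.locallyIntegrableOn _)
    (((h.continuousOn_logPot hS).const_mul diracMass⁻¹).locallyIntegrableOn hSo.measurableSet)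
    fun φ hφ => ?_
  rw [setIntegral_mul_test hφ, setIntegral_mul_test hφ]
  have h1 := integral_logPot hv h.integrable h.eq_zero hvg (hφ.mono hS)
  simp_rw [mul_assoc, integral_const_mul]
  rw [eq_inv_mul_iff_mul_eq₀ hc.ne', h1]
  simp_rw [mul_comm]

theorem MorreyDensity.isWeakPartial {v : Plane → ℝ} (h : MorreyDensity S g) (hS : S ⊆ D2)
    (hSo : IsOpen S) (hv : Integrable v)
    (hvg : ∀ Φ : Plane → ℝ, ContDiff ℝ ∞ Φ →
      ∫ x, v x * ∑ k, partialDeriv k (partialDeriv k Φ) x = ∫ x, g x * Φ x) (k : Fin 2) :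
    IsWeakPartial S k v fun x => diracMass⁻¹ * gradPot g k x := by
  have hc := diracMass_pos
  refine ⟨hv.locallyIntegrable.locallyIntegrableOn _, locallyIntegrableOn_of_memLp (p := 2)
    (by norm_num) hSo ((h.memLp_gradPot hS hSo.measurableSet (by norm_num) k).const_mul _),
    fun φ hφ => ?_⟩
  rw [setIntegral_mul_test (hφ.partialDeriv k), setIntegral_mul_test hφ]
  have h1 := integral_gradPot hv h.integrable h.eq_zero hvg (hφ.mono hS) k
  simp_rw [mul_assoc, integral_const_mul]
  rw [← mul_neg, eq_inv_mul_iff_mul_eq₀ hc.ne', h1]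
  simp_rw [mul_comm]

end GradientPotential

/-! ### Construction of Morrey densities and the equation of a cutoff solution. -/

section Localization

variable {S : Set Plane} {f f₁ f₂ b w : Plane → ℝ}

theorem MorreyDensity.add (h₁ : MorreyDensity S f₁) (h₂ : MorreyDensity S f₂) :
    MorreyDensity S fun x => f₁ x + f₂ x := by
  refine ⟨h₁.integrable.add h₂.integrable, fun x hx => by simp [h₁.eq_zero x hx, h₂.eq_zero x hx],
    fun α hα hα1 => ?_⟩
  obtain ⟨C₁, hC₁⟩ := h₁.decay α hα hα1
  obtain ⟨C₂, hC₂⟩ := h₂.decay α hα hα1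
  refine ⟨C₁ + C₂, fun x hx ρ hρ => ?_⟩
  have i1 := h₁.integrable.abs.integrableOn (s := ball x ρ)
  have i2 := h₂.integrable.abs.integrableOn (s := ball x ρ)
  calc ∫ y in ball x ρ, |f₁ y + f₂ y| ≤ ∫ y in ball x ρ, (|f₁ y| + |f₂ y|) :=
        integral_mono (h₁.integrable.add h₂.integrable).abs.integrableOn (i1.add i2)
          fun y => abs_add_le _ _
    _ = (∫ y in ball x ρ, |f₁ y|) + ∫ y in ball x ρ, |f₂ y| := integral_add i1 i2
    _ ≤ (C₁ + C₂) * ρ ^ α := by linarith [hC₁ x hx ρ hρ, hC₂ x hx ρ hρ]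

theorem MorreyDensity.zero : MorreyDensity S fun _ => 0 :=
  ⟨integrable_zero _ _ _, fun _ _ => rfl, fun α _ _ => ⟨0, fun x _ ρ _ => by simp⟩⟩

theorem MorreyDensity.sum {ι : Type*} (s : Finset ι) {f : ι → Plane → ℝ}
    (h : ∀ i, MorreyDensity S (f i)) : MorreyDensity S fun x => ∑ i ∈ s, f i x := by
  classical
  induction s using Finset.induction_on with
  | empty => simpa using MorreyDensity.zero
  | insert i s hi ih => simpa [Finset.sum_insert hi] using (h i).add ih

theorem MorreyDensity.mul (h : MorreyDensity S f) (hb : Continuous b) (hs : HasCompactSupport b) :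
    MorreyDensity S fun x => f x * b x := by
  obtain ⟨M, hM0, hM⟩ := exists_abs_le_of_hasCompactSupport hb hs
  have hi : Integrable fun x => f x * b x := by
    simpa [mul_comm] using h.integrable.bdd_mul hb.aestronglyMeasurable (ae_of_all _ hM)
  refine ⟨hi, fun x hx => by simp [h.eq_zero x hx], fun α hα hα1 => ?_⟩
  obtain ⟨C, hC⟩ := h.decay α hα hα1
  refine ⟨C * M, fun x hx ρ hρ => ?_⟩
  calc ∫ y in ball x ρ, |f y * b y| ≤ ∫ y in ball x ρ, |f y| * M :=
        integral_mono hi.abs.integrableOn (h.integrable.abs.mul_const M).integrableOn fun y => by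
          simp only [abs_mul]
          exact mul_le_mul_of_nonneg_left (hM y) (abs_nonneg _)
    _ = (∫ y in ball x ρ, |f y|) * M := integral_mul_const _ _
    _ ≤ C * M * ρ ^ α := by nlinarith [hC x hx ρ hρ]

/-- Cauchy–Schwarz on each ball; only the factor `w` has to decay, the other contributes its full
`L²` norm. -/
theorem MorreyDensity.of_mul (hf : MemLp f 2 (volume.restrict D2))
    (hw : MemLp w 2 (volume.restrict D2))
    (h : ∀ α : ℝ, 0 < α → α < 1 → ∃ C : ℝ, ∀ x ∈ S, ∀ ρ, 0 < ρ →
      √(∫ y in ball x ρ, D2.indicator (fun y => w y ^ 2) y) ≤ C * ρ ^ α) :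
    MorreyDensity S (D2.indicator fun x => f x * w x) := by
  have hi : Integrable (D2.indicator fun x => f x * w x) :=
    (integrable_indicator_iff measurableSet_D2).2 (integrable_mul_D2 hf hw)
  refine ⟨hi, fun x hx => by simp [hx], fun α hα hα1 => ?_⟩
  obtain ⟨C, hC⟩ := h α hα hα1
  refine ⟨√(∫ y, D2.indicator f y ^ 2) * C, fun x hx ρ hρ => ?_⟩
  have hf' : MemLp (D2.indicator f) 2 := (memLp_indicator_iff_restrict measurableSet_D2).2 hf
  have hw' : MemLp (D2.indicator w) 2 := (memLp_indicator_iff_restrict measurableSet_D2).2 hw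
  have e : ∀ y, |D2.indicator (fun x => f x * w x) y| =
      |D2.indicator f y| * |D2.indicator w y| := fun y => by
    by_cases hy : y ∈ D2 <;> simp [hy, abs_mul]
  have e2 : ∀ y, D2.indicator w y ^ 2 = D2.indicator (fun y => w y ^ 2) y := fun y => by
    by_cases hy : y ∈ D2 <;> simp [hy]
  simp_rw [e]
  refine (integral_abs_mul_le_sqrt (hf'.restrict _) (hw'.restrict _)).trans ?_
  simp_rw [e2]
  rw [mul_assoc]
  refine mul_le_mul (Real.sqrt_le_sqrt ?_) (hC x hx ρ hρ) (Real.sqrt_nonneg _) (Real.sqrt_nonneg _)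
  exact setIntegral_le_integral hf'.integrable_sq (ae_of_all _ fun _ => sq_nonneg _)

/-- Use the area of the ball for `ρ ≤ 1` and the area of the disk for `ρ ≥ 1`. The form `1 ^ 2`
matches `MorreyDensity.of_mul` with `w = 1`, which makes every `L²` function on the disk a Morrey
density. -/
theorem sqrt_setIntegral_indicator_one_le {α : ℝ} (hα : 0 < α) (hα1 : α < 1) (x : Plane) {ρ : ℝ}
    (hρ : 0 < ρ) : √(∫ y in ball x ρ, D2.indicator (fun _ => (1 : ℝ) ^ 2) y) ≤
      √Real.pi * ρ ^ α := by
  have hi : Integrable (D2.indicator fun _ => (1 : ℝ) ^ 2) :=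
    (integrable_indicator_iff measurableSet_D2).2 (integrable_const _)
  have h0 : ∀ y, 0 ≤ D2.indicator (fun _ => (1 : ℝ) ^ 2) y := fun y =>
    Set.indicator_nonneg (fun _ _ => by norm_num) y
  have hle1 : ∫ y in ball x ρ, D2.indicator (fun _ => (1 : ℝ) ^ 2) y ≤ Real.pi * 1 ^ 2 := by
    refine (setIntegral_le_integral hi (ae_of_all _ h0)).trans (le_of_eq ?_)
    rw [integral_indicator measurableSet_D2, ← volume_real_ball_plane 0 zero_le_one]
    simp [D2]
  have hle2 : ∫ y in ball x ρ, D2.indicator (fun _ => (1 : ℝ) ^ 2) y ≤ Real.pi * ρ ^ 2 := by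
    have := isFiniteMeasure_restrict_ball x ρ
    refine (integral_mono hi.integrableOn (integrable_const (1 : ℝ)) fun y => ?_).trans (le_of_eq ?_)
    · by_cases hy : y ∈ D2 <;> simp [hy]
    · rw [← volume_real_ball_plane x hρ.le]
      simp
  have key : ∀ t : ℝ, 0 < t → t ≤ ρ ^ α → ∫ y in ball x ρ, D2.indicator (fun _ => (1 : ℝ) ^ 2) y ≤
      Real.pi * t ^ 2 → √(∫ y in ball x ρ, D2.indicator (fun _ => (1 : ℝ) ^ 2) y) ≤
      √Real.pi * ρ ^ α := fun t ht htρ hle => by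
    refine (Real.sqrt_le_sqrt hle).trans ?_
    rw [Real.sqrt_mul Real.pi_pos.le, Real.sqrt_sq ht.le]
    exact mul_le_mul_of_nonneg_left htρ (Real.sqrt_nonneg _)
  rcases le_total ρ 1 with h | h
  · refine key ρ hρ ?_ hle2
    simpa using Real.rpow_le_rpow_of_exponent_ge hρ h hα1.le
  · exact key 1 one_pos (Real.one_le_rpow h hα.le) hle1

theorem MorreyDensity.of_memLp (hf : MemLp f 2 (volume.restrict D2)) :
    MorreyDensity S (D2.indicator f) := by
  have := MorreyDensity.of_mul (S := S) hf (memLp_const (1 : ℝ)) fun α hα hα1 =>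
    ⟨√Real.pi, fun x _ ρ hρ => sqrt_setIntegral_indicator_one_le hα hα1 x hρ⟩
  simpa using this

theorem Sob.integral_add_eq_zero {u ψ : Plane → ℝ} {U : Fin 2 → Plane → ℝ} (hu : Sob u U)
    (hψ : IsTestFunction D2 ψ) (k : Fin 2) :
    Integrable (fun x => u x * partialDeriv k ψ x + U k x * ψ x) (volume.restrict D2) ∧
      ∫ x in D2, (u x * partialDeriv k ψ x + U k x * ψ x) = 0 := by
  have i1 : Integrable (fun x => u x * partialDeriv k ψ x) (volume.restrict D2) :=
    integrable_mul_test (hu.memLp.integrable (by norm_num)) (hψ.partialDeriv k)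
  have i2 : Integrable (fun x => U k x * ψ x) (volume.restrict D2) :=
    integrable_mul_test ((hu.memLp_grad k).integrable (by norm_num)) hψ
  exact ⟨i1.add i2, by rw [integral_add i1 i2, (hu.weak k).2.2 ψ hψ, neg_add_cancel]⟩

/-- The equation satisfied by the product of a solution with a cutoff function. -/
theorem Sob.integral_cutoff_laplacian {u V ζ : Plane → ℝ} {U : Fin 2 → Plane → ℝ} (hu : Sob u U)
    (hV : Integrable V (volume.restrict D2))
    (h : ∀ φ, IsTestFunction D2 φ →
      ∫ x in D2, ∑ k, U k x * partialDeriv k φ x = ∫ x in D2, V x * φ x)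
    (hζ : IsTestFunction D2 ζ) {Φ : Plane → ℝ} (hΦ : ContDiff ℝ ∞ Φ) :
    ∫ x in D2, u x * ζ x * ∑ k, partialDeriv k (partialDeriv k Φ) x =
      ∫ x in D2, (V x * -ζ x + (∑ k, U k x * (2 * partialDeriv k ζ x)) +
        u x * ∑ k, partialDeriv k (partialDeriv k ζ) x) * Φ x := by
  have t1 : ∀ k, IsTestFunction D2 fun x => partialDeriv k Φ x * ζ x := fun k =>
    hζ.mul_left (contDiff_partialDeriv hΦ k)
  have t2 : ∀ k, IsTestFunction D2 fun x => Φ x * partialDeriv k ζ x := fun k =>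
    (hζ.partialDeriv k).mul_left hΦ
  have t3 : IsTestFunction D2 fun x => Φ x * ζ x := hζ.mul_left hΦ
  have iu : Integrable u (volume.restrict D2) := hu.memLp.integrable (by norm_num)
  have iU : ∀ k, Integrable (U k) (volume.restrict D2) := fun k =>
    (hu.memLp_grad k).integrable (by norm_num)
  have a1 := fun k => hu.integral_add_eq_zero (t1 k) k
  have a2 := fun k => hu.integral_add_eq_zero (t2 k) k
  have i3 : Integrable (fun x => ∑ k, U k x * partialDeriv k (fun x => Φ x * ζ x) x)
      (volume.restrict D2) := integrable_sum_mul_test iU t3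
  have i4 : Integrable (fun x => V x * (Φ x * ζ x)) (volume.restrict D2) :=
    integrable_mul_test hV t3
  have a3 : ∫ x in D2, (V x * (Φ x * ζ x) -
      ∑ k, U k x * partialDeriv k (fun x => Φ x * ζ x) x) = 0 := by
    rw [integral_sub i4 i3, h _ t3, sub_self]
  have d1 : ∀ k x, partialDeriv k (fun x => partialDeriv k Φ x * ζ x) x =
      partialDeriv k Φ x * partialDeriv k ζ x + partialDeriv k (partialDeriv k Φ) x * ζ x :=
    fun k x => partialDeriv_mul (contDiff_partialDeriv hΦ k) hζ.1 k x
  have d2 : ∀ k x, partialDeriv k (fun x => Φ x * partialDeriv k ζ x) x =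
      Φ x * partialDeriv k (partialDeriv k ζ) x + partialDeriv k Φ x * partialDeriv k ζ x :=
    fun k x => partialDeriv_mul hΦ (contDiff_partialDeriv hζ.1 k) k x
  have d3 : ∀ k x, partialDeriv k (fun x => Φ x * ζ x) x =
      Φ x * partialDeriv k ζ x + partialDeriv k Φ x * ζ x :=
    fun k x => partialDeriv_mul hΦ hζ.1 k x
  -- The five null integrals are the weak derivatives `∂ₖu` tested with `ζ∂ₖΦ` and, with a minus
  -- sign, with `Φ∂ₖζ`, followed by the equation tested with `Φζ`.
  refine integral_eq_of_sum (ι := Fin 5) (Φ := ![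
    fun x => u x * partialDeriv 0 (fun x => partialDeriv 0 Φ x * ζ x) x +
      U 0 x * (partialDeriv 0 Φ x * ζ x),
    fun x => u x * partialDeriv 1 (fun x => partialDeriv 1 Φ x * ζ x) x +
      U 1 x * (partialDeriv 1 Φ x * ζ x),
    fun x => -(u x * partialDeriv 0 (fun x => Φ x * partialDeriv 0 ζ x) x +
      U 0 x * (Φ x * partialDeriv 0 ζ x)),
    fun x => -(u x * partialDeriv 1 (fun x => Φ x * partialDeriv 1 ζ x) x +
      U 1 x * (Φ x * partialDeriv 1 ζ x)),
    fun x => V x * (Φ x * ζ x) - ∑ k, U k x * partialDeriv k (fun x => Φ x * ζ x) x]) ?_ ?_ ?_ ?_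
    (ae_of_all _ fun x => ?_)
  · have : ∀ k, Integrable (fun x => u x * (partialDeriv k (partialDeriv k Φ) x * ζ x))
        (volume.restrict D2) := fun k => integrable_mul_test iu
      (hζ.mul_left (contDiff_partialDeriv (contDiff_partialDeriv hΦ k) k))
    refine (integrable_finsetSum Finset.univ fun k _ => this k).congr (ae_of_all _ fun x => ?_)
    simp only [Fin.sum_univ_two]
    ring
  · have j1 : ∀ k, Integrable (fun x => U k x * (Φ x * partialDeriv k ζ x))
        (volume.restrict D2) := fun k => integrable_mul_test (iU k) (t2 k)
    have j2 : ∀ k, Integrable (fun x => u x * (Φ x * partialDeriv k (partialDeriv k ζ) x))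
        (volume.restrict D2) := fun k => integrable_mul_test iu
      (((hζ.partialDeriv k).partialDeriv k).mul_left hΦ)
    refine ((i4.neg.add ((integrable_finsetSum Finset.univ fun k _ => j1 k).const_mul 2)).add
      (integrable_finsetSum Finset.univ fun k _ => j2 k)).congr (ae_of_all _ fun x => ?_)
    simp only [Fin.sum_univ_two, Pi.add_apply, Pi.neg_apply]
    ring
  · intro i
    fin_cases i
    · exact (a1 0).1
    · exact (a1 1).1
    · exact (a2 0).1.neg
    · exact (a2 1).1.neg
    · exact i4.sub i3
  · intro i
    fin_cases i
    · exact (a1 0).2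
    · exact (a1 1).2
    · exact (integral_neg _).trans (by rw [(a2 0).2, neg_zero])
    · exact (integral_neg _).trans (by rw [(a2 1).2, neg_zero])
    · exact a3
  · simp [Fin.sum_univ_succ, d1, d2, d3]
    ring

end Localization

/-! ### Regularity of solutions with decaying energy. -/

section Regularity

variable {m : ℕ} {Ω : Fin 2 → Plane → Matrix (Fin m) (Fin m) ℝ}
  {u : Plane → EuclideanSpace ℝ (Fin m)}

/-- The Dirichlet energy decays locally uniformly like every power less than two of the radius. -/
def EnergyDecay (u : Plane → EuclideanSpace ℝ (Fin m)) : Prop :=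
  ∀ α R : ℝ, 0 < α → α < 1 → R < 1 → ∃ C : ℝ, 0 ≤ C ∧ ∀ p : Plane, ‖p‖ ≤ R → ∀ ρ : ℝ, 0 < ρ →
    √(∫ x in ball p ρ, D2.indicator (energy u) x) ≤ C * ρ ^ α

theorem EnergyDecay.morreyDensity (h : EnergyDecay u) (hu : VecW12 u) {R : ℝ} (hR : R < 1)
    {f : Plane → ℝ} (hf : MemLp f 2 (volume.restrict D2)) (k : Fin 2) (j : Fin m) :
    MorreyDensity (ball 0 R) (D2.indicator fun x => f x * vecGrad u k x j) := by
  refine MorreyDensity.of_mul hf (hu.memLp_vecGrad k j) fun α hα hα1 => ?_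
  obtain ⟨C, -, hC⟩ := h α R hα hα1 hR
  refine ⟨C, fun x hx ρ hρ => le_trans (Real.sqrt_le_sqrt ?_)
    (hC x (mem_ball_zero_iff.1 hx).le ρ hρ)⟩
  have i1 : Integrable (D2.indicator fun y => vecGrad u k y j ^ 2) :=
    (integrable_indicator_iff measurableSet_D2).2 (hu.memLp_vecGrad k j).integrable_sq
  have i2 : Integrable (D2.indicator (energy u)) :=
    (integrable_indicator_iff measurableSet_D2).2 (integrable_energy hu)
  refine integral_mono i1.integrableOn i2.integrableOn fun y => ?_
  refine Set.indicator_le_indicator ?_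
  refine le_trans ?_ (Finset.single_le_sum (f := fun k => ∑ i, vecGrad u k y i ^ 2)
    (fun k _ => Finset.sum_nonneg fun i _ => sq_nonneg _) (Finset.mem_univ k))
  exact Finset.single_le_sum (f := fun i => vecGrad u k y i ^ 2) (fun i _ => sq_nonneg _)
    (Finset.mem_univ j)

theorem EnergyDecay.morreyDensity_vecGrad (h : EnergyDecay u) (hu : VecW12 u) {R : ℝ} (hR : R < 1)
    (k : Fin 2) (j : Fin m) : MorreyDensity (ball 0 R) (D2.indicator fun x => vecGrad u k x j) := by
  simpa using h.morreyDensity hu hR (memLp_const (1 : ℝ)) k j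

theorem EnergyDecay.morreyDensity_potentialTerm (h : EnergyDecay u) (hu : VecW12 u)
    (hΩ : ∀ k, MatMemLp 2 (Ω k)) {R : ℝ} (hR : R < 1) (i : Fin m) :
    MorreyDensity (ball 0 R) (D2.indicator fun x => potentialTerm Ω u x i) := by
  have h1 := MorreyDensity.sum Finset.univ fun k => MorreyDensity.sum Finset.univ fun j =>
    h.morreyDensity hu hR (hΩ k i j) k j
  convert h1 using 1
  funext x
  by_cases hx : x ∈ D2
  · simp [hx, potentialTerm, Matrix.mulVec, dotProduct]
  · simp [hx]

theorem exists_cutoff_ball {R : ℝ} (hR0 : 0 < R) (hR : R < 1) :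
    ∃ ζ, IsTestFunction D2 ζ ∧ ∀ x ∈ ball (0 : Plane) R, ζ x = 1 := by
  let β : ContDiffBump (0 : Plane) := ⟨R, (1 + R) / 2, hR0, by linarith⟩
  refine ⟨β, ⟨β.contDiff, β.hasCompactSupport, ?_⟩, fun x hx =>
    β.one_of_mem_closedBall (ball_subset_closedBall hx)⟩
  rw [β.tsupport_eq]
  exact closedBall_subset_ball (by change (1 + R) / 2 < 1; linarith)

/-- Every component of a solution has a Hölder continuous representative and weak derivatives of all
finite integrabilities on every smaller disk. -/
theorem EnergyDecay.exists_representative (h : EnergyDecay u) (hu : VecW12 u)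
    (hΩ : ∀ k, MatMemLp 2 (Ω k)) (hsol : SolvesSchrodinger Ω u) {R : ℝ} (hR0 : 0 < R) (hR : R < 1)
    (i : Fin m) : ∃ w : Plane → ℝ, (fun x => u x i) =ᵐ[volume.restrict (ball 0 R)] w ∧
      (∀ β : ℝ, 0 < β → β < 1 → ∃ K : ℝ, 0 ≤ K ∧ ∀ x ∈ ball (0 : Plane) R,
        ∀ x' ∈ ball (0 : Plane) R, |w x - w x'| ≤ K * ‖x - x'‖ ^ β) ∧
      ∀ k, ∃ W, IsWeakPartial (ball 0 R) k (fun x => u x i) W ∧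
        ∀ p : ℝ≥0∞, p ≠ ⊤ → MemLp W p (volume.restrict (ball 0 R)) := by
  obtain ⟨ζ, hζ, hζ1⟩ := exists_cutoff_ball hR0 hR
  set ui : Plane → ℝ := fun x => u x i with hui
  have hsob : Sob ui fun k x => vecGrad u k x i := hu.sob i
  set V : Plane → ℝ := fun x => potentialTerm Ω u x i with hV
  have hVi : Integrable V (volume.restrict D2) := integrable_potentialTerm hΩ hu i
  -- This is `Δ(ζu) = ζΔu + 2∇ζ·∇u + uΔζ` with `Δu = -V`; each summand is a Morrey density.
  set g : Plane → ℝ := fun x => D2.indicator V x * -ζ x +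
    (∑ k, D2.indicator (fun x => vecGrad u k x i) x * (2 * partialDeriv k ζ x)) +
      D2.indicator ui x * ∑ k, partialDeriv k (partialDeriv k ζ) x with hg
  set v : Plane → ℝ := fun x => D2.indicator ui x * ζ x with hv
  have hdens : MorreyDensity (ball 0 R) g := by
    refine (MorreyDensity.add ?_ (MorreyDensity.sum _ fun k => ?_)).add ?_
    · exact (h.morreyDensity_potentialTerm hu hΩ hR i).mul hζ.1.continuous.neg hζ.2.1.neg
    · exact (h.morreyDensity_vecGrad hu hR k i).mul
        (continuous_const.mul (hζ.partialDeriv k).1.continuous) (hζ.partialDeriv k).2.1.mul_left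
    · have e : (fun x => D2.indicator ui x * ∑ k, partialDeriv k (partialDeriv k ζ) x) =
          fun x => ∑ k, D2.indicator ui x * partialDeriv k (partialDeriv k ζ) x := by
        funext x; rw [Finset.mul_sum]
      rw [e]
      exact MorreyDensity.sum _ fun k => (MorreyDensity.of_memLp hsob.memLp).mul
        ((hζ.partialDeriv k).partialDeriv k).1.continuous ((hζ.partialDeriv k).partialDeriv k).2.1
  have hvi : Integrable v :=
    ((MorreyDensity.of_memLp (S := ball 0 R) hsob.memLp).mul hζ.1.continuous hζ.2.1).integrable
  have hvg : ∀ Φ : Plane → ℝ, ContDiff ℝ ∞ Φ →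
      ∫ x, v x * ∑ k, partialDeriv k (partialDeriv k Φ) x = ∫ x, g x * Φ x := by
    intro Φ hΦ
    have h1 := hsob.integral_cutoff_laplacian hVi ((solvesSchrodinger_iff hΩ hu).1 hsol i) hζ hΦ
    have e1 : ∫ x in D2, v x * ∑ k, partialDeriv k (partialDeriv k Φ) x =
        ∫ x, v x * ∑ k, partialDeriv k (partialDeriv k Φ) x :=
      setIntegral_eq_integral_of_forall_compl_eq_zero fun x hx => by simp [hv, hx]
    have e2 : ∫ x in D2, g x * Φ x = ∫ x, g x * Φ x :=
      setIntegral_eq_integral_of_forall_compl_eq_zero fun x hx => by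
        rw [hdens.eq_zero x hx, zero_mul]
    rw [← e1, ← e2]
    refine (setIntegral_congr_fun measurableSet_D2 fun x hx => ?_).trans
      (h1.trans (setIntegral_congr_fun measurableSet_D2 fun x hx => ?_))
    · simp [hv, hx]
    · simp [hg, hx]
  have hSD : ball (0 : Plane) R ⊆ D2 := ball_subset_D2 hR
  have hvu : ∀ x ∈ ball (0 : Plane) R, v x = ui x := fun x hx => by
    simp [hv, hSD hx, hζ1 x hx]
  have hvu' : v =ᵐ[volume.restrict (ball 0 R)] ui :=
    (ae_restrict_iff' measurableSet_ball).2 (ae_of_all _ hvu)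
  refine ⟨fun x => diracMass⁻¹ * logPot g x,
    hvu'.symm.trans (hdens.ae_eq_logPot hSD isOpen_ball hvi hvg), fun β hβ hβ1 => ?_, fun k => ?_⟩
  · obtain ⟨K, hK0, hK⟩ := hdens.exists_holder hSD hβ hβ1
    have hc := diracMass_pos
    refine ⟨diracMass⁻¹ * K, by positivity, fun x hx x' hx' => ?_⟩
    rw [← mul_sub, abs_mul, abs_of_pos (by positivity), mul_assoc]
    exact mul_le_mul_of_nonneg_left (hK x hx x' hx') (by positivity)
  · refine ⟨_, ?_, fun p hp => (hdens.memLp_gradPot hSD measurableSet_ball hp k).const_mul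
      diracMass⁻¹⟩
    obtain ⟨l1, l2, l3⟩ := hdens.isWeakPartial hSD isOpen_ball hvi hvg k
    refine ⟨(hsob.weak k).1.mono_set hSD, l2, fun φ hφ => ?_⟩
    rw [← l3 φ hφ]
    exact setIntegral_congr_fun measurableSet_ball fun x hx => by simp [hvu x hx]

theorem EnergyDecay.memW1pLoc (h : EnergyDecay u) (hu : VecW12 u)
    (hΩ : ∀ k, MatMemLp 2 (Ω k)) (hsol : SolvesSchrodinger Ω u) {p : ℝ≥0∞} (hp : p ≠ ⊤)
    (i : Fin m) : MemW1pLoc p D2 fun x => u x i := by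
  intro V hVo _ hVD
  obtain ⟨R₀, hR₀, hVR₀⟩ := exists_lt_subset_ball isClosed_closure hVD
  -- The maximum only guarantees a positive radius.
  set R := max R₀ (1 / 2)
  have hR : R < 1 := max_lt hR₀ (by norm_num)
  have hR0 : 0 < R := lt_of_lt_of_le (by norm_num) (le_max_right _ _)
  have hVR : V ⊆ ball 0 R :=
    subset_closure.trans (hVR₀.trans (ball_subset_ball (le_max_left _ _)))
  obtain ⟨w, hw, hHol, hW⟩ := h.exists_representative hu hΩ hsol hR0 hR i
  have hmono : volume.restrict V ≤ volume.restrict (ball (0 : Plane) R) :=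
    Measure.restrict_mono hVR le_rfl
  have := isFiniteMeasure_restrict_ball 0 R
  refine ⟨?_, fun k => ?_⟩
  · obtain ⟨K, hK0, hK⟩ := hHol (1 / 2) (by norm_num) (by norm_num)
    refine MemLp.mono_measure hmono (MemLp.of_bound (C := |w 0| + K) ?_ ?_)
    · exact (memLp_ball_of_D2 (hu.sob i).memLp hR).1
    · filter_upwards [hw, ae_restrict_mem measurableSet_ball] with x hx hxb
      rw [hx, Real.norm_eq_abs]
      have h1 := hK x hxb 0 (mem_ball_self hR0)
      rw [sub_zero] at h1
      have h2 : ‖x‖ ^ (1 / 2 : ℝ) ≤ 1 :=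
        Real.rpow_le_one (norm_nonneg _) ((mem_ball_zero_iff.1 hxb).le.trans hR.le) (by norm_num)
      have h3 : |w x| ≤ |w 0| + |w x - w 0| := by
        have := abs_add_le (w 0) (w x - w 0)
        simpa using this
      nlinarith
  · obtain ⟨W, hWp, hWm⟩ := hW k
    refine ⟨W, ⟨hWp.1.mono_set hVR, hWp.2.1.mono_set hVR, fun φ hφ => ?_⟩,
      (hWm p hp).mono_measure hmono⟩
    have h1 := hWp.2.2 φ (hφ.mono hVR)
    rw [setIntegral_mul_test ((hφ.mono hVR).partialDeriv k), setIntegral_mul_test (hφ.mono hVR)] at h1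
    rw [setIntegral_mul_test (hφ.partialDeriv k), setIntegral_mul_test hφ, h1]

end Regularity

/-! ### Gluing of the representatives and the Morrey estimate. -/

section Conclusion

variable {m : ℕ} {Ω : Fin 2 → Plane → Matrix (Fin m) (Fin m) ℝ}
  {u : Plane → EuclideanSpace ℝ (Fin m)}

theorem norm_le_sum_abs (x : EuclideanSpace ℝ (Fin m)) : ‖x‖ ≤ ∑ i, |x i| := by
  conv_lhs => rw [← (EuclideanSpace.basisFun (Fin m) ℝ).sum_repr x]
  refine (norm_sum_le _ _).trans (Finset.sum_le_sum fun i _ => ?_)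
  simp [norm_smul]

/-- The representatives on concentric disks are continuous and agree almost everywhere, hence
everywhere, on the smaller disk. They glue to one map on the whole disk, independent of the
exponent. -/
theorem EnergyDecay.locallyHolder (h : EnergyDecay u) (hu : VecW12 u)
    (hΩ : ∀ k, MatMemLp 2 (Ω k)) (hsol : SolvesSchrodinger Ω u) : LocallyHolderAllExponents u := by
  -- The conditions on `R` follow the quantifier over `w`, with the zero function as default, so
  -- that a family indexed by all radii can be chosen.
  have hex : ∀ (R : ℝ) (i : Fin m), ∃ w : Plane → ℝ, 0 < R → R < 1 →
      (fun x => u x i) =ᵐ[volume.restrict (ball 0 R)] w ∧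
      ∀ β : ℝ, 0 < β → β < 1 → ∃ K : ℝ, 0 ≤ K ∧ ∀ x ∈ ball (0 : Plane) R,
        ∀ x' ∈ ball (0 : Plane) R, |w x - w x'| ≤ K * ‖x - x'‖ ^ β := by
    intro R i
    by_cases hR : 0 < R ∧ R < 1
    · obtain ⟨w, hw, hHol, -⟩ := h.exists_representative hu hΩ hsol hR.1 hR.2 i
      exact ⟨w, fun _ _ => ⟨hw, hHol⟩⟩
    · exact ⟨0, fun h1 h2 => absurd ⟨h1, h2⟩ hR⟩
  choose w hw using hex
  have hcont : ∀ R i, 0 < R → R < 1 → ContinuousOn (w R i) (ball 0 R) := fun R i h1 h2 => by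
    obtain ⟨K, -, hK⟩ := (hw R i h1 h2).2 (1 / 2) (by norm_num) (by norm_num)
    exact continuousOn_of_holder (by norm_num) hK
  have hcons : ∀ R R' i, 0 < R → R ≤ R' → R' < 1 → ∀ x ∈ ball (0 : Plane) R,
      w R i x = w R' i x := by
    intro R R' i h1 h2 h3
    have hsub : ball (0 : Plane) R ⊆ ball 0 R' := ball_subset_ball h2
    have hae : w R i =ᵐ[volume.restrict (ball 0 R)] w R' i :=
      (hw R i h1 (by linarith)).1.symm.trans
        (ae_mono (Measure.restrict_mono hsub le_rfl) (hw R' i (by linarith) h3).1)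
    exact Measure.eqOn_open_of_ae_eq hae isOpen_ball (hcont R i h1 (by linarith))
      ((hcont R' i (by linarith) h3).mono hsub)
  -- The radius `(1 + ‖x‖)/2` lies strictly between `‖x‖` and one, so its disk contains `x`.
  set v : Plane → EuclideanSpace ℝ (Fin m) := fun x =>
    WithLp.toLp 2 fun i => w ((1 + ‖x‖) / 2) i x with hv
  have hvw : ∀ R i, 0 < R → R < 1 → ∀ x ∈ ball (0 : Plane) R, v x i = w R i x := by
    intro R i h1 h2 x hx
    have hx1 : ‖x‖ < 1 := (mem_ball_zero_iff.1 hx).trans h2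
    have hx0 := norm_nonneg x
    have hx2 : x ∈ ball (0 : Plane) ((1 + ‖x‖) / 2) := mem_ball_zero_iff.2 (by linarith)
    simp only [hv]
    rcases le_total R ((1 + ‖x‖) / 2) with hle | hle
    · exact (hcons R _ i h1 hle (by linarith) x hx).symm
    · exact hcons _ R i (by linarith) hle h2 x hx2
  refine ⟨v, ?_, fun α hα hα1 K hKc hKD => ?_⟩
  · have hR : ∀ n : ℕ, 0 < 1 - 1 / ((n : ℝ) + 2) ∧ 1 - 1 / ((n : ℝ) + 2) < 1 := fun n => by
      have h0 : (0 : ℝ) ≤ n := Nat.cast_nonneg n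
      refine ⟨?_, by simp; positivity⟩
      rw [sub_pos, div_lt_one (by positivity)]
      linarith
    have hall : ∀ᵐ x : Plane, ∀ (n : ℕ) (i : Fin m), x ∈ ball (0 : Plane) (1 - 1 / ((n : ℝ) + 2)) →
        u x i = w (1 - 1 / ((n : ℝ) + 2)) i x := by
      rw [ae_all_iff]; intro n
      rw [ae_all_iff]; intro i
      exact (ae_restrict_iff' measurableSet_ball).1 (hw _ i (hR n).1 (hR n).2).1
    rw [Filter.EventuallyEq, ae_restrict_iff' measurableSet_D2]
    filter_upwards [hall] with x hx hxD
    rw [D2, mem_ball_zero_iff] at hxD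
    obtain ⟨n, hn⟩ := exists_nat_one_div_lt (sub_pos.2 hxD)
    have hlt : 1 / ((n : ℝ) + 2) ≤ 1 / ((n : ℝ) + 1) :=
      one_div_le_one_div_of_le (by positivity) (by linarith)
    have hmem : x ∈ ball (0 : Plane) (1 - 1 / ((n : ℝ) + 2)) := mem_ball_zero_iff.2 (by linarith)
    ext i
    rw [hvw _ i (hR n).1 (hR n).2 x hmem, hx n i hmem]
  · obtain ⟨R₀, hR₀, hKR₀⟩ := exists_lt_subset_ball hKc.isClosed hKD
    set R := max R₀ (1 / 2)
    have hR : R < 1 := max_lt hR₀ (by norm_num)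
    have hR0 : 0 < R := lt_of_lt_of_le (by norm_num) (le_max_right _ _)
    have hKR : K ⊆ ball 0 R := hKR₀.trans (ball_subset_ball (le_max_left _ _))
    choose c hc0 hc using fun i => (hw R i hR0 hR).2 α (by exact_mod_cast hα) (by exact_mod_cast hα1)
    have hsum : 0 ≤ ∑ i, c i := Finset.sum_nonneg fun i _ => hc0 i
    refine ⟨Real.toNNReal (∑ i, c i), fun x hx y hy => ?_⟩
    have hle : dist (v x) (v y) ≤ (∑ i, c i) * dist x y ^ (α : ℝ) := by
      rw [dist_eq_norm, dist_eq_norm, Finset.sum_mul]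
      refine (norm_le_sum_abs _).trans (Finset.sum_le_sum fun i _ => ?_)
      have h1 := hc i x (hKR hx) y (hKR hy)
      rw [← hvw R i hR0 hR x (hKR hx), ← hvw R i hR0 hR y (hKR hy)] at h1
      simpa using h1
    rw [edist_dist, edist_dist, ENNReal.ofReal_rpow_of_nonneg dist_nonneg α.coe_nonneg]
    refine (ENNReal.ofReal_le_ofReal hle).trans (le_of_eq ?_)
    rw [ENNReal.ofReal_mul hsum]
    rfl

theorem EnergyDecay.morreyDecay (h : EnergyDecay u) (hu : VecW12 u)
    (hΩ : ∀ k, MatMemLp 2 (Ω k)) (hsol : SolvesSchrodinger Ω u) : MorreyDecay u := by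
  obtain ⟨C, hC0, hC⟩ := h (1 / 2) (1 / 2) (by norm_num) (by norm_num) (by norm_num)
  have hdens := fun i => h.morreyDensity_potentialTerm hu hΩ (by norm_num : (1 / 2 : ℝ) < 1) i
  choose c hc using fun i => (hdens i).decay (1 / 2) (by norm_num) (by norm_num)
  have hsub : ∀ p ∈ ball (0 : Plane) (1 / 2), ∀ ρ : ℝ, ρ < 1 / 4 → ‖p‖ + ρ < 1 :=
    fun p hp ρ hρ => by
      have := mem_ball_zero_iff.1 hp
      linarith
  -- Any exponent below one would serve. The first constant is squared because the decay is known
  -- for the square root of the energy, and the Laplacian is `-Ω·∇u`.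
  refine ⟨1 / 2, max (C ^ 2) (∑ i, c i), by norm_num, fun p hp ρ hρ hρ4 => ?_,
    fun x => WithLp.toLp 2 fun i => -potentialTerm Ω u x i, hsol, fun p hp ρ hρ hρ4 => ?_⟩
  · have h1 := hC p (mem_ball_zero_iff.1 hp).le ρ hρ
    rw [setIntegral_ball_indicator (hsub p hp ρ hρ4), Real.sqrt_le_left (by positivity)] at h1
    have h2 : (ρ ^ (1 / 2 : ℝ)) ^ 2 = ρ ^ (2 * (1 / 2) : ℝ) := by
      rw [← Real.rpow_natCast, ← Real.rpow_mul hρ.le]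
      norm_num
    refine h1.trans ?_
    rw [mul_pow, h2]
    exact mul_le_mul_of_nonneg_right (le_max_left _ _) (by positivity)
  · have hr : volume.restrict (ball p ρ) ≤ volume.restrict D2 :=
      Measure.restrict_mono (ball_subset_D2' (hsub p hp ρ hρ4)) le_rfl
    have hi : ∀ i, Integrable (fun x => |potentialTerm Ω u x i|) (volume.restrict (ball p ρ)) :=
      fun i => ((integrable_potentialTerm hΩ hu i).mono_measure hr).abs
    calc ∫ x in ball p ρ, ‖(WithLp.toLp 2 fun i => -potentialTerm Ω u x i :
          EuclideanSpace ℝ (Fin m))‖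
        ≤ ∫ x in ball p ρ, ∑ i, |potentialTerm Ω u x i| := by
          refine integral_mono_of_nonneg (ae_of_all _ fun x => norm_nonneg _)
            (integrable_finsetSum _ fun i _ => hi i) (ae_of_all _ fun x => ?_)
          refine (norm_le_sum_abs _).trans (le_of_eq ?_)
          simp
      _ = ∑ i, ∫ x in ball p ρ, |potentialTerm Ω u x i| := integral_finsetSum _ fun i _ => hi i
      _ ≤ ∑ i, c i * ρ ^ (1 / 2 : ℝ) := by
          refine Finset.sum_le_sum fun i _ => le_trans (le_of_eq ?_) (hc i p hp ρ hρ)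
          refine setIntegral_congr_fun measurableSet_ball fun x hx => ?_
          simp [ball_subset_D2' (hsub p hp ρ hρ4) hx]
      _ = (∑ i, c i) * ρ ^ (1 / 2 : ℝ) := by rw [Finset.sum_mul]
      _ ≤ max (C ^ 2) (∑ i, c i) * ρ ^ (1 / 2 : ℝ) :=
          mul_le_mul_of_nonneg_right (le_max_right _ _) (by positivity)

end Conclusion

end SchrodingerSystem

theorem mainTheorem3 (m : ℕ)
    (Ω : Fin 2 → SchrodingerSystem.Plane → Matrix (Fin m) (Fin m) ℝ)
    (hΩ : ∀ k, SchrodingerSystem.MatMemLp 2 (Ω k))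
    (hΩ_so : ∀ᵐ x ∂volume.restrict SchrodingerSystem.D2, ∀ k, (Ω k x)ᵀ = -Ω k x)
    (A B : SchrodingerSystem.Plane → Matrix (Fin m) (Fin m) ℝ)
    (hA : SchrodingerSystem.MatW12 A) (hB : SchrodingerSystem.MatW12 B)
    (hAB : ∀ᵐ x ∂volume.restrict SchrodingerSystem.D2, ∀ k,
      SchrodingerSystem.matGrad A k x - A x * Ω k x = -SchrodingerSystem.matGradPerp B k x)
    (hA_unit : ∀ᵐ x ∂volume.restrict SchrodingerSystem.D2, IsUnit (A x))
    (hA_bdd : SchrodingerSystem.MatMemLp ⊤ A)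
    (hA_inv_bdd : SchrodingerSystem.MatMemLp ⊤ fun x => (A x)⁻¹)
    (u : SchrodingerSystem.Plane → EuclideanSpace ℝ (Fin m))
    (hu : SchrodingerSystem.VecW12 u) :
    (SchrodingerSystem.SolvesSchrodinger Ω u ↔ SchrodingerSystem.ConservationLaw A B u) ∧
    (SchrodingerSystem.ConservationLaw A B u →
      (∀ p : ℝ≥0∞, 1 ≤ p → p ≠ ⊤ →
        ∀ i, SchrodingerSystem.MemW1pLoc p SchrodingerSystem.D2 fun x => u x i) ∧
      SchrodingerSystem.LocallyHolderAllExponents u ∧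
      SchrodingerSystem.MorreyDecay u) := by
  refine ⟨SchrodingerSystem.solvesSchrodinger_iff_conservationLaw hΩ hA hB hAB hA_unit hA_bdd
    hA_inv_bdd hu, fun hcons => ?_⟩
  have hsol := (SchrodingerSystem.solvesSchrodinger_iff_conservationLaw hΩ hA hB hAB hA_unit hA_bdd
    hA_inv_bdd hu).2 hcons
  have hdecay : SchrodingerSystem.EnergyDecay u := fun α R hα hα1 hR =>
    SchrodingerSystem.exists_energy_decay hA hB hu hA_unit hA_bdd hA_inv_bdd hcons hα hα1 hR
  exact ⟨fun p _ hp i => hdecay.memW1pLoc hu hΩ hsol hp i, hdecay.locallyHolder hu hΩ hsol,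
    hdecay.morreyDecay hu hΩ hsol⟩
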